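/- Let $n\ge 1$, let $\tilde\nabla$ be the standard flat connection on $\mathbb{R}^{n+1}$ and $\omega$ a nonzero constant $(n+1)$-form. Let $M$ be a compact smooth $n$-manifold without boundary, with an equiaffine structure $(\nabla,\theta)$: a smooth torsion-free affine connection and a nowhere vanishing smooth $n$-form with $\nabla\theta=0$; $M$ is oriented by $\theta$. Let $f:(M,\nabla,\theta)\to(\mathbb{R}^{n+1},\tilde\nabla,\omega)$ be an equiaffine immersion, that is, a smooth immersion for which there is a smooth vector field $\xi:M\to\mathbb{R}^{n+1}$ along $f$, everywhere transversal to $df(TM)$, such that $$\tilde\nabla_X df(Y)=df(\nabla_XY)+\alpha(X,Y),\qquad \alpha(X,Y)\in\mathbb{R}\,\xi,\qquad \theta(X_1,\dots,X_n)=\omega(df(X_1),\dots,df(X_n),\xi);$$ fix such a $\xi$. For $\phi\in\bigwedge^{n}\mathbb{R}^{n+1}$ let $\tilde h_\phi$ be the linear function $\tilde h_\phi(v)=\omega(\phi\wedge v)$, i.e. $\tilde h_{v_1\wedge\dots\wedge v_n}(v)=\omega(v_1,\dots,v_n,v)$. Let $\omega'$ be the volume element of $\bigwedge^n\mathbb{R}^{n+1}$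 whose value on $(\widehat{v_1}\wedge v_2\wedge\dots\wedge v_{n+1},\dots,v_1\wedge\dots\wedge v_n\wedge\widehat{v_{n+1}})$, where a hat denotes omission, is $(-1)^{n(n+1)/2}$ whenever $\omega(v_1,\dots,v_{n+1})=1$, and let $S=\{\sum_i a_i\zeta_i : \sum_i a_i^2=1\}$ be a unit ellipsoid, where $(\zeta_1,\dots,\zeta_{n+1})$ is a basis of $\bigwedge^n\mathbb{R}^{n+1}$ with $\omega'(\zeta_1,\dots,\zeta_{n+1})=1$. For $p\in M$, $t\in\mathbb{R}$ and a frame $(e_1,\dots,e_n)$ of $T_pM$ with $\theta(e_1,\dots,e_n)=1$ put $$\tilde\nu(p,t)=t\,df(e_1)\wedge\dots\wedge df(e_n),\quad B=\tilde\nu^{-1}(S)\subset M\times\mathbb{R},\quad G(p,t)=(-1)^n\det\bigl[\tilde h_{\tilde\nu(p,t)}(\alpha(e_i,e_j))\bigr]_{i,j},$$ and let $\omega_B$ be the volume element of $B$ given at $(p,t)$ by $t$ times the pull-back of $\theta$ under the projection $B\to M$. The total absolute curvature of $f$ with respect to $S$ is $$\tau_S(f)=\frac{1}{\operatorname{vol}(\mathcal{S}^{n}(1))}\int_B|G|\,|\omega_B|=\frac{1}{\operatorname{vol}(\mathcal{S}^{n}(1))}\int_M\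 \sum_{t:\,(p,t)\in B}|G(p,t)|\,|t|\;|\theta|(p),$$ where $\operatorname{vol}(\mathcal{S}^{n}(1))$ is the volume of the Euclidean unit sphere in $\mathbb{R}^{n+1}$. If $\tau_S(f)=2$, then $f(M)$ is an embedded convex hypersurface: $f$ is an embedding, and $f(M)$ is the boundary of a compact convex subset of $\mathbb{R}^{n+1}$ with non-empty interior. -/

import Mathlib

open Set Filter Topology MeasureTheory Bundle
open scoped Manifold ContDiff

noncomputable section

namespace EquiaffineHypersurface

/-- The affine space `ℝⁿ⁺¹`. Its norm is used only through the topology and the standard smooth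
structure. Its natural flat connection is the ordinary derivative of vector-valued functions; its
parallel volume elements are the nonzero constant alternating `(n+1)`-forms. -/
abbrev Ambient (n : ℕ) : Type := EuclideanSpace ℝ (Fin (n + 1))

/-! ### Multilinear algebra of the ambient space -/

/-- The height function `v ↦ Ω(φ ∧ v)` attached to `φ ∈ ⋀ⁿ ℝⁿ⁺¹`; on decomposable elements it is
`Ω(v₁, …, vₙ, v)`. -/
def height {n : ℕ} (Ω : Ambient n [⋀^Fin (n + 1)]→ₗ[ℝ] ℝ) :
    ⋀[ℝ]^n (Ambient n) →ₗ[ℝ] (Ambient n →ₗ[ℝ] ℝ) :=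
  exteriorPower.alternatingMapLinearEquiv
    { Ω.toMultilinearMap.curryRight with
      map_eq_zero_of_eq' := by
        intro v i j hij hne
        ext w
        refine Ω.map_eq_zero_of_eq (Fin.snoc v w) (i := i.castSucc) (j := j.castSucc) ?_ ?_
        · simpa using hij
        · simpa using hne }

theorem height_ιMulti {n : ℕ} (Ω : Ambient n [⋀^Fin (n + 1)]→ₗ[ℝ] ℝ)
    (v : Fin n → Ambient n) (w : Ambient n) :
    height Ω (exteriorPower.ιMulti ℝ n v) w = Ω (Fin.snoc v w) := by
  simp only [height, exteriorPower.alternatingMapLinearEquiv_apply_ιMulti]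
  rfl

/-- If `φ = v₁ ∧ ⋯ ∧ vₙ` and `Ω(v₁, …, vₙ, u) = 1`, then the height function of `φ` is the
coordinate along `u` of the projection with respect to `span {v₁, …, vₙ} ⊕ span {u}`. -/
theorem height_eq_coordinate {n : ℕ} (Ω : Ambient n [⋀^Fin (n + 1)]→ₗ[ℝ] ℝ)
    (v : Fin n → Ambient n) (u : Ambient n) (hu : Ω (Fin.snoc v u) = 1)
    (c : Fin n → ℝ) (t : ℝ) :
    height Ω (exteriorPower.ιMulti ℝ n v) (∑ i, c i • v i + t • u) = t := by
  have h0 : ∀ i, height Ω (exteriorPower.ιMulti ℝ n v) (v i) = 0 := by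
    intro i
    rw [height_ιMulti]
    refine Ω.map_eq_zero_of_eq _ (i := i.castSucc) (j := Fin.last n) ?_ ?_
    · simp
    · exact (Fin.castSucc_lt_last i).ne
  have h1 : height Ω (exteriorPower.ιMulti ℝ n v) u = 1 := by
    rw [height_ιMulti]; exact hu
  rw [map_add, map_sum, map_smul, h1]
  simp [h0]

/-- `Ωn` is the volume element of `⋀ⁿ ℝⁿ⁺¹` induced by `Ω`: for every `v` with
`Ω(v₁, …, vₙ₊₁) = 1`, its value on the family of the products omitting `v₁`, …, `vₙ₊₁` is
`(-1)^((n+1)n/2)`. -/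
def IsInducedVolume {n : ℕ} (Ω : Ambient n [⋀^Fin (n + 1)]→ₗ[ℝ] ℝ)
    (Ωn : (⋀[ℝ]^n (Ambient n)) [⋀^Fin (n + 1)]→ₗ[ℝ] ℝ) : Prop :=
  ∀ v : Fin (n + 1) → Ambient n, Ω v = 1 →
    Ωn (fun i => exteriorPower.ιMulti ℝ n (fun j => v (i.succAbove j))) =
      (-1) ^ ((n + 1) * n / 2)

/-- A unit ellipsoid: the coordinate unit sphere of a basis of `⋀ⁿ ℝⁿ⁺¹` of volume one. -/
def IsUnitEllipsoid {n : ℕ} (Ω : Ambient n [⋀^Fin (n + 1)]→ₗ[ℝ] ℝ)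
    (S : Set (⋀[ℝ]^n (Ambient n))) : Prop :=
  ∃ (Ωn : (⋀[ℝ]^n (Ambient n)) [⋀^Fin (n + 1)]→ₗ[ℝ] ℝ)
    (ζ : Module.Basis (Fin (n + 1)) ℝ (⋀[ℝ]^n (Ambient n))),
    IsInducedVolume Ω Ωn ∧ Ωn ζ = 1 ∧
      S = {φ | ∃ a : Fin (n + 1) → ℝ, ∑ i, a i ^ 2 = 1 ∧ φ = ∑ i, a i • ζ i}

/-! ### Equiaffine structures -/

section Manifold

variable {n : ℕ} {M : Type*} [TopologicalSpace M] [ChartedSpace (EuclideanSpace ℝ (Fin n)) M]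
  [IsManifold (𝓡 n) ∞ M]

/-- `X` is a smooth vector field near `p`. -/
def SmoothFieldAt (X : (q : M) → TangentSpace (𝓡 n) q) (p : M) : Prop :=
  ContMDiffAt (𝓡 n) (𝓡 n).tangent ∞
    (fun q => (⟨q, X q⟩ : TangentBundle (𝓡 n) M)) p

variable (n M) in
/-- An equiaffine structure `(∇, θ)`: a smooth torsion-free affine connection `∇` and a smooth
nowhere vanishing `n`-form `θ` with `∇ θ = 0`. In particular `θ` orients `M`.
In the convention used here `∇_X Y` at `p` is `conn Y p (X p)`. -/
structure EquiaffineStructure where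
  /-- the connection `∇` -/
  conn : CovariantDerivative (𝓡 n) (EuclideanSpace ℝ (Fin n)) (TangentSpace (𝓡 n) : M → Type)
  /-- the volume element `θ` -/
  vol : (p : M) → (TangentSpace (𝓡 n) p) [⋀^Fin n]→ₗ[ℝ] ℝ
  conn_smooth : CovariantDerivative.ContMDiffCovariantDerivative conn ∞
  conn_torsionFree : conn.torsion = 0
  vol_smooth : ∀ (p : M) (X : Fin n → (q : M) → TangentSpace (𝓡 n) q),
    (∀ i, SmoothFieldAt (X i) p) →
      ContMDiffAt (𝓡 n) 𝓘(ℝ, ℝ) ∞ (fun q => vol q (fun i => X i q)) p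
  vol_ne_zero : ∀ p, vol p ≠ 0
  vol_parallel : ∀ (p : M) (u : TangentSpace (𝓡 n) p)
    (X : Fin n → (q : M) → TangentSpace (𝓡 n) q), (∀ i, SmoothFieldAt (X i) p) →
      mvfderiv (𝓡 n) (fun q => vol q (fun i => X i q)) p u =
        ∑ i, vol p (Function.update (fun j => X j p) i (conn (X i) p u))

/-- The component `α(X, Y) = ∇̃_X df(Y) - df(∇_X Y)` at `p`, for a vector `u = X p` and a vector
field `Y` near `p`. -/
def gaussDefect (A : EquiaffineStructure n M) (f : M → Ambient n) (p : M)
    (u : TangentSpace (𝓡 n) p) (Y : (q : M) → TangentSpace (𝓡 n) q) : Ambient n :=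
  mvfderiv (𝓡 n) (fun q => mvfderiv (𝓡 n) f q (Y q)) p u -
    mvfderiv (𝓡 n) f p (A.conn Y p u)

/-- `f : (M, ∇, θ) → (ℝⁿ⁺¹, ∇̃, Ω)` is an equiaffine immersion, with `(∇, θ)` induced by the pair
`(N, θ⊥)`. In codimension one such a pair is the same thing as a transversal vector field `ξ`:
`N` is the line bundle spanned by `ξ`, and `θ⊥(ξ) = 1`. -/
structure IsEquiaffineImmersion (Ω : Ambient n [⋀^Fin (n + 1)]→ₗ[ℝ] ℝ)
    (A : EquiaffineStructure n M) (f ξ : M → Ambient n) : Prop where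
  smooth : ContMDiff (𝓡 n) 𝓘(ℝ, Ambient n) ∞ f
  immersion : ∀ p, Function.Injective (mvfderiv (𝓡 n) f p)
  transversal_smooth : ContMDiff (𝓡 n) 𝓘(ℝ, Ambient n) ∞ ξ
  transversal : ∀ p, ξ p ∉ Set.range (mvfderiv (𝓡 n) f p)
  induces_conn : ∀ (p : M) (u : TangentSpace (𝓡 n) p) (Y : (q : M) → TangentSpace (𝓡 n) q),
    SmoothFieldAt Y p → gaussDefect A f p u Y ∈ Submodule.span ℝ {ξ p}
  induces_vol : ∀ (p : M) (e : Fin n → TangentSpace (𝓡 n) p),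
    A.vol p e = Ω (Fin.snoc (fun i => mvfderiv (𝓡 n) f p (e i)) (ξ p))

/-- The `N`-valued affine fundamental form `α` at `p`; the second vector is extended to a smooth
vector field near `p`, the result being independent of the extension. -/
def affineFundamentalForm (A : EquiaffineStructure n M) (f : M → Ambient n) (p : M)
    (u w : TangentSpace (𝓡 n) p) : Ambient n :=
  gaussDefect A f p u (FiberBundle.extend (EuclideanSpace ℝ (Fin n)) w)

/-! ### Gauss map, transversal ellipsoid bundle, Lipschitz-Killing curvature

In codimension one `⋀ʳ⁻¹ N` is the trivial line bundle `M × ℝ`. -/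

/-- A frame `e` of `T_p M` with `θ(e₁, …, eₙ) = 1`. -/
def unimodularFrame (A : EquiaffineStructure n M) (p : M) : Fin n → TangentSpace (𝓡 n) p :=
  Classical.epsilon fun e => A.vol p e = 1

theorem vol_unimodularFrame (hn : 0 < n) (A : EquiaffineStructure n M) (p : M) :
    A.vol p (unimodularFrame A p) = 1 := by
  have h : ∃ v, A.vol p v ≠ 0 := by
    by_contra! h
    exact A.vol_ne_zero p (AlternatingMap.ext h)
  obtain ⟨v, hv⟩ := h
  refine Classical.epsilon_spec (p := fun e => A.vol p e = 1)
    ⟨Function.update v ⟨0, hn⟩ ((A.vol p v)⁻¹ • v ⟨0, hn⟩), ?_⟩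
  rw [AlternatingMap.map_update_smul, Function.update_eq_self, smul_eq_mul, inv_mul_cancel₀ hv]

/-- The map `ν̃(p, t) = t • df(e₁) ∧ ⋯ ∧ df(eₙ)`, for a frame with `θ(e₁, …, eₙ) = 1`. -/
def gaussMap (A : EquiaffineStructure n M) (f : M → Ambient n) (η : M × ℝ) :
    ⋀[ℝ]^n (Ambient n) :=
  η.2 • exteriorPower.ιMulti ℝ n (fun i => mvfderiv (𝓡 n) f η.1 (unimodularFrame A η.1 i))

/-- The transversal ellipsoid bundle `B`. -/
def ellipsoidBundle (A : EquiaffineStructure n M) (f : M → Ambient n)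
    (S : Set (⋀[ℝ]^n (Ambient n))) : Set (M × ℝ) :=
  gaussMap A f ⁻¹' S

/-- The Lipschitz-Killing curvature `G(η) = (-1)ⁿ det [h_η(α(eᵢ, eⱼ))]`. -/
def lipschitzKilling (Ω : Ambient n [⋀^Fin (n + 1)]→ₗ[ℝ] ℝ) (A : EquiaffineStructure n M)
    (f : M → Ambient n) (η : M × ℝ) : ℝ :=
  (-1) ^ n * (Matrix.of fun i j : Fin n =>
    height Ω (gaussMap A f η)
      (affineFundamentalForm A f η.1 (unimodularFrame A η.1 i) (unimodularFrame A η.1 j))).det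

/-- The measure `|θ|` on the domain of the preferred chart at `x`, extended by zero. -/
def chartVolume [MeasurableSpace M] (A : EquiaffineStructure n M) (x : M) : Measure M :=
  Measure.map (chartAt (EuclideanSpace ℝ (Fin n)) x).symm
    ((volume.restrict (chartAt (EuclideanSpace ℝ (Fin n)) x).target).withDensity fun y =>
      ENNReal.ofReal |A.vol ((chartAt (EuclideanSpace ℝ (Fin n)) x).symm y) fun i =>
        mfderiv (𝓡 n) (𝓡 n) (chartAt (EuclideanSpace ℝ (Fin n)) x).symm y
          (EuclideanSpace.single i (1 : ℝ) : EuclideanSpace ℝ (Fin n))|)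

/-- The measure `|θ|` on `M`. The chart measures are its restrictions to the chart domains, so it
is their supremum. -/
def volumeMeasure [MeasurableSpace M] (A : EquiaffineStructure n M) : Measure M :=
  ⨆ x : M, chartVolume A x

/-- The total absolute curvature `τ_S(f) = vol(Sⁿ)⁻¹ ∫_B |G| ω_B`.
The volume element of `B` at `(p, t)` is `t • π^* θ`, the one with `ν^* ω_S = G • ω_B`;
here the integral over `B` is written as the integral over `M` of the sum over the
(two-point) fibres. -/
def totalAbsoluteCurvature [MeasurableSpace M] (Ω : Ambient n [⋀^Fin (n + 1)]→ₗ[ℝ] ℝ)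
    (A : EquiaffineStructure n M) (f : M → Ambient n)
    (S : Set (⋀[ℝ]^n (Ambient n))) : ENNReal :=
  (∫⁻ p, ∑' t : {t : ℝ // (p, t) ∈ ellipsoidBundle A f S},
      ENNReal.ofReal (|lipschitzKilling Ω A f (p, t.1)| * |t.1|) ∂(volumeMeasure A)) /
    (volume : Measure (Ambient n)).toSphere Set.univ

end Manifold

/-- A (closed) convex hypersurface of `ℝⁿ⁺¹`: the boundary of a convex body. -/
def IsConvexHypersurface {n : ℕ} (H : Set (Ambient n)) : Prop :=
  ∃ K : Set (Ambient n), IsCompact K ∧ Convex ℝ K ∧ (interior K).Nonempty ∧ frontier K = H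

end EquiaffineHypersurface

end

noncomputable section

namespace EquiaffineHypersurface

/-! ### Gradient maps with degenerate derivative -/

section Developable

variable {X : Type*} [NormedAddCommGroup X] [InnerProductSpace ℝ X]

/-! The argument is that of Chern and Lashof, carried out on conormals. Let ℓ be the form vanishing
on the tangent hyperplane with ℓ(ξ) = 1 (`conormalField`). The height function of ν̃(p,t) is t·ℓ_p,
so G is, up to powers of t, the determinant of (u,w) ↦ (D_uℓ)(df w), and that determinant is the
Jacobian of the cone map (s,p) ↦ s·ℓ_p. In the coordinates dual to the ellipsoid basis, τ_S(f) = 2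
says that the total area density, divided by n+1, integrates to the volume of the unit ball
(`lintegral_curvatureDensity`).

Every nonzero linear form l attains its maximum on f(M) at some p, and there l is a multiple of ℓ_p.
If an open set V can be avoided by these maximum points, the complement of V already sweeps out the
whole ball (`volume_ball_le`). No curvature is then left for V: it vanishes identically there
(`curvature_eq_zero_of_max_off`). This is used twice.

First use: V is the set of points whose tangent hyperplane has points of f(M) strictly on both
sides. On V the conormal is degenerate, and a Hartman-Nirenberg type argument puts every point of
f(V) at the centre of a straight segment in f(M) along which the tangent hyperplane is constant
(`exists_flat_segment`). Choosing the point of greatest norm among those sharing one tangent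
hyperplane gives a contradiction, so V is empty and every tangent hyperplane supports f(M)
(`supporting`).

Hence f(M) lies in the boundary of its convex hull K, and an interior point o of K lies on no
tangent hyperplane. Radial projection from o is a local homeomorphism on M, and by connectedness of
the punctured space f(M) is all of the boundary (`frontier_hull`).

Second use: a double point has a neighbourhood all of whose points have partners outside it, so the
curvature vanishes at double points. The double points form an open and closed set. Were it
nonempty, every ray from o would meet its image, so every point would be a double point and the
curvature would vanish identically, contradicting τ_S(f) = 2. No connectedness of M and no covering
theory is needed, so n = 1 is included. -/

theorem fderiv_kernelField_apply_self {g V : X → X} {O : Set X} (hO : IsOpen O)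
    (hg : ContDiffOn ℝ ∞ g O) (hV : ContDiffOn ℝ ∞ V O)
    (hsym : ∀ x ∈ O, ∀ a b, inner ℝ (fderiv ℝ g x a) b = inner ℝ a (fderiv ℝ g x b))
    (hker : ∀ x ∈ O, fderiv ℝ g x (V x) = 0) :
    ∀ x ∈ O, (∀ z, fderiv ℝ g x (fderiv ℝ V x z) = -(fderiv ℝ (fderiv ℝ g) x (V x) z)) ∧
      fderiv ℝ g x (fderiv ℝ V x (V x)) = 0 := by
  intro x hx
  have hOx := hO.mem_nhds hx
  have hgx : ContDiffAt ℝ ∞ g x := hg.contDiffAt hOx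
  have hVd : DifferentiableAt ℝ V x := (hV.contDiffAt hOx).differentiableAt (by simp)
  have hA : DifferentiableAt ℝ (fderiv ℝ g) x :=
    (hgx.fderiv_right (m := ∞) (by simp)).differentiableAt (by simp)
  have hsnd : ∀ a b, fderiv ℝ (fderiv ℝ g) x a b = fderiv ℝ (fderiv ℝ g) x b a := by
    have := hgx.isSymmSndFDerivAt (by simp; norm_cast)
    exact fun a b => this a b
  -- Differentiate Dg(V) = 0 in the direction z and use the symmetry of D²g.
  have h1 : ∀ z, fderiv ℝ g x (fderiv ℝ V x z) = -(fderiv ℝ (fderiv ℝ g) x (V x) z) := by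
    intro z
    have h := hA.hasFDerivAt.clm_apply hVd.hasFDerivAt
    have h0 : HasFDerivAt (fun y => fderiv ℝ g y (V y)) (0 : X →L[ℝ] X) x :=
      (hasFDerivAt_const (0 : X) x).congr_of_eventuallyEq
        (by filter_upwards [hOx] with y hy using hker y hy)
    have := congrArg (fun T : X →L[ℝ] X => T z) (h.unique h0)
    simp at this
    rw [hsnd, eq_neg_iff_add_eq_zero]; exact this
  refine ⟨h1, ?_⟩
  rw [h1, neg_eq_zero]
  refine ext_inner_right ℝ fun z => ?_
  -- Each operator D²g(a) is symmetric because Dg is. Hence ⟨D²g(V,V), z⟩ = ⟨V, D²g(V,z)⟩ = -⟨V,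
  -- Dg(DV z)⟩ = -⟨Dg V, DV z⟩ = 0.
  have key : ∀ a b c, inner ℝ (fderiv ℝ (fderiv ℝ g) x a b) c =
      inner ℝ b (fderiv ℝ (fderiv ℝ g) x a c) := by
    intro a b c
    have e1 : HasFDerivAt (fun y => inner ℝ (fderiv ℝ g y b) c)
        ((innerSL ℝ c).comp ((fderiv ℝ (fderiv ℝ g) x).flip b)) x := by
      have := (innerSL ℝ c).hasFDerivAt.comp x
        (hA.hasFDerivAt.clm_apply (hasFDerivAt_const b x))
      refine (this.congr_fderiv ?_).congr_of_eventuallyEq ?_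
      · ext; simp
      · filter_upwards with y; simp [real_inner_comm]
    have e2 : HasFDerivAt (fun y => inner ℝ (fderiv ℝ g y b) c)
        ((innerSL ℝ b).comp ((fderiv ℝ (fderiv ℝ g) x).flip c)) x := by
      have := (innerSL ℝ b).hasFDerivAt.comp x
        (hA.hasFDerivAt.clm_apply (hasFDerivAt_const c x))
      refine (this.congr_fderiv ?_).congr_of_eventuallyEq ?_
      · ext; simp
      · filter_upwards [hOx] with y hy; simpa using hsym y hy b c
    have := congrArg (fun T : X →L[ℝ] ℝ => T a) (e1.unique e2)
    simpa [real_inner_comm] using this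
  rw [key, hsnd, real_inner_comm, inner_zero_left]
  have := h1 z
  rw [hsnd, ← neg_eq_iff_eq_neg] at this
  rw [← this, inner_neg_left, hsym x hx, hker x hx]; simp

/-- The difference W(t) = V(y + tv) - v satisfies W' = -DV(W), because DV(V) = 0, and W(0) = 0.
Grönwall's inequality forces W = 0: the integral curves of V are straight. -/
theorem eq_on_line_of_fderiv_apply_self {V : X → X} {O : Set X} (hO : IsOpen O)
    (hV : ContDiffOn ℝ ∞ V O) (hself : ∀ x ∈ O, fderiv ℝ V x (V x) = 0) {y v : X} (hy : V y = v)
    {b : ℝ} (hline : ∀ t ∈ Icc 0 b, y + t • v ∈ O) :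
    ∀ t ∈ Icc 0 b, V (y + t • v) = v := by
  have hc : ∀ t : ℝ, HasDerivAt (fun t : ℝ => y + t • v) v t := fun t => by
    simpa using ((hasDerivAt_id t).smul_const v).const_add y
  have hd : ∀ t ∈ Icc 0 b, HasDerivAt (fun t : ℝ => V (y + t • v) - v)
      (fderiv ℝ V (y + t • v) v) t := fun t ht =>
    (((hV.contDiffAt (hO.mem_nhds (hline t ht))).differentiableAt
      (by simp)).hasFDerivAt.comp_hasDerivAt t (hc t)).sub_const v
  have hcont : ContinuousOn (fun t : ℝ => fderiv ℝ V (y + t • v)) (Icc 0 b) := by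
    refine (hV.continuousOn_fderiv_of_isOpen hO (by simp)).comp ?_ hline
    exact (continuous_const.add (continuous_id.smul continuous_const)).continuousOn
  obtain ⟨C, hC⟩ := isCompact_Icc.exists_bound_of_continuousOn hcont
  have := eq_zero_of_abs_deriv_le_mul_abs_self_of_eq_zero_right (K := C)
    (f := fun t : ℝ => V (y + t • v) - v)
    (fun t ht => (hd t ht).continuousAt.continuousWithinAt)
    (fun t ht => (hd t (Ico_subset_Icc_self ht)).hasDerivWithinAt) (by simp [hy]) (by
      intro t ht
      have ht' := Ico_subset_Icc_self ht
      have : fderiv ℝ V (y + t • v) v = -fderiv ℝ V (y + t • v) (V (y + t • v) - v) := by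
        rw [map_sub, hself _ (hline t ht')]; simp
      rw [this, norm_neg]
      exact (ContinuousLinearMap.le_opNorm _ _).trans
        (mul_le_mul_of_nonneg_right (hC t ht') (norm_nonneg _)))
  intro t ht
  exact sub_eq_zero.1 (this t ht)

/-- Along the line put J = S⁻¹ and Θ = DV. The hypothesis on S gives J' = ΘJ, and differentiating
DV(V) = 0 gives Θ' = -Θ². So ΘJ is constant and J is affine in t. In particular S⁻¹ stays bounded on
bounded segments, which prevents S from degenerating at an endpoint. -/
theorem inverse_affine_on_line [CompleteSpace X] {V : X → X} {S : X → X →L[ℝ] X} {O : Set X}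
    (hO : IsOpen O) (hV : ContDiffOn ℝ ∞ V O) (hS : ContDiffOn ℝ ∞ S O)
    (hself : ∀ x ∈ O, fderiv ℝ V x (V x) = 0)
    (hunit : ∀ x ∈ O, IsUnit (S x))
    (hSV : ∀ x ∈ O, ∀ z, fderiv ℝ S x (V x) z = -(S x (fderiv ℝ V x z)))
    {y v : X} {b : ℝ} (hline : ∀ t ∈ Icc 0 b, y + t • v ∈ O)
    (hVv : ∀ t ∈ Icc 0 b, V (y + t • v) = v) :
    ∀ t ∈ Icc 0 b, Ring.inverse (S (y + t • v)) =
      Ring.inverse (S y) + t • (fderiv ℝ V y * Ring.inverse (S y)) := by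
  have hc : ∀ t : ℝ, HasDerivAt (fun t : ℝ => y + t • v) v t := fun t => by
    simpa using ((hasDerivAt_id t).smul_const v).const_add y
  set J : ℝ → X →L[ℝ] X := fun t => Ring.inverse (S (y + t • v)) with hJ
  set Θ : ℝ → X →L[ℝ] X := fun t => fderiv ℝ V (y + t • v) with hΘ
  have hJd : ∀ t ∈ Icc 0 b, HasDerivAt J (Θ t * J t) t := by
    intro t ht
    have hx := hline t ht
    obtain ⟨u, hu⟩ := hunit _ hx
    have h1 : HasFDerivAt (𝕜 := ℝ) Ring.inverse
        (-ContinuousLinearMap.mulLeftRight ℝ (X →L[ℝ] X) ↑u⁻¹ ↑u⁻¹) (S (y + t • v)) := by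
      rw [← hu]; exact hasFDerivAt_ringInverse (𝕜 := ℝ) u
    have h2 : HasDerivAt (fun t : ℝ => S (y + t • v)) (fderiv ℝ S (y + t • v) v) t :=
      ((hS.contDiffAt (hO.mem_nhds hx)).differentiableAt
        (by simp)).hasFDerivAt.comp_hasDerivAt t (hc t)
    have h3 := h1.comp_hasDerivAt t h2
    have h4 : fderiv ℝ S (y + t • v) v = -((u : X →L[ℝ] X) * Θ t) := by
      ext z
      have := hSV _ hx z
      rw [hVv t ht] at this
      rw [this, ← hu]; rfl
    refine h3.congr_deriv ?_
    have h5 : J t = ↑u⁻¹ := by simp only [hJ, ← hu, Ring.inverse_unit]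
    rw [h4, h5]
    change -((↑u⁻¹ : X →L[ℝ] X) * -((u : X →L[ℝ] X) * Θ t) * (↑u⁻¹ : X →L[ℝ] X)) = _
    rw [mul_neg, neg_mul, neg_neg, ← mul_assoc, Units.inv_mul, one_mul]
  have hΘd : ∀ t ∈ Icc 0 b, HasDerivAt Θ (-(Θ t * Θ t)) t := by
    intro t ht
    have hx := hline t ht
    have hOx := hO.mem_nhds hx
    have hVx := hV.contDiffAt hOx
    have hVd : DifferentiableAt ℝ V (y + t • v) := hVx.differentiableAt (by simp)
    have hA : DifferentiableAt ℝ (fderiv ℝ V) (y + t • v) :=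
      (hVx.fderiv_right (m := ∞) (by simp)).differentiableAt (by simp)
    have h := hA.hasFDerivAt.comp_hasDerivAt t (hc t)
    refine h.congr_deriv ?_
    ext z
    have h2 := hA.hasFDerivAt.clm_apply hVd.hasFDerivAt
    have h0 : HasFDerivAt (fun y => fderiv ℝ V y (V y)) (0 : X →L[ℝ] X) (y + t • v) :=
      (hasFDerivAt_const (0 : X) _).congr_of_eventuallyEq
        (by filter_upwards [hOx] with y hy using hself y hy)
    have h3 := congrArg (fun T : X →L[ℝ] X => T z) (h2.unique h0)
    simp [hVv t ht] at h3
    have h4 := hVx.isSymmSndFDerivAt (by simp; norm_cast) z v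
    rw [h4] at h3
    change _ = -(fderiv ℝ V (y + t • v) (fderiv ℝ V (y + t • v) z))
    rw [eq_neg_iff_add_eq_zero, add_comm]; exact h3
  have hK : ∀ t ∈ Icc 0 b, Θ t * J t = Θ 0 * J 0 := by
    refine constant_of_has_deriv_right_zero (f := fun t => Θ t * J t) ?_ ?_
    · exact fun t ht => ((hΘd t ht).mul (hJd t ht)).continuousAt.continuousWithinAt
    · intro t ht
      have ht' := Ico_subset_Icc_self ht
      refine (((hΘd t ht').mul (hJd t ht')).congr_deriv ?_).hasDerivWithinAt
      simp [mul_assoc]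
  have hfin : ∀ t ∈ Icc 0 b, J t - t • (Θ 0 * J 0) = J 0 - (0 : ℝ) • (Θ 0 * J 0) := by
    refine constant_of_has_deriv_right_zero (f := fun t => J t - t • (Θ 0 * J 0)) ?_ ?_
    · exact fun t ht => ((hJd t ht).sub
        ((hasDerivAt_id t).smul_const _)).continuousAt.continuousWithinAt
    · intro t ht
      have ht' := Ico_subset_Icc_self ht
      refine (((hJd t ht').sub ((hasDerivAt_id t).smul_const _)).congr_deriv ?_).hasDerivWithinAt
      rw [hK t ht']; simp
  intro t ht
  have := hfin t ht
  simp [hJ, hΘ] at this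
  rw [sub_eq_iff_eq_add] at this
  exact this


/-- At a point of maximal rank the kernel vector v extends to a kernel field V of Dg which is
constant along the line y + tv, so g is constant there. The point is that the rank cannot drop
before the line leaves O. -/
theorem eq_on_line_of_fderiv_degenerate [FiniteDimensional ℝ X] {g : X → X} {O : Set X}
    (hO : IsOpen O) (hg : ContDiffOn ℝ ∞ g O)
    (hsym : ∀ x ∈ O, ∀ a b, inner ℝ (fderiv ℝ g x a) b = inner ℝ a (fderiv ℝ g x b)) {k : ℕ}
    (hrank : ∀ x ∈ O, Module.finrank ℝ (fderiv ℝ g x : X →ₗ[ℝ] X).range ≤ k) {y v : X}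
    (hy : Module.finrank ℝ (fderiv ℝ g y : X →ₗ[ℝ] X).range = k) (hv : fderiv ℝ g y v = 0)
    (hline : ∀ t ∈ Icc (0 : ℝ) 1, y + t • v ∈ O) :
    ∀ t ∈ Icc (0 : ℝ) 1, g (y + t • v) = g y := by
  have : CompleteSpace X := FiniteDimensional.complete ℝ X
  have hyO : y ∈ O := by simpa using hline 0 (by simp)
  set K : Submodule ℝ X := (fderiv ℝ g y : X →ₗ[ℝ] X).range with hK
  set P : X →L[ℝ] X := K.starProjection with hP
  -- S is invertible at y, since the symmetric operator Dg(y) is injective on its range K and has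
  -- kernel K^⊥. The field V = S⁻¹v will satisfy P(Dg V) = 0 and (1 - P)V = v.
  set S : X → X →L[ℝ] X := fun x => P * fderiv ℝ g x + (1 - P) with hS
  have hSapp : ∀ x z, S x z = P (fderiv ℝ g x z) + (z - P z) := fun x z => rfl
  have hPK : ∀ z, P z ∈ K := fun z => Submodule.starProjection_apply_mem K z
  have hPid : ∀ z ∈ K, P z = z := fun z hz => Submodule.starProjection_eq_self_iff.2 hz
  have hPP : ∀ z, P (P z) = P z := fun z => hPid _ (hPK z)
  have hPv : P v = 0 := by
    rw [hP, Submodule.starProjection_apply_eq_zero_iff]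
    rw [Submodule.mem_orthogonal]
    rintro _ ⟨a, rfl⟩
    have := hsym y hyO a v
    rw [hv, inner_zero_right] at this
    exact this
  have hfS : ContDiffOn ℝ ∞ S O := by
    have h := hg.fderiv_of_isOpen (m := ∞) hO (by simp)
    exact (contDiffOn_const.mul h).add contDiffOn_const
  set O' : Set X := O ∩ S ⁻¹' {T | IsUnit T} with hO'
  have hO'o : IsOpen O' := hfS.continuousOn.isOpen_inter_preimage hO Units.isOpen
  have hSy : IsUnit (S y) := by
    rw [ContinuousLinearMap.isUnit_iff_bijective]
    have hinj : Function.Injective (S y) := by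
      rw [injective_iff_map_eq_zero]
      intro z hz
      have hmem : fderiv ℝ g y z ∈ K := ⟨z, rfl⟩
      rw [hSapp, hPid _ hmem] at hz
      have h1 : fderiv ℝ g y z = 0 := by
        have := congrArg P hz
        simpa [hPid _ hmem, hPP] using this
      rw [h1, zero_add, sub_eq_zero] at hz
      have h2 : z ∈ K := by rw [hz]; exact hPK z
      obtain ⟨a, ha⟩ := h2
      have h3 := hsym y hyO a z
      rw [h1, inner_zero_right] at h3
      have h4 : fderiv ℝ g y a = z := ha
      rw [h4] at h3
      exact inner_self_eq_zero.1 h3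
    exact ⟨hinj, (LinearMap.injective_iff_surjective (f := (S y : X →ₗ[ℝ] X))).1 hinj⟩
  set V : X → X := fun x => Ring.inverse (S x) v with hV
  have hSV : ∀ x ∈ O', S x (V x) = v := by
    rintro x ⟨-, hx⟩
    have := Ring.mul_inverse_cancel _ hx
    exact congrArg (fun T : X →L[ℝ] X => T v) this
  have hSinj : ∀ x ∈ O', Function.Injective (S x) := fun x hx =>
    ((ContinuousLinearMap.isUnit_iff_bijective).1 hx.2).1
  have hPAV : ∀ x ∈ O', P (fderiv ℝ g x (V x)) = 0 := by
    intro x hx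
    have := congrArg P (hSV x hx)
    rw [hSapp, hPv] at this
    simpa [hPP] using this
  -- Where S is invertible, P maps the range of Dg(x) onto K. The rank bound makes this map
  -- injective, so P(Dg V) = 0 improves to Dg V = 0.
  have hAV : ∀ x ∈ O', fderiv ℝ g x (V x) = 0 := by
    intro x hx
    set R : Submodule ℝ X := (fderiv ℝ g x : X →ₗ[ℝ] X).range
    let ρ : R →ₗ[ℝ] K := ((P : X →ₗ[ℝ] X).codRestrict K hPK).comp R.subtype
    have hsurj : Function.Surjective ρ := by
      rintro ⟨r, hr⟩
      obtain ⟨z, hz⟩ := ((ContinuousLinearMap.isUnit_iff_bijective).1 hx.2).2 r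
      refine ⟨⟨fderiv ℝ g x z, z, rfl⟩, Subtype.ext ?_⟩
      have := congrArg P hz
      rw [hSapp, hPid r hr] at this
      simp only [map_add, map_sub, hPP, sub_self, add_zero] at this
      exact this
    have hfr : Module.finrank ℝ R = Module.finrank ℝ K :=
      le_antisymm ((hrank x hx.1).trans hy.ge) (LinearMap.finrank_le_finrank_of_surjective hsurj)
    have hinj := (LinearMap.injective_iff_surjective_of_finrank_eq_finrank hfr).2 hsurj
    have h0 : ρ ⟨fderiv ℝ g x (V x), V x, rfl⟩ = 0 := Subtype.ext (hPAV x hx)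
    exact congrArg Subtype.val ((injective_iff_map_eq_zero ρ).1 hinj _ h0)
  have hVc : ContDiffOn ℝ ∞ V O' := by
    intro x hx
    obtain ⟨u, hu⟩ := hx.2
    have h1 : ContDiffAt ℝ ∞ (fun x => Ring.inverse (S x)) x := by
      refine ContDiffAt.comp x (g := Ring.inverse) ?_ (hfS.contDiffAt (hO.mem_nhds hx.1))
      rw [← hu]; exact contDiffAt_ringInverse ℝ u
    exact (h1.clm_apply contDiffAt_const).contDiffWithinAt
  have hbasic := fderiv_kernelField_apply_self hO'o (hg.mono inter_subset_left) hVc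
    (fun x hx => hsym x hx.1) hAV
  -- The component (1 - P)V is the constant v, so DV takes values in K.
  have hnormal : ∀ x ∈ O', ∀ z, fderiv ℝ V x z - P (fderiv ℝ V x z) = 0 := by
    intro x hx z
    have hVd : DifferentiableAt ℝ V x :=
      (hVc.contDiffAt (hO'o.mem_nhds hx)).differentiableAt (by simp)
    have h1 : HasFDerivAt (fun x => (1 - P) (V x)) ((1 - P).comp (fderiv ℝ V x)) x :=
      (1 - P).hasFDerivAt.comp x hVd.hasFDerivAt
    have h2 : HasFDerivAt (fun x => (1 - P) (V x)) (0 : X →L[ℝ] X) x := by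
      refine (hasFDerivAt_const v x).congr_of_eventuallyEq ?_
      filter_upwards [hO'o.mem_nhds hx] with w hw
      have := hSV w hw
      rw [hSapp, hPAV w hw, zero_add] at this
      exact this
    exact congrArg (fun T : X →L[ℝ] X => T z) (h1.unique h2)
  have hself : ∀ x ∈ O', fderiv ℝ V x (V x) = 0 := by
    intro x hx
    apply hSinj x hx
    rw [hSapp, hnormal x hx, (hbasic x hx).2]; simp
  have hSD : ∀ x ∈ O', ∀ z, fderiv ℝ S x (V x) z = -(S x (fderiv ℝ V x z)) := by
    intro x hx z
    have hA : DifferentiableAt ℝ (fderiv ℝ g) x :=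
      ((hg.contDiffAt (hO.mem_nhds hx.1)).fderiv_right (m := ∞) (by simp)).differentiableAt
        (by simp)
    have h1 : HasFDerivAt S ((ContinuousLinearMap.compL ℝ X X X P).comp
        (fderiv ℝ (fderiv ℝ g) x)) x := by
      have := (ContinuousLinearMap.compL ℝ X X X P).hasFDerivAt.comp x hA.hasFDerivAt
      exact this.add_const (1 - P)
    rw [h1.fderiv, hSapp, hnormal x hx, (hbasic x hx).1]
    simp
  have hSc : ContinuousOn (fun t : ℝ => S (y + t • v)) (Icc 0 1) := by
    refine hfS.continuousOn.comp ?_ hline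
    exact (continuous_const.add (continuous_id.smul continuous_const)).continuousOn
  have hVy : V y = v := by
    apply hSinj y ⟨hyO, hSy⟩
    rw [hSV y ⟨hyO, hSy⟩, hSapp, hv, hPv]; simp
  -- Let τ be the first parameter at which S is singular. Before τ the inverse is affine in t, so it
  -- has a limit at τ; by continuity that limit is a two-sided inverse of S at τ, a contradiction.
  have hall : ∀ t ∈ Icc (0 : ℝ) 1, IsUnit (S (y + t • v)) := by
    by_contra! hcon
    set N : Set ℝ := Icc (0 : ℝ) 1 ∩ (fun t : ℝ => S (y + t • v)) ⁻¹' {T | IsUnit T}ᶜ with hN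
    have hNc : IsClosed N := hSc.preimage_isClosed_of_isClosed isClosed_Icc
      (Units.isOpen (R := X →L[ℝ] X)).isClosed_compl
    have hNne : N.Nonempty := by
      obtain ⟨t, ht, h⟩ := hcon
      exact ⟨t, ht, h⟩
    have hbdd : BddBelow N := ⟨0, fun t ht => ht.1.1⟩
    have hτ : sInf N ∈ N := hNc.csInf_mem hNne hbdd
    set τ := sInf N
    have hτ0 : 0 < τ := by
      refine lt_of_le_of_ne hτ.1.1 fun h => hτ.2 ?_
      rw [← h]; simpa using hSy
    have hbelow : ∀ t ∈ Ico 0 τ, y + t • v ∈ O' := by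
      intro t ht
      have ht1 : t ∈ Icc (0 : ℝ) 1 := ⟨ht.1, ht.2.le.trans hτ.1.2⟩
      refine ⟨hline t ht1, ?_⟩
      by_contra h
      exact absurd (csInf_le hbdd ⟨ht1, h⟩) (not_le.2 ht.2)
    set I0 := Ring.inverse (S y)
    set K0 := fderiv ℝ V y * I0
    have haff : ∀ t ∈ Ico 0 τ, Ring.inverse (S (y + t • v)) = I0 + t • K0 := by
      intro t ht
      have hl : ∀ s ∈ Icc 0 t, y + s • v ∈ O' := fun s hs => hbelow s ⟨hs.1, hs.2.trans_lt ht.2⟩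
      exact inverse_affine_on_line hO'o hVc (hfS.mono inter_subset_left) hself (fun x hx => hx.2)
        hSD hl (eq_on_line_of_fderiv_apply_self hO'o hVc hself hVy hl) t ⟨ht.1, le_rfl⟩
    have hne : (𝓝[Ico 0 τ] τ).NeBot := by
      rw [← mem_closure_iff_nhdsWithin_neBot, closure_Ico hτ0.ne]
      exact ⟨hτ0.le, le_rfl⟩
    have hsub : Ico 0 τ ⊆ Icc (0 : ℝ) 1 := fun t ht => ⟨ht.1, ht.2.le.trans hτ.1.2⟩
    have hlimS : Tendsto (fun t : ℝ => S (y + t • v)) (𝓝[Ico 0 τ] τ) (𝓝 (S (y + τ • v))) :=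
      (hSc τ hτ.1).mono hsub
    have hlimI : Tendsto (fun t : ℝ => I0 + t • K0) (𝓝[Ico 0 τ] τ) (𝓝 (I0 + τ • K0)) :=
      ((continuous_const.add (continuous_id.smul continuous_const)).tendsto τ).mono_left
        nhdsWithin_le_nhds
    have e1 : S (y + τ • v) * (I0 + τ • K0) = 1 := by
      refine tendsto_nhds_unique (hlimS.mul hlimI) (tendsto_const_nhds.congr' ?_)
      filter_upwards [self_mem_nhdsWithin] with t ht
      rw [← haff t ht, Ring.mul_inverse_cancel _ (hbelow t ht).2]
    have e2 : (I0 + τ • K0) * S (y + τ • v) = 1 := by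
      refine tendsto_nhds_unique (hlimI.mul hlimS) (tendsto_const_nhds.congr' ?_)
      filter_upwards [self_mem_nhdsWithin] with t ht
      rw [← haff t ht, Ring.inverse_mul_cancel _ (hbelow t ht).2]
    exact hτ.2 ⟨⟨_, _, e1, e2⟩, rfl⟩
  have hl : ∀ t ∈ Icc (0 : ℝ) 1, y + t • v ∈ O' := fun t ht => ⟨hline t ht, hall t ht⟩
  have hVl := eq_on_line_of_fderiv_apply_self hO'o hVc hself hVy hl
  have hgd : ∀ t ∈ Icc (0 : ℝ) 1, HasDerivAt (fun t : ℝ => g (y + t • v)) 0 t := by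
    intro t ht
    have hc : HasDerivAt (fun t : ℝ => y + t • v) v t := by
      simpa using ((hasDerivAt_id t).smul_const v).const_add y
    have := ((hg.contDiffAt (hO.mem_nhds (hline t ht))).differentiableAt
      (by simp)).hasFDerivAt.comp_hasDerivAt t hc
    refine this.congr_deriv ?_
    have h := hAV _ (hl t ht)
    rwa [hVl t ht] at h
  have := constant_of_has_deriv_right_zero (f := fun t : ℝ => g (y + t • v))
    (fun t ht => (hgd t ht).continuousAt.continuousWithinAt)
    (fun t ht => (hgd t (Ico_subset_Icc_self ht)).hasDerivWithinAt)
  simpa using this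

/-- The point x₀ need not have maximal rank, but it is a limit of points y_j whose rank is maximal
nearby. The segments through y_j on which g is constant have a common length, so a subsequence of
their directions converges to a segment centred at x₀. -/
theorem exists_segment_of_fderiv_degenerate [FiniteDimensional ℝ X] {g : X → X} {x₀ : X}
    (hg : ∀ᶠ x in 𝓝 x₀, ContDiffAt ℝ ∞ g x)
    (hsym : ∀ᶠ x in 𝓝 x₀, ∀ a b, inner ℝ (fderiv ℝ g x a) b = inner ℝ a (fderiv ℝ g x b))
    (hdeg : ∀ᶠ x in 𝓝 x₀, ∃ v ≠ 0, fderiv ℝ g x v = 0) {U : Set X} (hU : U ∈ 𝓝 x₀) :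
    ∃ v ≠ 0, ∀ t ∈ Icc (-1 : ℝ) 1, x₀ + t • v ∈ U ∧ g (x₀ + t • v) = g x₀ := by
  set r : X → ℕ := fun x => Module.finrank ℝ (fderiv ℝ g x : X →ₗ[ℝ] X).range with hr
  have hex : ∃ k, ∀ᶠ x in 𝓝 x₀, r x ≤ k :=
    ⟨Module.finrank ℝ X, Eventually.of_forall fun x => Submodule.finrank_le _⟩
  -- Take the least k bounding the rank near x₀. For k > 0 minimality makes rank greater than k - 1
  -- occur arbitrarily close to x₀; k = 0 is separate because of truncated subtraction.
  obtain ⟨k, hk, hfreq⟩ : ∃ k, (∀ᶠ x in 𝓝 x₀, r x ≤ k) ∧ ∃ᶠ x in 𝓝 x₀, r x = k := by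
    classical
    refine ⟨Nat.find hex, Nat.find_spec hex, ?_⟩
    rcases Nat.eq_zero_or_pos (Nat.find hex) with h0 | hpos
    · have := Nat.find_spec hex
      refine (this.mono fun x hx => ?_).frequently
      omega
    · have hnot := Nat.find_min hex (Nat.sub_lt hpos one_pos)
      refine ((not_eventually.1 hnot).and_eventually (Nat.find_spec hex)).mono ?_
      intro x hx
      omega
  obtain ⟨δ, hδ, hball⟩ := Metric.eventually_nhds_iff_ball.1
    ((hg.and hsym).and ((hdeg.and hk).and hU))
  set O := Metric.ball x₀ δ with hO
  have hOo : IsOpen O := Metric.isOpen_ball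
  have hgO : ContDiffOn ℝ ∞ g O := fun x hx => (hball x hx).1.1.contDiffWithinAt
  have hseq : ∀ j : ℕ, ∃ y v : X, dist y x₀ < δ / (2 * (j + 1)) ∧ ‖v‖ = 1 ∧ r y = k ∧
      fderiv ℝ g y v = 0 := by
    intro j
    have hε : 0 < δ / (2 * ((j : ℝ) + 1)) := by positivity
    have hle : δ / (2 * ((j : ℝ) + 1)) ≤ δ := by
      refine div_le_self hδ.le ?_
      have : (0 : ℝ) ≤ j := j.cast_nonneg
      linarith
    obtain ⟨y, hy, hyd⟩ := (hfreq.and_eventually (Metric.ball_mem_nhds x₀ hε)).exists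
    obtain ⟨v, hv, hv0⟩ := (hball y (Metric.ball_subset_ball hle hyd)).2.1.1
    exact ⟨y, ‖v‖⁻¹ • v, hyd, norm_smul_inv_norm (𝕜 := ℝ) hv, hy, by rw [map_smul, hv0, smul_zero]⟩
  choose y v hyd hvn hyr hv0 using hseq
  have hyto : Tendsto y atTop (𝓝 x₀) := by
    rw [tendsto_iff_dist_tendsto_zero]
    refine squeeze_zero (fun _ => dist_nonneg) (fun j => (hyd j).le) ?_
    have h1 : Tendsto (fun j : ℕ => (δ / 2) * (1 / ((j : ℝ) + 1))) atTop (𝓝 ((δ / 2) * 0)) :=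
      tendsto_one_div_add_atTop_nhds_zero_nat.const_mul _
    rw [mul_zero] at h1
    refine h1.congr fun j => ?_
    rw [div_mul_div_comm, mul_one]
  obtain ⟨w, hw, φ, hφ, hlim⟩ := (isCompact_sphere (0 : X) 1).tendsto_subseq
    (fun j => by simpa using hvn j : ∀ j, v j ∈ Metric.sphere (0 : X) 1)
  have hw1 : ‖w‖ = 1 := by simpa using hw
  have hyδ : ∀ j, dist (y j) x₀ < δ / 2 := by
    intro j
    refine (hyd j).trans_le (div_le_div_of_nonneg_left hδ.le two_pos ?_)
    have : (0 : ℝ) ≤ j := j.cast_nonneg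
    linarith
  have hconst : ∀ j, ∀ s ∈ Icc (-(δ / 2)) (δ / 2), g (y j + s • v j) = g (y j) := by
    intro j s hs
    have := eq_on_line_of_fderiv_degenerate (v := s • v j) hOo hgO (fun x hx => (hball x hx).1.2)
      (fun x hx => (hball x hx).2.1.2) (hyr j) (by rw [map_smul, hv0, smul_zero]) ?_ 1
      ⟨zero_le_one, le_rfl⟩
    · simpa using this
    · intro t ht
      rw [hO, Metric.mem_ball]
      have h1 : dist (y j + t • s • v j) x₀ ≤ dist (y j + t • s • v j) (y j) + dist (y j) x₀ :=
        dist_triangle _ _ _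
      have h2 : dist (y j + t • s • v j) (y j) ≤ δ / 2 := by
        rw [dist_eq_norm, add_sub_cancel_left, norm_smul, norm_smul, hvn, mul_one,
          Real.norm_eq_abs, Real.norm_eq_abs, abs_of_nonneg ht.1]
        have := abs_le.2 hs
        nlinarith [abs_nonneg s, ht.1, ht.2]
      linarith [hyδ j]
  have hδ4 : δ / 4 ≠ 0 := by positivity
  -- Half-length δ/4 lies in the range |s| ≤ δ/2 of `hconst` and keeps the limit segment inside the
  -- open ball of radius δ.
  refine ⟨(δ / 4) • w, smul_ne_zero hδ4 fun h => by simp [h] at hw1, fun t ht => ?_⟩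
  have hnorm : |t * (δ / 4)| ≤ δ / 4 := by
    rw [abs_mul, abs_of_pos (show 0 < δ / 4 by positivity)]
    have := abs_le.2 ht
    nlinarith
  have hmem : x₀ + t • (δ / 4) • w ∈ O := by
    rw [hO, Metric.mem_ball, dist_eq_norm, add_sub_cancel_left, smul_smul, norm_smul, hw1, mul_one,
      Real.norm_eq_abs]
    linarith
  refine ⟨(hball _ hmem).2.2, ?_⟩
  have hc1 := (hball _ hmem).1.1.continuousAt
  have hc2 := (hball x₀ (Metric.mem_ball_self hδ)).1.1.continuousAt
  have hl1 : Tendsto (fun j => g (y (φ j) + t • (δ / 4) • v (φ j))) atTop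
      (𝓝 (g (x₀ + t • (δ / 4) • w))) :=
    hc1.tendsto.comp ((hyto.comp hφ.tendsto_atTop).add ((hlim.const_smul (δ / 4)).const_smul t))
  have hl2 : Tendsto (fun j => g (y (φ j))) atTop (𝓝 (g x₀)) :=
    hc2.tendsto.comp (hyto.comp hφ.tendsto_atTop)
  refine tendsto_nhds_unique hl1 (hl2.congr fun j => ?_)
  rw [smul_smul, hconst]
  have := abs_le.1 hnorm
  constructor <;> linarith [this.1, this.2]

end Developable

/-! ### Straight segments in a hypersurface with degenerate conormal map. -/

section Hypersurface

variable {X E : Type*} [NormedAddCommGroup X] [InnerProductSpace ℝ X] [FiniteDimensional ℝ X]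
  [NormedAddCommGroup E] [NormedSpace ℝ E]

/-- The splitting of the ambient space into a hyperplane and a transversal line. -/
theorem exists_equiv_prod_of_transversal (T : X →L[ℝ] E) (hT : Function.Injective T)
    (l : E →L[ℝ] ℝ) (hl : ∀ w, l w = 0 ↔ ∃ c, T c = w) {ξ : E} (hξ : l ξ = 1) :
    ∃ Q : (X × ℝ) ≃L[ℝ] E, (∀ c t, Q (c, t) = T c + t • ξ) ∧ ∀ w, (Q.symm w).2 = l w := by
  let Q₀ : (X × ℝ) →ₗ[ℝ] E :=
    (T : X →ₗ[ℝ] E).coprod (LinearMap.toSpanSingleton ℝ E ξ)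
  have hQ₀ : ∀ c t, Q₀ (c, t) = T c + t • ξ := fun c t => by simp [Q₀]
  have hlT : ∀ c, l (T c) = 0 := fun c => (hl _).2 ⟨c, rfl⟩
  have hlQ : ∀ z : X × ℝ, l (Q₀ z) = z.2 := fun z => by
    rw [show z = (z.1, z.2) from rfl, hQ₀]; simp [hlT, hξ]
  have hinj : Function.Injective Q₀ := by
    rw [injective_iff_map_eq_zero]
    rintro ⟨c, t⟩ h
    have ht : t = 0 := by have := hlQ (c, t); rw [h, map_zero] at this; exact this.symm
    rw [hQ₀, ht, zero_smul, add_zero] at h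
    rw [ht, (injective_iff_map_eq_zero T).1 hT c h]; rfl
  have hsurj : Function.Surjective Q₀ := by
    intro w
    obtain ⟨c, hc⟩ := (hl (w - l w • ξ)).1 (by simp [hξ])
    exact ⟨(c, l w), by rw [hQ₀, hc]; simp⟩
  let Q₁ : (X × ℝ) ≃ₗ[ℝ] E := LinearEquiv.ofBijective Q₀ ⟨hinj, hsurj⟩
  have : FiniteDimensional ℝ E := Q₁.finiteDimensional
  refine ⟨Q₁.toContinuousLinearEquiv, hQ₀, fun w => ?_⟩
  obtain ⟨z, rfl⟩ := hsurj w
  rw [hlQ]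
  exact congrArg Prod.snd (Q₁.symm_apply_apply z)

/-- Write the hypersurface near F(y₀) as a graph of u over its tangent hyperplane in the direction
ξ. Degeneracy of the conormal map makes the Hessian of u singular, so ∇u vanishes on a segment
around the base point. There u is constant, F runs along a straight line, and the tangent hyperplane
does not move. -/
theorem exists_flat_segment {F : X → E} {l : X → E →L[ℝ] ℝ} {y₀ : X} {ξ : E}
    (hF : ∀ᶠ y in 𝓝 y₀, ContDiffAt ℝ ∞ F y) (hl : ∀ᶠ y in 𝓝 y₀, ContDiffAt ℝ ∞ l y)
    (hker : ∀ᶠ y in 𝓝 y₀, ∀ w, l y w = 0 ↔ ∃ c, fderiv ℝ F y c = w)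
    (hinj : Function.Injective (fderiv ℝ F y₀)) (hξ : l y₀ ξ = 1)
    (hdeg : ∀ᶠ y in 𝓝 y₀, ∃ w ≠ 0, ∀ c, fderiv ℝ l y w (fderiv ℝ F y c) = 0)
    {U : Set X} (hU : U ∈ 𝓝 y₀) :
    ∃ d ≠ 0, ∃ y₁ ∈ U, ∃ y₂ ∈ U, F y₁ = F y₀ + d ∧ F y₂ = F y₀ - d ∧ l y₀ d = 0 ∧
      (∀ c, l y₀ (fderiv ℝ F y₁ c) = 0) ∧ ∀ c, l y₀ (fderiv ℝ F y₂ c) = 0 := by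
  have : CompleteSpace X := FiniteDimensional.complete ℝ X
  obtain ⟨Q, hQ, hQ2⟩ := exists_equiv_prod_of_transversal _ hinj (l y₀) hker.self_of_nhds hξ
  set T := fderiv ℝ F y₀ with hT
  set pr : E →L[ℝ] X := (ContinuousLinearMap.fst ℝ X ℝ).comp (Q.symm : E →L[ℝ] X × ℝ) with hpr
  have hprT : ∀ c, pr (T c) = c := by
    intro c
    have : T c = Q (c, 0) := by rw [hQ]; simp
    rw [this, hpr]; simp
  have hsplit : ∀ w, w = T (pr w) + l y₀ w • ξ := by
    intro w
    rw [← hQ, ← hQ2 w]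
    exact (Q.apply_symm_apply w).symm
  set G : X → X := fun y => pr (F y) with hG
  have hGc : ∀ᶠ y in 𝓝 y₀, ContDiffAt ℝ ∞ G y :=
    hF.mono fun y hy => pr.contDiff.contDiffAt.comp y hy
  have hFd : HasFDerivAt F T y₀ :=
    (hF.self_of_nhds.differentiableAt (by simp)).hasFDerivAt
  have hGd : HasFDerivAt G ((ContinuousLinearEquiv.refl ℝ X : X ≃L[ℝ] X) : X →L[ℝ] X) y₀ := by
    refine (pr.hasFDerivAt.comp y₀ hFd).congr_fderiv ?_
    ext c; simp [hprT]
  set e := hGc.self_of_nhds.toOpenPartialHomeomorph G hGd (by simp) with he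
  have hecoe : ∀ y, e y = G y := fun y => by
    rw [he, ContDiffAt.toOpenPartialHomeomorph_coe]
  have hy₀ : y₀ ∈ e.source := ContDiffAt.mem_toOpenPartialHomeomorph_source _ hGd (by simp)
  set x₀ := e y₀ with hx₀
  set ψ := e.symm with hψ
  have hψx₀ : ψ x₀ = y₀ := e.left_inv hy₀
  have hx₀t : x₀ ∈ e.target := e.map_source hy₀
  have hψc : Tendsto ψ (𝓝 x₀) (𝓝 y₀) := by
    have := (e.continuousAt_symm hx₀t).tendsto
    rwa [hψx₀] at this
  have hinv : ∀ᶠ y in 𝓝 y₀, ∃ D : X ≃L[ℝ] X, HasFDerivAt G (D : X →L[ℝ] X) y := by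
    have hc : ContinuousAt (fderiv ℝ G) y₀ :=
      (hGc.self_of_nhds.fderiv_right (m := 0) (by simp)).continuousAt
    have hn := ContinuousLinearEquiv.nhds (ContinuousLinearEquiv.refl ℝ X)
    rw [← hGd.fderiv] at hn
    filter_upwards [hc.preimage_mem_nhds hn, hGc] with y hy hy'
    obtain ⟨D, hD⟩ := hy
    exact ⟨D, by rw [hD]; exact (hy'.differentiableAt (by simp)).hasFDerivAt⟩
  have hlam : ∀ᶠ y in 𝓝 y₀, l y ξ ≠ 0 := by
    have hc : ContinuousAt (fun y => l y ξ) y₀ :=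
      hl.self_of_nhds.continuousAt.clm_apply continuousAt_const
    exact hc.eventually_ne (by rw [hξ]; exact one_ne_zero)
  have hgood : ∀ᶠ x in 𝓝 x₀, x ∈ e.target ∧ (ψ x ∈ U ∧ ContDiffAt ℝ ∞ F (ψ x) ∧
      ContDiffAt ℝ ∞ l (ψ x) ∧ ContDiffAt ℝ ∞ G (ψ x)) ∧
      (∀ w, l (ψ x) w = 0 ↔ ∃ c, fderiv ℝ F (ψ x) c = w) ∧
      (∃ w ≠ 0, ∀ c, fderiv ℝ l (ψ x) w (fderiv ℝ F (ψ x) c) = 0) ∧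
      (∃ D : X ≃L[ℝ] X, HasFDerivAt G (D : X →L[ℝ] X) (ψ x)) ∧ l (ψ x) ξ ≠ 0 :=
    (eventually_mem_set.2 (e.open_target.mem_nhds hx₀t)).and <| hψc.eventually <|
      ((eventually_mem_set.2 hU).and (hF.and (hl.and hGc))).and
        (hker.and (hdeg.and (hinv.and hlam)))
  obtain ⟨O, hOgood, hOo, hx₀O⟩ := eventually_nhds_iff.1 hgood
  set u : X → ℝ := fun x => l y₀ (F (ψ x)) with hu
  have hGψ : ∀ x ∈ O, G (ψ x) = x := fun x hx => by
    rw [← hecoe]; exact e.right_inv (hOgood x hx).1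
  have hFψ : ∀ x ∈ O, F (ψ x) = T x + u x • ξ := by
    intro x hx
    have := hsplit (F (ψ x))
    have h2 := hGψ x hx
    simp only [hG] at h2
    rwa [h2] at this
  have hψs : ∀ x ∈ O, ContDiffAt ℝ ∞ ψ x := by
    intro x hx
    obtain ⟨ht, ⟨-, -, -, hGs⟩, -, -, ⟨D, hD⟩, -⟩ := hOgood x hx
    have hcoe : (e : X → X) = G := funext hecoe
    refine e.contDiffAt_symm (f₀' := D) ht ?_ ?_
    · rw [hcoe]; exact hD
    · rw [hcoe]; exact hGs
  have hus : ∀ x ∈ O, ContDiffAt ℝ ∞ u x := fun x hx =>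
    (l y₀).contDiff.contDiffAt.comp x (((hOgood x hx).2.1.2.1).comp x (hψs x hx))
  have hψd : ∀ x ∈ O, ∃ D : X ≃L[ℝ] X, HasFDerivAt ψ (D : X →L[ℝ] X) x := by
    intro x hx
    obtain ⟨ht, -, -, -, ⟨D, hD⟩, -⟩ := hOgood x hx
    have h1 : HasFDerivAt ψ (fderiv ℝ ψ x) x :=
      ((hψs x hx).differentiableAt (by simp)).hasFDerivAt
    have h2 := hD.comp x h1
    have h3 : HasFDerivAt (G ∘ ψ) (ContinuousLinearMap.id ℝ X) x :=
      (hasFDerivAt_id x).congr_of_eventuallyEq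
        (by filter_upwards [hOo.mem_nhds hx] with z hz using hGψ z hz)
    have h4 := h2.unique h3
    refine ⟨D.symm, h1.congr_fderiv ?_⟩
    ext c
    have := congrArg (fun R : X →L[ℝ] X => R c) h4
    simp only [ContinuousLinearMap.comp_apply, ContinuousLinearMap.id_apply] at this
    rw [← D.symm_apply_apply (fderiv ℝ ψ x c)]
    exact congrArg D.symm this
  have hud : ∀ x ∈ O, HasFDerivAt u (fderiv ℝ u x) x := fun x hx =>
    ((hus x hx).differentiableAt (by simp)).hasFDerivAt
  have hFψd : ∀ x ∈ O, ∀ D : X →L[ℝ] X, HasFDerivAt ψ D x → ∀ c,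
      fderiv ℝ F (ψ x) (D c) = T c + fderiv ℝ u x c • ξ := by
    intro x hx D hD c
    have h1 : HasFDerivAt (fun x => F (ψ x)) ((fderiv ℝ F (ψ x)).comp D) x :=
      (((hOgood x hx).2.1.2.1).differentiableAt (by simp)).hasFDerivAt.comp x hD
    have h2 : HasFDerivAt (fun x => F (ψ x)) (T + (fderiv ℝ u x).smulRight ξ) x := by
      refine (T.hasFDerivAt.add ((hud x hx).smul_const ξ)).congr_of_eventuallyEq ?_
      filter_upwards [hOo.mem_nhds hx] with z hz using hFψ z hz
    exact congrArg (fun R : X →L[ℝ] E => R c) (h1.unique h2)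
  have hconormal : ∀ x ∈ O, ∀ c, l (ψ x) (T c) + fderiv ℝ u x c * l (ψ x) ξ = 0 := by
    intro x hx c
    obtain ⟨D, hD⟩ := hψd x hx
    have h1 := hFψd x hx D hD c
    have h2 := ((hOgood x hx).2.2.1 _).2 ⟨_, h1⟩
    simpa using h2
  let R : (X →L[ℝ] ℝ) →L[ℝ] X := LinearMap.toContinuousLinearMap
    { toFun := fun a => (InnerProductSpace.toDual ℝ X).symm a
      map_add' := fun a b => map_add _ a b
      map_smul' := fun c a => by simp }
  set g : X → X := fun x => (InnerProductSpace.toDual ℝ X).symm (fderiv ℝ u x) with hg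
  have hginner : ∀ x c, inner ℝ (g x) c = fderiv ℝ u x c := fun x c => by
    rw [hg]; exact InnerProductSpace.toDual_symm_apply
  have hfus : ∀ x ∈ O, ContDiffAt ℝ ∞ (fderiv ℝ u) x := fun x hx =>
    (hus x hx).fderiv_right (m := ∞) (by simp)
  have hgs : ∀ x ∈ O, ContDiffAt ℝ ∞ g x := fun x hx =>
    R.contDiff.contDiffAt.comp x (hfus x hx)
  have hgd : ∀ x ∈ O, ∀ a b, inner ℝ (fderiv ℝ g x a) b = fderiv ℝ (fderiv ℝ u) x a b := by
    intro x hx a b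
    have h1 := R.hasFDerivAt.comp x ((hfus x hx).differentiableAt (by simp)).hasFDerivAt
    have h2 : fderiv ℝ g x a =
        (InnerProductSpace.toDual ℝ X).symm (fderiv ℝ (fderiv ℝ u) x a) := by
      have : HasFDerivAt g _ x := h1
      rw [this.fderiv]; rfl
    rw [h2]; exact InnerProductSpace.toDual_symm_apply
  have hsnd : ∀ x ∈ O, ∀ a b, fderiv ℝ (fderiv ℝ u) x a b = fderiv ℝ (fderiv ℝ u) x b a := by
    intro x hx a b
    exact (hus x hx).isSymmSndFDerivAt (by simp; norm_cast) a b
  have hOn : ∀ᶠ x in 𝓝 x₀, x ∈ O := hOo.mem_nhds hx₀O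
  have hgdeg : ∀ x ∈ O, ∃ v ≠ 0, fderiv ℝ g x v = 0 := by
    intro x hx
    obtain ⟨-, ⟨-, -, hls, -⟩, hk, ⟨w, hw, hw0⟩, -, hne⟩ := hOgood x hx
    obtain ⟨D, hD⟩ := hψd x hx
    refine ⟨D.symm w, by simpa using hw, ext_inner_right ℝ fun c => ?_⟩
    rw [inner_zero_left, hgd x hx]
    -- D_w l vanishes on tangent vectors, hence is proportional to l itself. The relation is
    -- cross-multiplied to avoid dividing by l(ξ).
    have hprop : ∀ v, fderiv ℝ l (ψ x) w v * l (ψ x) ξ =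
        fderiv ℝ l (ψ x) w ξ * l (ψ x) v := by
      intro v
      obtain ⟨b, hb⟩ := (hk (l (ψ x) ξ • v - l (ψ x) v • ξ)).1 (by simp; ring)
      have := hw0 b
      rw [hb] at this
      simp at this
      linarith
    have hl1 : HasFDerivAt (fun x => l (ψ x)) ((fderiv ℝ l (ψ x)).comp (D : X →L[ℝ] X)) x :=
      (hls.differentiableAt (by simp)).hasFDerivAt.comp x hD
    have h1 := (hl1.clm_apply (hasFDerivAt_const (T c) x)).add
      ((((hfus x hx).differentiableAt (by simp)).hasFDerivAt.clm_apply
        (hasFDerivAt_const c x)).mul (hl1.clm_apply (hasFDerivAt_const ξ x)))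
    have h2 := h1.unique ((hasFDerivAt_const (0 : ℝ) x).congr_of_eventuallyEq
        (by filter_upwards [hOo.mem_nhds hx] with z hz; exact hconormal z hz c))
    have h3 := congrArg (fun R : X →L[ℝ] ℝ => R (D.symm w)) h2
    simp at h3
    have h4 := hprop (T c)
    have h5 := hconormal x hx c
    -- Differentiate the conormal equation l(Tc) + du(c)·l(ξ) = 0 in the direction D⁻¹w. The terms
    -- with D_w l cancel by proportionality, leaving the Hessian term.
    have h6 : fderiv ℝ (fderiv ℝ u) x (D.symm w) c * l (ψ x) ξ ^ 2 = 0 := by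
      have := congrArg (· * l (ψ x) ξ) h3
      linear_combination this - h4 - fderiv ℝ l (ψ x) w ξ * h5
    exact (mul_eq_zero.1 h6).resolve_right (pow_ne_zero 2 hne)
  obtain ⟨v, hv, hseg⟩ := exists_segment_of_fderiv_degenerate (g := g) (x₀ := x₀)
    (hOn.mono hgs)
    (hOn.mono fun x hx a b => by
      rw [hgd x hx, hsnd x hx, real_inner_comm, hgd x hx])
    (hOn.mono hgdeg) (hOo.mem_nhds hx₀O)
  have hg0 : g x₀ = 0 := by
    refine ext_inner_right ℝ fun c => ?_
    rw [hginner, inner_zero_left]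
    have h1 := hconormal x₀ hx₀O c
    rw [hψx₀, hξ, (hker.self_of_nhds (T c)).2 ⟨c, rfl⟩] at h1
    simpa using h1
  have hdu : ∀ t ∈ Icc (-1 : ℝ) 1, fderiv ℝ u (x₀ + t • v) = 0 := by
    intro t ht
    ext c
    rw [← hginner, (hseg t ht).2, hg0]; simp
  have hline : ∀ t ∈ Icc (-1 : ℝ) 1, HasDerivAt (fun t : ℝ => u (x₀ + t • v)) 0 t := by
    intro t ht
    have hc : HasDerivAt (fun t : ℝ => x₀ + t • v) v t := by
      simpa using ((hasDerivAt_id t).smul_const v).const_add x₀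
    have := (hud _ (hseg t ht).1).comp_hasDerivAt t hc
    rw [hdu t ht] at this
    exact this
  have hconst := constant_of_has_deriv_right_zero (f := fun t : ℝ => u (x₀ + t • v))
    (fun t ht => (hline t ht).continuousAt.continuousWithinAt)
    (fun t ht => (hline t (Ico_subset_Icc_self ht)).hasDerivWithinAt)
  have hu0 : ∀ t ∈ Icc (-1 : ℝ) 1, u (x₀ + t • v) = u x₀ := by
    intro t ht
    have h0 := hconst 0 (by norm_num)
    simp only [zero_smul, add_zero] at h0
    exact (hconst t ht).trans h0.symm
  have hFseg : ∀ t ∈ Icc (-1 : ℝ) 1, F (ψ (x₀ + t • v)) = F y₀ + t • T v := by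
    intro t ht
    have h0 := hFψ x₀ hx₀O
    rw [hψx₀] at h0
    rw [hFψ _ (hseg t ht).1, hu0 t ht, h0]
    simp; abel
  have htan : ∀ t ∈ Icc (-1 : ℝ) 1, ∀ c, l y₀ (fderiv ℝ F (ψ (x₀ + t • v)) c) = 0 := by
    intro t ht c
    obtain ⟨D, hD⟩ := hψd _ (hseg t ht).1
    have h1 := hFψd _ (hseg t ht).1 D hD (D.symm c)
    rw [hdu t ht] at h1
    simp at h1
    rw [h1]
    exact (hker.self_of_nhds _).2 ⟨_, rfl⟩
  have m1 : (1 : ℝ) ∈ Icc (-1 : ℝ) 1 := by norm_num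
  have m2 : (-1 : ℝ) ∈ Icc (-1 : ℝ) 1 := by norm_num
  refine ⟨T v, fun h => hv ((injective_iff_map_eq_zero T).1 hinj v h),
    ψ (x₀ + (1 : ℝ) • v), (hOgood _ (hseg 1 m1).1).2.1.1,
    ψ (x₀ + (-1 : ℝ) • v), (hOgood _ (hseg (-1) m2).1).2.1.1, ?_, ?_,
    (hker.self_of_nhds _).2 ⟨_, rfl⟩, htan 1 m1, htan (-1) m2⟩
  · rw [hFseg 1 m1, one_smul]
  · rw [hFseg (-1) m2]; simp [sub_eq_add_neg]

end Hypersurface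

/-! ### Volume of the cone swept out by a family of linear forms. -/

section Area

variable {n : ℕ}

/-- Both sides acquire the same factor, the determinant of q in the basis b. This moves a
determinant from a fixed basis to a moving frame. -/
theorem det_apply_mul_eq (Ω : Ambient n [⋀^Fin (n + 1)]→ₗ[ℝ] ℝ)
    (b : Module.Basis (Fin (n + 1)) ℝ (Ambient n)) (φ : Fin (n + 1) → Ambient n →ₗ[ℝ] ℝ)
    (q : Fin (n + 1) → Ambient n) :
    (Matrix.of fun i j => φ i (q j)).det * Ω b = (Matrix.of fun i j => φ i (b j)).det * Ω q := by
  have h1 : (Matrix.of fun i j => φ i (q j)) =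
      (Matrix.of fun i j => φ i (b j)) * b.toMatrix q := by
    ext i j
    simp only [Matrix.of_apply, Matrix.mul_apply]
    have h := congrArg (φ i) (b.sum_toMatrix_smul_self q j)
    rw [map_sum] at h
    rw [← h]
    exact Finset.sum_congr rfl fun x _ => by rw [map_smul, smul_eq_mul, mul_comm]
  have h2 : Ω q = Ω b * b.det q := by
    conv_lhs => rw [AlternatingMap.eq_smul_basis_det b Ω]
    simp
  rw [h1, Matrix.det_mul, h2, Module.Basis.det_apply]
  ring

theorem det_snoc_of_last_row {m : ℕ} (A : Matrix (Fin (m + 1)) (Fin (m + 1)) ℝ)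
    (h0 : ∀ j : Fin m, A (Fin.last m) j.castSucc = 0) (h1 : A (Fin.last m) (Fin.last m) = 1) :
    A.det = (Matrix.of fun i j : Fin m => A i.castSucc j.castSucc).det := by
  rw [Matrix.det_succ_row A (Fin.last m), Fin.sum_univ_castSucc]
  simp only [h0, h1, mul_zero, zero_mul, Finset.sum_const_zero, zero_add, mul_one]
  have : (-1 : ℝ) ^ ((Fin.last m : ℕ) + (Fin.last m : ℕ)) = 1 := by
    rw [← two_mul, pow_mul]; simp
  rw [this, one_mul]
  congr 1
  ext i j
  simp

/-- Appending a last coordinate, `ℝ × ℝⁿ ≃ ℝⁿ⁺¹`. -/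
def snocEquiv (n : ℕ) : (ℝ × EuclideanSpace ℝ (Fin n)) ≃L[ℝ] Ambient n :=
  LinearEquiv.toContinuousLinearEquiv
    { toFun := fun z => WithLp.toLp 2 (Fin.snoc (α := fun _ => ℝ) z.2.ofLp z.1)
      invFun := fun v => (v (Fin.last n), WithLp.toLp 2 fun i => v i.castSucc)
      map_add' := fun z w => by
        ext i
        refine Fin.lastCases ?_ (fun i => ?_) i <;> simp
      map_smul' := fun c z => by
        ext i
        refine Fin.lastCases ?_ (fun i => ?_) i <;> simp
      left_inv := fun z => by
        ext <;> simp
      right_inv := fun v => by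
        ext i
        refine Fin.lastCases ?_ (fun i => ?_) i <;> simp }

theorem snocEquiv_apply (z : ℝ × EuclideanSpace ℝ (Fin n)) :
    snocEquiv n z = WithLp.toLp 2 (Fin.snoc (α := fun _ => ℝ) z.2.ofLp z.1) := rfl

theorem snocEquiv_symm_apply (v : Ambient n) :
    (snocEquiv n).symm v = (v (Fin.last n), WithLp.toLp 2 fun i => v i.castSucc) := rfl

theorem measurePreserving_snocEquiv : MeasurePreserving (snocEquiv n) volume volume := by
  have h1 : MeasurePreserving (Prod.map id (WithLp.ofLp (p := 2) (V := Fin n → ℝ)))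
      (volume : Measure (ℝ × EuclideanSpace ℝ (Fin n))) (volume.prod volume) :=
    (MeasurePreserving.id volume).prod (PiLp.volume_preserving_ofLp (Fin n))
  have h2 := (volume_preserving_piFinSuccAbove (fun _ : Fin (n + 1) => ℝ) (Fin.last n)).symm
  have h3 := PiLp.volume_preserving_toLp (Fin (n + 1))
  have h := h3.comp (h2.comp h1)
  convert! h using 1
  ext z i
  simp [snocEquiv_apply, MeasurableEquiv.piFinSuccAbove]

/-- Tonelli with the inner integral of sⁿ over 0 < s < 1/K(y). -/
theorem lintegral_radial {A : Set (EuclideanSpace ℝ (Fin n))} (hA : MeasurableSet A)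
    {K d : EuclideanSpace ℝ (Fin n) → ℝ} (hK : Measurable K) (hd : Measurable d)
    (hKpos : ∀ y ∈ A, 0 < K y) (hd0 : ∀ y ∈ A, 0 ≤ d y) :
    ∫⁻ z in {z : ℝ × EuclideanSpace ℝ (Fin n) | z.2 ∈ A ∧ 0 < z.1 ∧ z.1 * K z.2 < 1},
      ENNReal.ofReal (z.1 ^ n * d z.2) =
    ∫⁻ y in A, ENNReal.ofReal (d y * ((K y)⁻¹ ^ (n + 1) / (n + 1))) := by
  set D := {z : ℝ × EuclideanSpace ℝ (Fin n) | z.2 ∈ A ∧ 0 < z.1 ∧ z.1 * K z.2 < 1} with hD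
  have hDm : MeasurableSet D :=
    (measurable_snd hA).inter ((measurableSet_lt measurable_const measurable_fst).inter
      (measurableSet_lt (measurable_fst.mul (hK.comp measurable_snd)) measurable_const))
  have hm : Measurable fun z : ℝ × EuclideanSpace ℝ (Fin n) =>
      ENNReal.ofReal (z.1 ^ n * d z.2) :=
    ((measurable_fst.pow_const n).mul (hd.comp measurable_snd)).ennreal_ofReal
  rw [← lintegral_indicator hDm, Measure.volume_eq_prod,
    lintegral_prod_symm _ (hm.indicator hDm).aemeasurable, ← lintegral_indicator hA]
  refine lintegral_congr fun y => ?_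
  by_cases hy : y ∈ A
  · rw [indicator_of_mem hy]
    have hk := hKpos y hy
    have h1 : ∀ s : ℝ, D.indicator (fun z => ENNReal.ofReal (z.1 ^ n * d z.2)) (s, y) =
        (Ioo 0 (K y)⁻¹).indicator (fun s => ENNReal.ofReal (s ^ n * d y)) s := by
      intro s
      have : (s, y) ∈ D ↔ s ∈ Ioo 0 (K y)⁻¹ := by
        have e : s < (K y)⁻¹ ↔ s * K y < 1 := by rw [← one_div, lt_div_iff₀ hk]
        exact ⟨fun h => ⟨h.2.1, e.2 h.2.2⟩, fun h => ⟨hy, h.1, e.1 h.2⟩⟩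
      simp only [indicator, this]
    simp_rw [h1]
    have hR : 0 ≤ (K y)⁻¹ := (inv_pos.2 hk).le
    rw [lintegral_indicator measurableSet_Ioo, restrict_Ioo_eq_restrict_Ioc,
      ← ofReal_integral_eq_lintegral_ofReal, ← intervalIntegral.integral_of_le hR,
      intervalIntegral.integral_mul_const, integral_pow]
    · simp [mul_comm]
    · refine IntegrableOn.mono_set ?_ Ioc_subset_Icc_self
      exact (Continuous.continuousOn (by fun_prop)).integrableOn_compact isCompact_Icc
    · filter_upwards [ae_restrict_mem measurableSet_Ioc] with s hs
      exact mul_nonneg (pow_nonneg hs.1.le _) (hd0 y hy)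
  · rw [indicator_of_notMem hy]
    have h1 : ∀ s : ℝ, D.indicator (fun z => ENNReal.ofReal (z.1 ^ n * d z.2)) (s, y) = 0 :=
      fun s => indicator_of_notMem (fun h => hy h.1) _
    simp [h1]


/-- The values of a linear form on a basis, as a vector. -/
def evalBasis (b : Module.Basis (Fin (n + 1)) ℝ (Ambient n)) :
    (Ambient n →L[ℝ] ℝ) →L[ℝ] Ambient n :=
  LinearMap.toContinuousLinearMap
    { toFun := fun l => WithLp.toLp 2 fun j => l (b j)
      map_add' := fun l m => by ext j; simp
      map_smul' := fun c l => by ext j; simp }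

@[simp] theorem evalBasis_apply (b : Module.Basis (Fin (n + 1)) ℝ (Ambient n))
    (l : Ambient n →L[ℝ] ℝ) (j : Fin (n + 1)) : evalBasis b l j = l (b j) := rfl

theorem evalBasis_injective (b : Module.Basis (Fin (n + 1)) ℝ (Ambient n)) :
    Function.Injective (evalBasis b) := by
  intro l m h
  have h1 : (l : Ambient n →ₗ[ℝ] ℝ) = m := b.ext fun j => congrArg (fun v : Ambient n => v j) h
  exact ContinuousLinearMap.coe_injective h1

/-- The map (s,y) ↦ s·l(y) has Jacobian sⁿ·d(y) in absolute value. The area inequality needs no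
injectivity, and the ball condition s·‖l(y)‖ < 1 is then integrated radially. -/
theorem volume_cone_le (Ω : Ambient n [⋀^Fin (n + 1)]→ₗ[ℝ] ℝ)
    (b : Module.Basis (Fin (n + 1)) ℝ (Ambient n)) (hb : |Ω b| = 1)
    {O A : Set (EuclideanSpace ℝ (Fin n))} (hA : MeasurableSet A) (hAO : A ⊆ O)
    {l : EuclideanSpace ℝ (Fin n) → Ambient n →L[ℝ] ℝ}
    {q : EuclideanSpace ℝ (Fin n) → Fin n → Ambient n}
    {ξ : EuclideanSpace ℝ (Fin n) → Ambient n}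
    (hl : ∀ y ∈ O, DifferentiableAt ℝ l y) (hlq : ∀ y ∈ O, ∀ i, l y (q y i) = 0)
    (hlξ : ∀ y ∈ O, l y (ξ y) = 1) (hΩ : ∀ y ∈ O, Ω (Fin.snoc (q y) (ξ y)) ≠ 0)
    {d : EuclideanSpace ℝ (Fin n) → ℝ} (hdc : ContinuousOn d O)
    (hd : ∀ y ∈ O, d y = |(Matrix.of fun i j : Fin n =>
      fderiv ℝ l y (EuclideanSpace.single i (1 : ℝ)) (q y j)).det| /
        |Ω (Fin.snoc (q y) (ξ y))|) :
    volume {w : Ambient n | ∃ y ∈ A, ∃ s : ℝ, 0 < s ∧ w = evalBasis b (s • l y) ∧ ‖w‖ < 1} ≤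
      ∫⁻ y in A, ENNReal.ofReal (d y * (‖evalBasis b (l y)‖⁻¹ ^ (n + 1) / (n + 1))) := by
  classical
  set K : EuclideanSpace ℝ (Fin n) → ℝ := fun y => ‖evalBasis b (l y)‖ with hK
  have hlc : ContinuousOn l O := fun y hy => (hl y hy).continuousAt.continuousWithinAt
  have hKc : ContinuousOn K O := ((evalBasis b).continuous.comp_continuousOn hlc).norm
  have hd0 : ∀ y ∈ O, 0 ≤ d y := fun y hy => by rw [hd y hy]; positivity
  have hKpos : ∀ y ∈ O, 0 < K y := fun y hy => by
    rw [hK, norm_pos_iff]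
    intro h
    have := evalBasis_injective b (h.trans (map_zero _).symm)
    have h2 := hlξ y hy
    rw [this] at h2
    simp at h2
  -- K and d are controlled only on O; extension by zero off A makes them globally measurable.
  set K' := A.piecewise K 0
  set d' := A.piecewise d 0
  have hK'm : Measurable K' :=
    (hKc.mono hAO).measurable_piecewise continuousOn_const hA
  have hd'm : Measurable d' :=
    (hdc.mono hAO).measurable_piecewise continuousOn_const hA
  have hK' : ∀ y ∈ A, K' y = K y := fun y hy => piecewise_eq_of_mem _ _ _ hy
  have hd' : ∀ y ∈ A, d' y = d y := fun y hy => piecewise_eq_of_mem _ _ _ hy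
  set D := {z : ℝ × EuclideanSpace ℝ (Fin n) | z.2 ∈ A ∧ 0 < z.1 ∧ z.1 * K' z.2 < 1} with hD
  have hDm : MeasurableSet D :=
    (measurable_snd hA).inter ((measurableSet_lt measurable_const measurable_fst).inter
      (measurableSet_lt (measurable_fst.mul (hK'm.comp measurable_snd)) measurable_const))
  let Φ : ℝ × EuclideanSpace ℝ (Fin n) → ℝ × EuclideanSpace ℝ (Fin n) :=
    fun z => (snocEquiv n).symm (evalBasis b (z.1 • l z.2))
  let Φ' : ℝ × EuclideanSpace ℝ (Fin n) →
      (ℝ × EuclideanSpace ℝ (Fin n)) →L[ℝ] (ℝ × EuclideanSpace ℝ (Fin n)) := fun z =>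
    (((snocEquiv n).symm : Ambient n →L[ℝ] ℝ × EuclideanSpace ℝ (Fin n)).comp (evalBasis b)).comp
      (z.1 • (fderiv ℝ l z.2).comp (ContinuousLinearMap.snd ℝ ℝ _) +
        (ContinuousLinearMap.fst ℝ ℝ _).smulRight (l z.2))
  have hΦ : ∀ z ∈ D, HasFDerivWithinAt Φ (Φ' z) D z := by
    intro z hz
    refine HasFDerivAt.hasFDerivWithinAt ?_
    have h1 : HasFDerivAt (fun z : ℝ × EuclideanSpace ℝ (Fin n) => z.1 • l z.2)
        (z.1 • (fderiv ℝ l z.2).comp (ContinuousLinearMap.snd ℝ ℝ _) +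
          (ContinuousLinearMap.fst ℝ ℝ _).smulRight (l z.2)) z :=
      hasFDerivAt_fst.smul ((hl z.2 (hAO hz.1)).hasFDerivAt.comp z hasFDerivAt_snd)
    exact (((snocEquiv n).symm : Ambient n →L[ℝ] ℝ × EuclideanSpace ℝ (Fin n)).comp
      (evalBasis b)).hasFDerivAt.comp z h1
  have hdet : ∀ z ∈ D, |(Φ' z).det| = z.1 ^ n * d' z.2 := by
    intro z hz
    have hzO := hAO hz.1
    set e := EuclideanSpace.basisFun (Fin (n + 1)) ℝ
    let φ : Fin (n + 1) → Ambient n →ₗ[ℝ] ℝ := Fin.snoc (α := fun _ => Ambient n →ₗ[ℝ] ℝ)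
      (fun i => ((z.1 • fderiv ℝ l z.2 (EuclideanSpace.single i (1 : ℝ)) : Ambient n →L[ℝ] ℝ) :
        Ambient n →ₗ[ℝ] ℝ)) (l z.2 : Ambient n →ₗ[ℝ] ℝ)
    have h1 : (Φ' z).det = (Matrix.of fun i j => φ i (b j)).det := by
      have e1 : (Φ' z).det = LinearMap.det
          (((snocEquiv n).toLinearEquiv : (ℝ × EuclideanSpace ℝ (Fin n)) →ₗ[ℝ] Ambient n) ∘ₗ
            (Φ' z : _ →ₗ[ℝ] _) ∘ₗ ((snocEquiv n).toLinearEquiv.symm :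
              Ambient n →ₗ[ℝ] ℝ × EuclideanSpace ℝ (Fin n))) :=
        (LinearMap.det_conj _ _).symm
      rw [e1, ← LinearMap.det_toMatrix e.toBasis, ← Matrix.det_transpose]
      congr 1
      ext i j
      rw [Matrix.transpose_apply, LinearMap.toMatrix_apply, Matrix.of_apply]
      have e2 : ∀ w : ℝ × EuclideanSpace ℝ (Fin n), (snocEquiv n) (Φ' z w) =
          evalBasis b (z.1 • fderiv ℝ l z.2 w.2 + w.1 • l z.2) := fun w => by
        simp [Φ']
      have e3 : e.toBasis.repr ((snocEquiv n) (Φ' z ((snocEquiv n).symm (e.toBasis i)))) j =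
          φ i (b j) := by
        rw [e2, snocEquiv_symm_apply]
        refine Fin.lastCases ?_ (fun i => ?_) i
        · have h0 : (WithLp.toLp 2 fun i : Fin n =>
              (e.toBasis (Fin.last n)).ofLp i.castSucc : EuclideanSpace ℝ (Fin n)) = 0 := by
            ext i; simp [e]
          rw [h0]
          simp [e, φ]
        · have h0 : (WithLp.toLp 2 fun j : Fin n =>
              (e.toBasis i.castSucc).ofLp j.castSucc : EuclideanSpace ℝ (Fin n)) =
              EuclideanSpace.single i 1 := by
            ext j; simp [e]
          rw [h0]
          simp [e, φ]
      exact e3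
    -- In the frame (q, ξ) the matrix is block triangular: its last row is l, which is 0 on each q_j
    -- and 1 on ξ. The other rows contribute the factor sⁿ.
    have h2 := det_apply_mul_eq Ω b φ (Fin.snoc (q z.2) (ξ z.2))
    have h3 : (Matrix.of fun i j => φ i (Fin.snoc (α := fun _ => Ambient n) (q z.2) (ξ z.2) j)).det
        = z.1 ^ n * (Matrix.of fun i j : Fin n =>
          fderiv ℝ l z.2 (EuclideanSpace.single i (1 : ℝ)) (q z.2 j)).det := by
      rw [det_snoc_of_last_row]
      · have : (Matrix.of fun i j : Fin n => (Matrix.of fun i j => φ i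
            (Fin.snoc (α := fun _ => Ambient n) (q z.2) (ξ z.2) j)) i.castSucc j.castSucc) =
            z.1 • (Matrix.of fun i j : Fin n =>
              fderiv ℝ l z.2 (EuclideanSpace.single i (1 : ℝ)) (q z.2 j)) := by
          ext i j; simp [φ]
        rw [this, Matrix.det_smul]; simp
      · intro j; simp [φ, hlq _ hzO]
      · simp [φ, hlξ _ hzO]
    rw [h3] at h2
    have h4 := congrArg abs h2
    rw [abs_mul, abs_mul, abs_mul, hb, mul_one, abs_of_nonneg (pow_nonneg hz.2.1.le n), ← h1] at h4
    rw [hd' _ hz.1, hd _ hzO, ← mul_div_assoc, eq_div_iff (abs_ne_zero.2 (hΩ _ hzO)), h4]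
  have himage : {w : Ambient n | ∃ y ∈ A, ∃ s : ℝ, 0 < s ∧ w = evalBasis b (s • l y) ∧ ‖w‖ < 1} ⊆
      (snocEquiv n).symm ⁻¹' (Φ '' D) := by
    rintro w ⟨y, hy, s, hs, rfl, hw⟩
    refine ⟨(s, y), ⟨hy, hs, ?_⟩, rfl⟩
    rw [map_smul, norm_smul, Real.norm_eq_abs, abs_of_pos hs] at hw
    rw [hK' y hy]; exact hw
  have hpres : MeasurePreserving (snocEquiv n).symm volume volume :=
    measurePreserving_snocEquiv.symm (snocEquiv n).toHomeomorph.toMeasurableEquiv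
  have hvol : volume ((snocEquiv n).symm ⁻¹' (Φ '' D)) = volume (Φ '' D) :=
    hpres.measure_preimage_equiv
      (f := (snocEquiv n).toHomeomorph.toMeasurableEquiv.symm) (Φ '' D)
  have hHaar : (volume : Measure (ℝ × EuclideanSpace ℝ (Fin n))).IsAddHaarMeasure := by
    rw [Measure.volume_eq_prod]; infer_instance
  calc _ ≤ volume (Φ '' D) := (measure_mono himage).trans hvol.le
    _ ≤ ∫⁻ z in D, ENNReal.ofReal |(Φ' z).det| :=
        addHaar_image_le_lintegral_abs_det_fderiv volume hDm hΦ
    _ = ∫⁻ z in D, ENNReal.ofReal (z.1 ^ n * d' z.2) :=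
        setLIntegral_congr_fun hDm fun z hz => by rw [hdet z hz]
    _ = ∫⁻ y in A, ENNReal.ofReal (d' y * ((K' y)⁻¹ ^ (n + 1) / (n + 1))) :=
        lintegral_radial hA hK'm hd'm (fun y hy => by rw [hK' y hy]; exact hKpos y (hAO hy))
          (fun y hy => by rw [hd' y hy]; exact hd0 y (hAO hy))
    _ = _ := setLIntegral_congr_fun hA fun y hy => by simp only [hd' y hy, hK' y hy, hK]

end Area

/-! ### Conormals of hyperplanes -/

section Conormal

variable {X E : Type*} [NormedAddCommGroup X] [NormedSpace ℝ X]
  [NormedAddCommGroup E] [NormedSpace ℝ E]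

/-- The map `X × ℝ → E` given by `T` on `X` and by `ξ` on `ℝ`. -/
def frameMap (T : X →L[ℝ] E) (ξ : E) : (X × ℝ) →L[ℝ] E :=
  T.comp (ContinuousLinearMap.fst ℝ X ℝ) + (ContinuousLinearMap.snd ℝ X ℝ).smulRight ξ

/-- The linear form vanishing on the range of `T` with value one at `ξ`. -/
def conormal (T : X →L[ℝ] E) (ξ : E) : E →L[ℝ] ℝ :=
  (ContinuousLinearMap.snd ℝ X ℝ).comp (frameMap T ξ).inverse

theorem frameMap_apply (T : X →L[ℝ] E) (ξ : E) (z : X × ℝ) :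
    frameMap T ξ z = T z.1 + z.2 • ξ := rfl

variable [FiniteDimensional ℝ X] [FiniteDimensional ℝ E]

theorem exists_equiv_frameMap
    (hdim : Module.finrank ℝ E = Module.finrank ℝ X + 1)
    {T : X →L[ℝ] E} (hT : Function.Injective T) {ξ : E} (hξ : ξ ∉ range T) :
    ∃ Q : (X × ℝ) ≃L[ℝ] E, (Q : (X × ℝ) →L[ℝ] E) = frameMap T ξ := by
  have hinj : Function.Injective (frameMap T ξ) := by
    rw [injective_iff_map_eq_zero]
    rintro ⟨c, t⟩ h
    rw [frameMap_apply] at h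
    simp only at h
    have ht : t = 0 := by
      by_contra ht
      refine hξ ⟨-(t⁻¹ • c), ?_⟩
      rw [map_neg, map_smul, eq_neg_of_add_eq_zero_left h, smul_neg, neg_neg, inv_smul_smul₀ ht]
    rw [ht, zero_smul, add_zero] at h
    rw [ht, (injective_iff_map_eq_zero T).1 hT c h]; rfl
  have hfr : Module.finrank ℝ (X × ℝ) = Module.finrank ℝ E := by
    rw [Module.finrank_prod, hdim]; simp
  refine ⟨(LinearEquiv.ofInjectiveOfFinrankEq (frameMap T ξ : (X × ℝ) →ₗ[ℝ] E) hinj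
    hfr).toContinuousLinearEquiv, ?_⟩
  ext z <;> rfl

theorem conormal_apply_frame (hdim : Module.finrank ℝ E = Module.finrank ℝ X + 1)
    {T : X →L[ℝ] E} (hT : Function.Injective T) {ξ : E} (hξ : ξ ∉ range T) (c : X) (t : ℝ) :
    conormal T ξ (T c + t • ξ) = t := by
  obtain ⟨Q, hQ⟩ := exists_equiv_frameMap hdim hT hξ
  have : T c + t • ξ = Q (c, t) := (congrArg (fun R : (X × ℝ) →L[ℝ] E => R (c, t)) hQ).symm
  rw [conormal, ← hQ, ContinuousLinearMap.inverse_equiv, this]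
  simp

theorem conormal_apply_self (hdim : Module.finrank ℝ E = Module.finrank ℝ X + 1)
    {T : X →L[ℝ] E} (hT : Function.Injective T) {ξ : E} (hξ : ξ ∉ range T) :
    conormal T ξ ξ = 1 := by
  simpa using conormal_apply_frame hdim hT hξ 0 1

theorem conormal_eq_zero_iff (hdim : Module.finrank ℝ E = Module.finrank ℝ X + 1)
    {T : X →L[ℝ] E} (hT : Function.Injective T) {ξ : E} (hξ : ξ ∉ range T) (w : E) :
    conormal T ξ w = 0 ↔ ∃ c, T c = w := by
  obtain ⟨Q, hQ⟩ := exists_equiv_frameMap hdim hT hξ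
  obtain ⟨⟨c, t⟩, rfl⟩ := Q.surjective w
  have : Q (c, t) = T c + t • ξ := congrArg (fun R : (X × ℝ) →L[ℝ] E => R (c, t)) hQ
  rw [this, conormal_apply_frame hdim hT hξ]
  refine ⟨fun h => ⟨c, by simp [h]⟩, fun ⟨c', hc'⟩ => ?_⟩
  have h2 := conormal_apply_frame hdim hT hξ c' 0
  rw [zero_smul, add_zero, hc', conormal_apply_frame hdim hT hξ] at h2
  exact h2

theorem eq_smul_conormal (hdim : Module.finrank ℝ E = Module.finrank ℝ X + 1)
    {T : X →L[ℝ] E} (hT : Function.Injective T) {ξ : E} (hξ : ξ ∉ range T) {l : E →L[ℝ] ℝ}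
    (h0 : ∀ c, l (T c) = 0) : l = l ξ • conormal T ξ := by
  obtain ⟨Q, hQ⟩ := exists_equiv_frameMap hdim hT hξ
  ext w
  obtain ⟨⟨c, t⟩, rfl⟩ := Q.surjective w
  have : Q (c, t) = T c + t • ξ := congrArg (fun R : (X × ℝ) →L[ℝ] E => R (c, t)) hQ
  rw [smul_apply, this, conormal_apply_frame hdim hT hξ]
  simp [h0, mul_comm]

/-- The conormal is a coordinate of the inverse of the frame map, and inversion is smooth at an
invertible operator. -/
theorem contDiffAt_conormal {Y : Type*} [NormedAddCommGroup Y] [NormedSpace ℝ Y]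
    (hdim : Module.finrank ℝ E = Module.finrank ℝ X + 1) {T : Y → X →L[ℝ] E} {ξ : Y → E} {y : Y}
    (hTc : ContDiffAt ℝ ∞ T y) (hξc : ContDiffAt ℝ ∞ ξ y) (hT : Function.Injective (T y))
    (hξ : ξ y ∉ range (T y)) : ContDiffAt ℝ ∞ (fun y => conormal (T y) (ξ y)) y := by
  obtain ⟨Q, hQ⟩ := exists_equiv_frameMap hdim hT hξ
  have : CompleteSpace X := FiniteDimensional.complete ℝ X
  have h1 : ContDiffAt ℝ ∞ (fun y => frameMap (T y) (ξ y)) y :=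
    (hTc.clm_comp contDiffAt_const).add (contDiffAt_const.smulRight hξc)
  have h2 : ContDiffAt ℝ ∞ ContinuousLinearMap.inverse (frameMap (T y) (ξ y)) := by
    rw [← hQ]; exact contDiffAt_map_inverse Q
  exact contDiffAt_const.clm_comp (ContDiffAt.comp y (g := ContinuousLinearMap.inverse) h2 h1)

end Conormal

/-! ### Linear algebra of volume elements -/

section LinearAlgebra

variable {n : ℕ}

theorem det_bilin_eq {X : Type*} [AddCommGroup X] [Module ℝ X] (c : Module.Basis (Fin n) ℝ X)
    (β : X →ₗ[ℝ] X →ₗ[ℝ] ℝ) (v : Fin n → X) :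
    (Matrix.of fun i j => β (v i) (v j)).det =
      c.det v ^ 2 * (Matrix.of fun i j => β (c i) (c j)).det := by
  have h : (Matrix.of fun i j => β (v i) (v j)) =
      (c.toMatrix v).transpose * (Matrix.of fun i j => β (c i) (c j)) * c.toMatrix v := by
    ext i j
    have hi := c.sum_toMatrix_smul_self v i
    have hj := c.sum_toMatrix_smul_self v j
    simp only [Matrix.of_apply, Matrix.mul_apply, Matrix.transpose_apply]
    conv_lhs => rw [← hj, ← hi]
    simp only [map_sum, map_smul, LinearMap.sum_apply, LinearMap.smul_apply, smul_eq_mul]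
    refine Finset.sum_congr rfl fun x _ => ?_
    rw [mul_comm]
  rw [h, Matrix.det_mul, Matrix.det_mul, Matrix.det_transpose, Module.Basis.det_apply]
  ring

/-- Up to signs, the products omitting one vector are dual to v under the height pairing. Diagonally
a permutation of v appears; off the diagonal a vector is repeated. -/
theorem abs_height_ιMulti_succAbove {Ω : Ambient n [⋀^Fin (n + 1)]→ₗ[ℝ] ℝ}
    {v : Fin (n + 1) → Ambient n} (hv : Ω v = 1) (i j : Fin (n + 1)) :
    |height Ω (exteriorPower.ιMulti ℝ n fun k => v (i.succAbove k)) (v j)| =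
      if i = j then 1 else 0 := by
  rw [height_ιMulti]
  split_ifs with h
  · subst h
    have hbij : Function.Bijective
        (Fin.snoc (α := fun _ => Fin (n + 1)) i.succAbove i) := by
      rw [← Finite.injective_iff_bijective]
      refine Fin.snoc_injective_iff.2 ⟨Fin.succAbove_right_injective, ?_⟩
      rintro ⟨k, hk⟩
      exact Fin.succAbove_ne i k hk
    have h1 : (Fin.snoc (α := fun _ => Ambient n) (fun k => v (i.succAbove k)) (v i)) =
        v ∘ (Equiv.ofBijective _ hbij) := by
      ext1 k
      refine Fin.lastCases ?_ (fun k => ?_) k <;> simp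
    rw [h1, AlternatingMap.map_perm, hv]
    rcases Int.units_eq_one_or (Equiv.Perm.sign (Equiv.ofBijective _ hbij)) with h | h <;>
      simp [h]
  · obtain ⟨k, hk⟩ := Fin.exists_succAbove_eq (Ne.symm h)
    rw [abs_eq_zero]
    refine Ω.map_eq_zero_of_eq _ (i := k.castSucc) (j := Fin.last n) ?_ (Fin.castSucc_lt_last k).ne
    simp [hk]

theorem exists_apply_eq_one {Ω : Ambient n [⋀^Fin (n + 1)]→ₗ[ℝ] ℝ} (hΩ : Ω ≠ 0) :
    ∃ v, Ω v = 1 := by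
  have h : ∃ v, Ω v ≠ 0 := by
    by_contra! h
    exact hΩ (AlternatingMap.ext h)
  obtain ⟨v, hv⟩ := h
  refine ⟨Function.update v 0 ((Ω v)⁻¹ • v 0), ?_⟩
  rw [AlternatingMap.map_update_smul, Function.update_eq_self, smul_eq_mul, inv_mul_cancel₀ hv]

/-- Take b dual to ζ under the height pairing: the coordinates of φ in ζ are then the values of its
height function on b, so S becomes a round sphere. The normalization of ζ makes b unimodular up to
sign, and only absolute values matter below. -/
theorem IsUnitEllipsoid.exists_basis {Ω : Ambient n [⋀^Fin (n + 1)]→ₗ[ℝ] ℝ} (hΩ : Ω ≠ 0)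
    {S : Set (⋀[ℝ]^n (Ambient n))} (hS : IsUnitEllipsoid Ω S) :
    ∃ b : Module.Basis (Fin (n + 1)) ℝ (Ambient n), |Ω b| = 1 ∧
      ∀ φ, φ ∈ S ↔ ∑ j, height Ω φ (b j) ^ 2 = 1 := by
  obtain ⟨Ωn, ζ, hind, hζ, hSeq⟩ := hS
  obtain ⟨v, hv⟩ := exists_apply_eq_one hΩ
  set φ : Fin (n + 1) → ⋀[ℝ]^n (Ambient n) :=
    fun i => exteriorPower.ιMulti ℝ n fun k => v (i.succAbove k) with hφ
  set N : Matrix (Fin (n + 1)) (Fin (n + 1)) ℝ := Matrix.of fun i j => height Ω (ζ i) (v j) with hN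
  have hdφ : |(Matrix.of fun i j => height Ω (φ i) (v j)).det| = 1 := by
    have h1 : (Matrix.of fun i j => height Ω (φ i) (v j)) =
        Matrix.diagonal fun i => height Ω (φ i) (v i) := by
      ext i j
      rw [Matrix.of_apply, Matrix.diagonal_apply]
      split_ifs with h
      · rw [h]
      · have := abs_height_ιMulti_succAbove hv i j
        rw [if_neg h, abs_eq_zero] at this
        exact this
    rw [h1, Matrix.det_diagonal, Finset.abs_prod]
    refine Finset.prod_eq_one fun i _ => ?_
    have := abs_height_ιMulti_succAbove hv i i
    rwa [if_pos rfl] at this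
  have hmul : (Matrix.of fun i j => height Ω (φ i) (v j)) = (ζ.toMatrix φ).transpose * N := by
    ext i j
    rw [Matrix.of_apply, Matrix.mul_apply]
    have h := congrArg (fun ψ => height Ω ψ (v j)) (ζ.sum_toMatrix_smul_self φ i)
    simp only [map_sum, map_smul, LinearMap.sum_apply, LinearMap.smul_apply, smul_eq_mul] at h
    exact h.symm
  -- The induced volume is ±1 on the products φ and 1 on ζ, so the transition determinant is ±1.
  have hC : |(ζ.toMatrix φ).det| = 1 := by
    have h1 : Ωn φ = (ζ.toMatrix φ).det := by
      rw [AlternatingMap.eq_smul_basis_det ζ Ωn, hζ, one_smul, Module.Basis.det_apply]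
    rw [← h1, hind v hv, abs_pow]; simp
  have hdN : |N.det| = 1 := by
    rw [hmul, Matrix.det_mul, Matrix.det_transpose, abs_mul, hC, one_mul] at hdφ
    exact hdφ
  have hNu : IsUnit N.det := isUnit_iff_ne_zero.2 fun h => by rw [h] at hdN; simp at hdN
  set b : Fin (n + 1) → Ambient n := fun j => ∑ k, N⁻¹ k j • v k with hb
  have hdual : ∀ i j, height Ω (ζ i) (b j) = if i = j then 1 else 0 := by
    intro i j
    have h1 := congrFun (congrFun (Matrix.mul_nonsing_inv N hNu) i) j
    rw [Matrix.mul_apply, Matrix.one_apply] at h1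
    rw [← h1, hb]
    simp only [map_sum, map_smul, smul_eq_mul]
    exact Finset.sum_congr rfl fun k _ => mul_comm _ _
  have hli : LinearIndependent ℝ b := by
    rw [Fintype.linearIndependent_iff]
    intro g hg i
    have h1 := congrArg (height Ω (ζ i)) hg
    simpa [hdual] using h1
  let B := basisOfLinearIndependentOfCardEqFinrank hli (by simp)
  have hBb : (B : Fin (n + 1) → Ambient n) = b :=
    coe_basisOfLinearIndependentOfCardEqFinrank hli _
  refine ⟨B, ?_, fun ψ => ?_⟩
  · have h1 := det_apply_mul_eq Ω B (fun i => height Ω (ζ i)) v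
    rw [hv, mul_one, hBb] at h1
    have h2 : (Matrix.of fun i j => height Ω (ζ i) (b j)) = 1 := by
      ext i j; rw [Matrix.of_apply, hdual, Matrix.one_apply]
    rw [h2, Matrix.det_one] at h1
    have h3 := congrArg abs h1
    rw [abs_mul, abs_one, ← hN, hdN, one_mul] at h3
    rw [hBb]; exact h3
  · have hcoord : ∀ j, height Ω ψ (B j) = ζ.repr ψ j := by
      intro j
      rw [hBb]
      have h1 := congrArg (fun ψ => height Ω ψ (b j)) (ζ.sum_repr ψ)
      simp only [map_sum, map_smul, LinearMap.sum_apply, LinearMap.smul_apply, smul_eq_mul,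
        hdual, mul_ite, mul_one, mul_zero, Finset.sum_ite_eq', Finset.mem_univ, if_true] at h1
      exact h1.symm
    simp only [hcoord, hSeq]
    constructor
    · rintro ⟨a, ha, rfl⟩
      have : ∀ j, ζ.repr (∑ i, a i • ζ i) j = a j := fun j => by
        rw [ζ.repr_sum_self]
      simpa only [this] using ha
    · intro h
      exact ⟨fun j => ζ.repr ψ j, h, (ζ.sum_repr ψ).symm⟩

end LinearAlgebra

/-! ### The conormal field of an equiaffine immersion -/

section Immersion

variable {n : ℕ} {M : Type*} [TopologicalSpace M] [ChartedSpace (EuclideanSpace ℝ (Fin n)) M]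

/-- The differential of `f` at `p`, on the model space of the tangent space. -/
def differential (f : M → Ambient n) (p : M) : EuclideanSpace ℝ (Fin n) →L[ℝ] Ambient n :=
  mvfderiv (𝓡 n) f p

/-- The linear form on the ambient space which vanishes on the tangent hyperplane at `p` and has
value one at `ξ p`. -/
def conormalField (f ξ : M → Ambient n) (p : M) : Ambient n →L[ℝ] ℝ :=
  conormal (differential f p) (ξ p)

/-- The inverse of the preferred chart at `x`. -/
def param (x : M) : EuclideanSpace ℝ (Fin n) → M :=
  (chartAt (EuclideanSpace ℝ (Fin n)) x).symm

/-- The domain of `param x`. -/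
def paramDomain (x : M) : Set (EuclideanSpace ℝ (Fin n)) :=
  (chartAt (EuclideanSpace ℝ (Fin n)) x).target

theorem isOpen_paramDomain (x : M) : IsOpen (paramDomain (n := n) x) :=
  (chartAt (EuclideanSpace ℝ (Fin n)) x).open_target

/-- The derivative of `param x`. -/
def paramDeriv (x : M) (y : EuclideanSpace ℝ (Fin n)) :
    EuclideanSpace ℝ (Fin n) →L[ℝ] EuclideanSpace ℝ (Fin n) :=
  mfderiv (𝓡 n) (𝓡 n) (param x) y

theorem exists_param_eq (p : M) : ∃ y ∈ paramDomain (n := n) p, param p y = p :=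
  ⟨chartAt _ p p, mem_chart_target _ p,
    (chartAt (EuclideanSpace ℝ (Fin n)) p).left_inv (mem_chart_source _ p)⟩

variable [IsManifold (𝓡 n) ∞ M]

theorem contMDiffOn_param (x : M) :
    ContMDiffOn (𝓡 n) (𝓡 n) ∞ (param (n := n) x) (paramDomain x) :=
  contMDiffOn_chart_symm

theorem mdifferentiable_chartAt (x : M) :
    (chartAt (EuclideanSpace ℝ (Fin n)) x).MDifferentiable (𝓡 n) (𝓡 n) :=
  haveI : IsManifold (𝓡 n) 1 M := IsManifold.of_le (n := ∞) (by simp)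
  mdifferentiable_chart x

theorem paramDeriv_bijective {x : M} {y : EuclideanSpace ℝ (Fin n)} (hy : y ∈ paramDomain x) :
    Function.Bijective (paramDeriv x y) :=
  (mdifferentiable_chartAt x).symm.mfderiv_bijective hy

theorem contDiffAt_comp_param {F : Type*} [NormedAddCommGroup F] [NormedSpace ℝ F] {g : M → F}
    (hg : ContMDiff (𝓡 n) 𝓘(ℝ, F) ∞ g) {x : M} {y : EuclideanSpace ℝ (Fin n)}
    (hy : y ∈ paramDomain x) : ContDiffAt ℝ ∞ (g ∘ param x) y := by
  have h1 : ContMDiffAt (𝓡 n) (𝓡 n) ∞ (param (n := n) x) y :=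
    (contMDiffOn_param x).contMDiffAt ((isOpen_paramDomain x).mem_nhds hy)
  have h2 : ContMDiffAt (𝓡 n) 𝓘(ℝ, F) ∞ (g ∘ param x) y := (hg _).comp y h1
  exact h2.contDiffAt

theorem fderiv_comp_param {F : Type*} [NormedAddCommGroup F] [NormedSpace ℝ F] {g : M → F}
    {x : M} {y : EuclideanSpace ℝ (Fin n)}
    (hg : MDifferentiableAt (𝓡 n) 𝓘(ℝ, F) g (param x y))
    (hy : y ∈ paramDomain x) (c : EuclideanSpace ℝ (Fin n)) :
    fderiv ℝ (g ∘ param x) y c = mvfderiv (𝓡 n) g (param x y) (paramDeriv x y c) := by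
  have h1 : MDifferentiableAt (𝓡 n) (𝓡 n) (param (n := n) x) y :=
    ((contMDiffOn_param x).contMDiffAt
      ((isOpen_paramDomain x).mem_nhds hy)).mdifferentiableAt (by simp)
  rw [← mfderiv_eq_fderiv]
  have := mfderiv_comp y hg h1
  exact congrArg (fun T : EuclideanSpace ℝ (Fin n) →L[ℝ] F => T c) this

variable {Ω : Ambient n [⋀^Fin (n + 1)]→ₗ[ℝ] ℝ} {A : EquiaffineStructure n M} {f ξ : M → Ambient n}

theorem finrank_ambient : Module.finrank ℝ (Ambient n) =
    Module.finrank ℝ (EuclideanSpace ℝ (Fin n)) + 1 := by simp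

theorem IsEquiaffineImmersion.differential_injective (hf : IsEquiaffineImmersion Ω A f ξ) (p : M) :
    Function.Injective (differential f p) := hf.immersion p

theorem IsEquiaffineImmersion.notMem_range (hf : IsEquiaffineImmersion Ω A f ξ) (p : M) :
    ξ p ∉ range (differential f p) := hf.transversal p

theorem IsEquiaffineImmersion.conormalField_eq_zero_iff (hf : IsEquiaffineImmersion Ω A f ξ)
    (p : M) (w : Ambient n) : conormalField f ξ p w = 0 ↔ ∃ c, differential f p c = w :=
  conormal_eq_zero_iff finrank_ambient (hf.differential_injective p) (hf.notMem_range p) w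

theorem IsEquiaffineImmersion.conormalField_differential (hf : IsEquiaffineImmersion Ω A f ξ)
    (p : M) (c : EuclideanSpace ℝ (Fin n)) : conormalField f ξ p (differential f p c) = 0 :=
  (hf.conormalField_eq_zero_iff p _).2 ⟨c, rfl⟩

theorem IsEquiaffineImmersion.conormalField_transversal (hf : IsEquiaffineImmersion Ω A f ξ)
    (p : M) : conormalField f ξ p (ξ p) = 1 :=
  conormal_apply_self finrank_ambient (hf.differential_injective p) (hf.notMem_range p)

theorem IsEquiaffineImmersion.eq_smul_conormalField (hf : IsEquiaffineImmersion Ω A f ξ)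
    {p : M} {l : Ambient n →L[ℝ] ℝ} (h0 : ∀ c, l (differential f p c) = 0) :
    l = l (ξ p) • conormalField f ξ p :=
  eq_smul_conormal finrank_ambient (hf.differential_injective p) (hf.notMem_range p) h0

theorem IsEquiaffineImmersion.fderiv_comp_param (hf : IsEquiaffineImmersion Ω A f ξ) {x : M}
    {y : EuclideanSpace ℝ (Fin n)} (hy : y ∈ paramDomain x) (c : EuclideanSpace ℝ (Fin n)) :
    fderiv ℝ (f ∘ param x) y c = differential f (param x y) (paramDeriv x y c) :=
  EquiaffineHypersurface.fderiv_comp_param ((hf.smooth _).mdifferentiableAt (by simp)) hy c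

theorem IsEquiaffineImmersion.fderiv_comp_param_injective (hf : IsEquiaffineImmersion Ω A f ξ)
    {x : M} {y : EuclideanSpace ℝ (Fin n)} (hy : y ∈ paramDomain x) :
    Function.Injective (fderiv ℝ (f ∘ param x) y) := by
  intro a b h
  rw [hf.fderiv_comp_param hy, hf.fderiv_comp_param hy] at h
  exact (paramDeriv_bijective hy).1 (hf.differential_injective _ h)

theorem IsEquiaffineImmersion.range_fderiv_comp_param (hf : IsEquiaffineImmersion Ω A f ξ)
    {x : M} {y : EuclideanSpace ℝ (Fin n)} (hy : y ∈ paramDomain x) :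
    range (fderiv ℝ (f ∘ param x) y) = range (differential f (param x y)) := by
  ext w
  constructor
  · rintro ⟨c, rfl⟩
    exact ⟨_, (hf.fderiv_comp_param hy c).symm⟩
  · rintro ⟨c, rfl⟩
    obtain ⟨c, rfl⟩ := (paramDeriv_bijective hy).2 c
    exact ⟨c, hf.fderiv_comp_param hy c⟩

theorem IsEquiaffineImmersion.conormalField_comp_param (hf : IsEquiaffineImmersion Ω A f ξ)
    {x : M} {y : EuclideanSpace ℝ (Fin n)} (hy : y ∈ paramDomain x) :
    conormalField f ξ (param x y) = conormal (fderiv ℝ (f ∘ param x) y) ((ξ ∘ param x) y) := by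
  have hξ : (ξ ∘ param x) y ∉ range (fderiv ℝ (f ∘ param x) y) := by
    rw [hf.range_fderiv_comp_param hy]; exact hf.notMem_range _
  have h := eq_smul_conormal finrank_ambient (hf.fderiv_comp_param_injective hy) hξ
    (l := conormalField f ξ (param x y)) (fun c => by
      rw [hf.fderiv_comp_param hy]; exact hf.conormalField_differential _ _)
  rw [h]
  have : conormalField f ξ (param x y) ((ξ ∘ param x) y) = 1 := hf.conormalField_transversal _
  rw [this, one_smul]

theorem IsEquiaffineImmersion.contDiffAt_conormalField_comp_param
    (hf : IsEquiaffineImmersion Ω A f ξ) {x : M} {y : EuclideanSpace ℝ (Fin n)}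
    (hy : y ∈ paramDomain x) : ContDiffAt ℝ ∞ (conormalField f ξ ∘ param x) y := by
  have h1 : ContDiffAt ℝ ∞ (f ∘ param x) y := contDiffAt_comp_param hf.smooth hy
  have h2 : ContDiffAt ℝ ∞ (ξ ∘ param x) y := contDiffAt_comp_param hf.transversal_smooth hy
  have hξ : (ξ ∘ param x) y ∉ range (fderiv ℝ (f ∘ param x) y) := by
    rw [hf.range_fderiv_comp_param hy]; exact hf.notMem_range _
  refine (contDiffAt_conormal finrank_ambient (h1.fderiv_right (m := ∞) (by simp)) h2
    (hf.fderiv_comp_param_injective hy) hξ).congr_of_eventuallyEq ?_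
  filter_upwards [(isOpen_paramDomain x).mem_nhds hy] with z hz
  exact hf.conormalField_comp_param hz

theorem IsEquiaffineImmersion.contMDiff_conormalField (hf : IsEquiaffineImmersion Ω A f ξ) :
    ContMDiff (𝓡 n) 𝓘(ℝ, Ambient n →L[ℝ] ℝ) ∞ (conormalField f ξ) := by
  intro p
  set e := chartAt (EuclideanSpace ℝ (Fin n)) p
  have h1 : ContMDiffAt (𝓡 n) 𝓘(ℝ, Ambient n →L[ℝ] ℝ) ∞ (conormalField f ξ ∘ param p) (e p) :=
    (hf.contDiffAt_conormalField_comp_param (mem_chart_target _ p)).contMDiffAt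
  have h2 : ContMDiffAt (𝓡 n) (𝓡 n) ∞ e p :=
    contMDiffOn_chart.contMDiffAt (e.open_source.mem_nhds (mem_chart_source _ p))
  refine (h1.comp p h2).congr_of_eventuallyEq ?_
  filter_upwards [e.open_source.mem_nhds (mem_chart_source _ p)] with q hq
  exact congrArg (conormalField f ξ) (e.left_inv hq).symm

/-- Differentiate ℓ(df Y) = 0 along u, with Y extending w. The tangential term df(∇_u Y) is killed
by ℓ. -/
theorem conormalField_affineFundamentalForm (hf : IsEquiaffineImmersion Ω A f ξ) (p : M)
    (u w : EuclideanSpace ℝ (Fin n)) :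
    conormalField f ξ p (affineFundamentalForm A f p u w) =
      -(mvfderiv (𝓡 n) (conormalField f ξ) p u (differential f p w)) := by
  set Y : (q : M) → TangentSpace (𝓡 n) q :=
    FiberBundle.extend (EuclideanSpace ℝ (Fin n)) (w : TangentSpace (𝓡 n) p) with hY
  have hYp : Y p = w := FiberBundle.extend_apply_self _ _
  have hYs : ContMDiffAt (𝓡 n) (𝓡 n).tangent ∞
      (fun q => (⟨q, Y q⟩ : TangentBundle (𝓡 n) M)) p :=
    FiberBundle.contMDiffAt_extend (𝓡 n) (EuclideanSpace ℝ (Fin n)) _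
  set g : M → Ambient n := fun q => mvfderiv (𝓡 n) f q (Y q) with hg
  have hgs : MDifferentiableAt (𝓡 n) 𝓘(ℝ, Ambient n) g p := by
    have h1 : ContMDiff (𝓡 n).tangent (𝓘(ℝ, Ambient n)).tangent ∞
        (tangentMap (𝓡 n) 𝓘(ℝ, Ambient n) f) :=
      hf.smooth.contMDiff_tangentMap (by simp)
    have h2 := (contMDiff_snd_tangentBundle_modelSpace (n := ∞) (Ambient n)
      𝓘(ℝ, Ambient n)).comp h1
    exact ((h2 _).comp p hYs).mdifferentiableAt (by simp)
  have hls : MDifferentiableAt (𝓡 n) 𝓘(ℝ, Ambient n →L[ℝ] ℝ) (conormalField f ξ) p :=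
    (hf.contMDiff_conormalField p).mdifferentiableAt (by simp)
  have hzero : ∀ q, conormalField f ξ q (g q) = 0 := fun q =>
    hf.conormalField_differential q (Y q)
  have hgp : g p = differential f p w := by simp only [hg, hYp]; rfl
  obtain ⟨y, hy, hyp⟩ := exists_param_eq (n := n) p
  obtain ⟨c, hc⟩ := (paramDeriv_bijective hy).2 u
  have e1 := fderiv_comp_param (g := g) (x := p) (y := y) (by rw [hyp]; exact hgs) hy c
  have e2 := fderiv_comp_param (g := conormalField f ξ) (x := p) (y := y)
    (by rw [hyp]; exact hls) hy c
  have hdl : DifferentiableAt ℝ (conormalField f ξ ∘ param p) y :=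
    (hf.contDiffAt_conormalField_comp_param hy).differentiableAt (by simp)
  have hdg : DifferentiableAt ℝ (g ∘ param p) y := by
    have h1 : MDifferentiableAt (𝓡 n) (𝓡 n) (param (n := n) p) y :=
      ((contMDiffOn_param p).contMDiffAt
        ((isOpen_paramDomain p).mem_nhds hy)).mdifferentiableAt (by simp)
    exact (MDifferentiableAt.comp y (by rw [hyp]; exact hgs) h1).differentiableAt
  have h3 := (hdl.hasFDerivAt.clm_apply hdg.hasFDerivAt).unique
    ((hasFDerivAt_const (0 : ℝ) y).congr_of_eventuallyEq
      (Eventually.of_forall fun z => hzero (param p z)))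
  have h4 := congrArg (fun T : EuclideanSpace ℝ (Fin n) →L[ℝ] ℝ => T c) h3
  have h5 : conormalField f ξ (param p y) (fderiv ℝ (g ∘ param p) y c) +
      fderiv ℝ (conormalField f ξ ∘ param p) y c (g (param p y)) = 0 := h4
  rw [e1, e2, hyp] at h5
  have hc' : paramDeriv p y c = u := hc
  rw [hc', hgp] at h5
  have h6 : affineFundamentalForm A f p u w =
      mvfderiv (𝓡 n) g p u - differential f p (A.conn Y p u) := rfl
  have h7 : conormalField f ξ p (differential f p (A.conn Y p u)) = 0 :=
    hf.conormalField_differential p _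
  rw [h6, map_sub]
  linear_combination h5 - h7

end Immersion

/-! ### Curvature density and the area inequality -/

section Curvature

variable {n : ℕ} {M : Type*} [TopologicalSpace M] [ChartedSpace (EuclideanSpace ℝ (Fin n)) M]

/-- The differential of the conormal field, on the model space of the tangent space. -/
def conormalDifferential (f ξ : M → Ambient n) (p : M) :
    EuclideanSpace ℝ (Fin n) →L[ℝ] Ambient n →L[ℝ] ℝ :=
  mvfderiv (𝓡 n) (conormalField f ξ) p

/-- The bilinear form `(u, w) ↦ (D_u ℓ)(df w)` for the conormal field `ℓ`. -/
def conormalForm (f ξ : M → Ambient n) (p : M) :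
    EuclideanSpace ℝ (Fin n) →ₗ[ℝ] EuclideanSpace ℝ (Fin n) →ₗ[ℝ] ℝ :=
  LinearMap.mk₂ ℝ (fun u w => conormalDifferential f ξ p u (differential f p w))
    (fun u v w => by simp) (fun c u w => by simp) (fun u v w => by simp) (fun c u w => by simp)

theorem continuous_alternatingMap_apply (Ω : Ambient n [⋀^Fin (n + 1)]→ₗ[ℝ] ℝ) :
    Continuous fun q : Fin (n + 1) → Ambient n => Ω q := by
  set b := (EuclideanSpace.basisFun (Fin (n + 1)) ℝ).toBasis
  have h : (fun q : Fin (n + 1) → Ambient n => Ω q) =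
      fun q => Ω b * (Matrix.of fun i j => q j i).det := by
    ext q
    conv_lhs => rw [AlternatingMap.eq_smul_basis_det b Ω]
    rw [AlternatingMap.smul_apply, Module.Basis.det_apply, smul_eq_mul]
    rfl
  rw [h]
  refine continuous_const.mul (Continuous.matrix_det ?_)
  refine continuous_pi fun i => continuous_pi fun j => ?_
  simp only [Matrix.of_apply]
  fun_prop

theorem measurableSet_preimage_param [MeasurableSpace M] [BorelSpace M] (x : M) {B : Set M}
    (hB : MeasurableSet B) : MeasurableSet (param x ⁻¹' B ∩ paramDomain (n := n) x) := by
  classical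
  have hOm : MeasurableSet (paramDomain (n := n) x) := (isOpen_paramDomain x).measurableSet
  have hgm : Measurable ((paramDomain (n := n) x).piecewise (param x) fun _ => x) :=
    (chartAt (EuclideanSpace ℝ (Fin n)) x).symm.continuousOn.measurable_piecewise
      continuousOn_const hOm
  convert! (hgm hB).inter hOm using 1
  ext y
  refine and_congr_left fun hy => ?_
  rw [mem_preimage, mem_preimage, piecewise_eq_of_mem _ _ _ hy]

variable [IsManifold (𝓡 n) ∞ M]

/-- The determinant of the conormal form in a unimodular frame. -/
def curvature (A : EquiaffineStructure n M) (f ξ : M → Ambient n) (p : M) : ℝ :=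
  (Matrix.of fun i j : Fin n =>
    conormalForm f ξ p (unimodularFrame A p i) (unimodularFrame A p j)).det

variable {Ω : Ambient n [⋀^Fin (n + 1)]→ₗ[ℝ] ℝ} {A : EquiaffineStructure n M} {f ξ : M → Ambient n}

theorem IsEquiaffineImmersion.vol_eq (hf : IsEquiaffineImmersion Ω A f ξ) (p : M)
    (e : Fin n → EuclideanSpace ℝ (Fin n)) :
    A.vol p e = Ω (Fin.snoc (fun i => differential f p (e i)) (ξ p)) := hf.induces_vol p e

/-- For t = 1 both forms kill the tangent hyperplane and equal 1 at ξ, the latter because θ(e) =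
Ω(df e, ξ) = 1. -/
theorem IsEquiaffineImmersion.height_gaussMap (hn : 0 < n) (hf : IsEquiaffineImmersion Ω A f ξ)
    (p : M) (t : ℝ) (w : Ambient n) :
    height Ω (gaussMap A f (p, t)) w = t * conormalField f ξ p w := by
  set e : Fin n → EuclideanSpace ℝ (Fin n) := unimodularFrame A p with he
  let l : Ambient n →L[ℝ] ℝ := LinearMap.toContinuousLinearMap
    (height Ω (exteriorPower.ιMulti ℝ n fun i => differential f p (e i)))
  have hl : ∀ w, l w = Ω (Fin.snoc (fun i => differential f p (e i)) w) :=
    fun w => height_ιMulti _ _ _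
  have h0 : ∀ c, l (differential f p c) = 0 := by
    intro c
    rw [hl]
    -- These are n + 1 vectors in the image of an n-dimensional space.
    refine Ω.map_linearDependent _ fun hli => ?_
    have h1 : (Fin.snoc (α := fun _ => Ambient n) (fun i => differential f p (e i))
        (differential f p c)) = (differential f p : EuclideanSpace ℝ (Fin n) →ₗ[ℝ] Ambient n) ∘
          (Fin.snoc (α := fun _ => EuclideanSpace ℝ (Fin n)) e c) := by
      ext1 k
      refine Fin.lastCases ?_ (fun k => ?_) k <;> simp
    rw [h1] at hli
    have h2 := (LinearIndependent.of_comp _ hli).fintype_card_le_finrank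
    simp at h2
  have h1 : l (ξ p) = 1 := by
    rw [hl, ← hf.vol_eq]; exact vol_unimodularFrame hn A p
  have h2 := hf.eq_smul_conormalField h0
  rw [h1, one_smul] at h2
  have h3 : height Ω (gaussMap A f (p, t)) w = t * l w := by
    rw [gaussMap, map_smul]; rfl
  rw [h3, h2]

theorem IsEquiaffineImmersion.lipschitzKilling_eq (hn : 0 < n)
    (hf : IsEquiaffineImmersion Ω A f ξ) (p : M) (t : ℝ) :
    lipschitzKilling Ω A f (p, t) = t ^ n * curvature A f ξ p := by
  have h : (Matrix.of fun i j : Fin n => height Ω (gaussMap A f (p, t))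
      (affineFundamentalForm A f p (unimodularFrame A p i) (unimodularFrame A p j))) =
      (-t) • (Matrix.of fun i j : Fin n =>
        conormalForm f ξ p (unimodularFrame A p i) (unimodularFrame A p j)) := by
    ext i j
    rw [Matrix.of_apply, hf.height_gaussMap hn, Matrix.smul_apply, Matrix.of_apply]
    have h1 := conormalField_affineFundamentalForm hf p (unimodularFrame A p i)
      (unimodularFrame A p j)
    rw [h1, smul_eq_mul, neg_mul, mul_neg]
    rfl
  have h2 : lipschitzKilling Ω A f (p, t) = (-1) ^ n * (Matrix.of fun i j : Fin n =>
      height Ω (gaussMap A f (p, t))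
      (affineFundamentalForm A f p (unimodularFrame A p i) (unimodularFrame A p j))).det := rfl
  rw [h2, h, Matrix.det_smul, Fintype.card_fin, ← mul_assoc, ← mul_pow, curvature]
  simp

/-- The volume density `θ` in the preferred chart at `x`. -/
def paramDensity (A : EquiaffineStructure n M) (x : M) (y : EuclideanSpace ℝ (Fin n)) : ℝ :=
  A.vol (param x y) fun i => paramDeriv x y (EuclideanSpace.single i (1 : ℝ))

theorem IsEquiaffineImmersion.paramDensity_eq (hf : IsEquiaffineImmersion Ω A f ξ) {x : M}
    {y : EuclideanSpace ℝ (Fin n)} (hy : y ∈ paramDomain x) :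
    paramDensity A x y = Ω (Fin.snoc (fun i => fderiv ℝ (f ∘ param x) y
      (EuclideanSpace.single i (1 : ℝ))) ((ξ ∘ param x) y)) := by
  have h := hf.vol_eq (param x y) fun i => paramDeriv x y (EuclideanSpace.single i (1 : ℝ))
  simp only [hf.fderiv_comp_param hy]
  exact h

theorem IsEquiaffineImmersion.conormalForm_paramDeriv (hf : IsEquiaffineImmersion Ω A f ξ) {x : M}
    {y : EuclideanSpace ℝ (Fin n)} (hy : y ∈ paramDomain x) (a c : EuclideanSpace ℝ (Fin n)) :
    conormalForm f ξ (param x y) (paramDeriv x y a) (paramDeriv x y c) =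
      fderiv ℝ (conormalField f ξ ∘ param x) y a (fderiv ℝ (f ∘ param x) y c) := by
  rw [hf.fderiv_comp_param hy, EquiaffineHypersurface.fderiv_comp_param
    ((hf.contMDiff_conormalField _).mdifferentiableAt (by simp)) hy]
  rfl

/-- The determinant of the conormal form in the coordinate frame. -/
def paramDet (f ξ : M → Ambient n) (x : M) (y : EuclideanSpace ℝ (Fin n)) : ℝ :=
  (Matrix.of fun i j : Fin n =>
    fderiv ℝ (conormalField f ξ ∘ param x) y (EuclideanSpace.single i (1 : ℝ))
      (fderiv ℝ (f ∘ param x) y (EuclideanSpace.single j (1 : ℝ)))).det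

/-- Under a change of frame the determinant of a bilinear form scales by the square of the
transition determinant, which here is the inverse of the coordinate density of θ. -/
theorem IsEquiaffineImmersion.curvature_mul_sq (hn : 0 < n) (hf : IsEquiaffineImmersion Ω A f ξ)
    {x : M} {y : EuclideanSpace ℝ (Fin n)} (hy : y ∈ paramDomain x) :
    paramDensity A x y ≠ 0 ∧
      curvature A f ξ (param x y) * paramDensity A x y ^ 2 = paramDet f ξ x y := by
  set p := param x y
  let c : Module.Basis (Fin n) ℝ (EuclideanSpace ℝ (Fin n)) :=
    (EuclideanSpace.basisFun (Fin n) ℝ).toBasis.map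
      (LinearEquiv.ofBijective (paramDeriv x y : _ →ₗ[ℝ] _) (paramDeriv_bijective hy))
  have hc : ∀ i, c i = paramDeriv x y (EuclideanSpace.single i (1 : ℝ)) := fun i => by
    simp [c]
  set e : Fin n → EuclideanSpace ℝ (Fin n) := unimodularFrame A p with he
  let v : (EuclideanSpace ℝ (Fin n)) [⋀^Fin n]→ₗ[ℝ] ℝ := A.vol p
  have hvc : v c = paramDensity A x y := congrArg v (funext hc)
  have h1 : v c * c.det e = 1 := by
    have h2 : v e = 1 := vol_unimodularFrame hn A p
    rw [AlternatingMap.eq_smul_basis_det c v] at h2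
    exact h2
  rw [hvc] at h1
  have hne : paramDensity A x y ≠ 0 := fun h => by rw [h, zero_mul] at h1; exact zero_ne_one h1
  refine ⟨hne, ?_⟩
  have h3 := det_bilin_eq c (conormalForm f ξ p) e
  have h4 : (Matrix.of fun i j => conormalForm f ξ p (c i) (c j)).det = paramDet f ξ x y := by
    rw [paramDet]
    congr 1
    ext i j
    rw [Matrix.of_apply, Matrix.of_apply, hc, hc]
    exact hf.conormalForm_paramDeriv hy _ _
  rw [h4] at h3
  have h5 : curvature A f ξ p = c.det e ^ 2 * paramDet f ξ x y := h3
  rw [h5]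
  linear_combination (paramDet f ξ x y) * (paramDensity A x y * c.det e + 1) * h1

theorem IsEquiaffineImmersion.exists_degenerate_direction (hn : 0 < n)
    (hf : IsEquiaffineImmersion Ω A f ξ) {x : M} {y : EuclideanSpace ℝ (Fin n)}
    (hy : y ∈ paramDomain x) (h0 : curvature A f ξ (param x y) = 0) : ∃ w ≠ 0, ∀ c,
      fderiv ℝ (conormalField f ξ ∘ param x) y w (fderiv ℝ (f ∘ param x) y c) = 0 := by
  have h1 := (hf.curvature_mul_sq hn hy).2
  rw [h0, zero_mul, paramDet] at h1
  obtain ⟨v, hv, hv0⟩ := Matrix.exists_vecMul_eq_zero_iff.2 h1.symm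
  refine ⟨WithLp.toLp 2 v, fun h => hv (by simpa using h), ?_⟩
  set b := (EuclideanSpace.basisFun (Fin n) ℝ).toBasis with hb
  have hbi : ∀ i, b i = EuclideanSpace.single i (1 : ℝ) := fun i => by simp [hb]
  set β := (fderiv ℝ (conormalField f ξ ∘ param x) y (WithLp.toLp 2 v)).comp
    (fderiv ℝ (f ∘ param x) y)
  have hβ : (β : EuclideanSpace ℝ (Fin n) →ₗ[ℝ] ℝ) = 0 := by
    refine b.ext fun j => ?_
    have h2 := congrFun hv0 j
    rw [Matrix.vecMul, dotProduct] at h2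
    have h3 : (WithLp.toLp 2 v : EuclideanSpace ℝ (Fin n)) =
        ∑ i, v i • EuclideanSpace.single i (1 : ℝ) := by
      have := b.sum_repr (WithLp.toLp 2 v)
      simp only [hbi] at this
      rw [← this]
      rfl
    simp only [ContinuousLinearMap.coe_coe, β, ContinuousLinearMap.comp_apply, hbi, h3, map_sum,
      map_smul]
    simpa using h2
  exact fun c => congrArg (fun T : EuclideanSpace ℝ (Fin n) →ₗ[ℝ] ℝ => T c) hβ

theorem IsEquiaffineImmersion.continuousOn_paramDet (hf : IsEquiaffineImmersion Ω A f ξ) (x : M) :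
    ContinuousOn (paramDet f ξ x) (paramDomain x) := by
  intro y hy
  refine ContinuousAt.continuousWithinAt ?_
  have h1 := ((hf.contDiffAt_conormalField_comp_param hy).fderiv_right
    (m := 0) (by simp)).continuousAt
  have h2 := ((contDiffAt_comp_param hf.smooth hy).fderiv_right (m := 0) (by simp)).continuousAt
  have hdet : Continuous fun m : Matrix (Fin n) (Fin n) ℝ => m.det := continuous_id.matrix_det
  refine ContinuousAt.comp (g := fun m : Matrix (Fin n) (Fin n) ℝ => m.det) hdet.continuousAt ?_
  refine continuousAt_pi.2 fun i => continuousAt_pi.2 fun j => ?_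
  exact (h1.clm_apply continuousAt_const).clm_apply (h2.clm_apply continuousAt_const)

theorem IsEquiaffineImmersion.continuousOn_paramDensity (hf : IsEquiaffineImmersion Ω A f ξ)
    (x : M) : ContinuousOn (paramDensity A x) (paramDomain x) := by
  refine ContinuousOn.congr ?_ fun y hy => hf.paramDensity_eq hy
  refine (continuous_alternatingMap_apply Ω).comp_continuousOn ?_
  intro y hy
  refine ContinuousAt.continuousWithinAt ?_
  have h1 := ((contDiffAt_comp_param hf.smooth hy).fderiv_right (m := 0) (by simp)).continuousAt
  have h2 := (contDiffAt_comp_param hf.transversal_smooth hy).continuousAt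
  refine continuousAt_pi.2 fun i => ?_
  refine Fin.lastCases ?_ (fun i => ?_) i
  · simp only [Fin.snoc_last]; exact h2
  · simpa using h1.clm_apply continuousAt_const

/-- The unimodular frames are chosen pointwise with no continuity, so continuity is read off from
the quotient of coordinate expressions. -/
theorem IsEquiaffineImmersion.continuous_abs_curvature (hn : 0 < n)
    (hf : IsEquiaffineImmersion Ω A f ξ) : Continuous fun p => |curvature A f ξ p| := by
  rw [continuous_iff_continuousAt]
  intro p
  set e := chartAt (EuclideanSpace ℝ (Fin n)) p
  have hO := (isOpen_paramDomain (n := n) p).mem_nhds (mem_chart_target _ p)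
  have h1 : ContinuousAt (fun y => |paramDet f ξ p y / paramDensity A p y ^ 2|) (e p) :=
    ((hf.continuousOn_paramDet p).continuousAt hO |>.div
      (((hf.continuousOn_paramDensity p).continuousAt hO).pow 2)
      (pow_ne_zero 2 (hf.curvature_mul_sq hn (mem_chart_target _ p)).1)).abs
  have h2 : ContinuousAt e p := e.continuousAt (mem_chart_source _ p)
  refine (h1.comp h2).congr ?_
  filter_upwards [e.open_source.mem_nhds (mem_chart_source _ p)] with q hq
  obtain ⟨h3, h4⟩ := hf.curvature_mul_sq hn (e.map_source hq)
  have h5 : param p (e q) = q := e.left_inv hq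
  rw [h5] at h4
  rw [Function.comp_apply, ← h4, mul_div_cancel_right₀ _ (pow_ne_zero 2 h3)]

/-! ### The total absolute curvature as an integral over `M` -/

/-- The radial function `‖ℓ‖` of the conormal field. -/
def conormalNorm (b : Module.Basis (Fin (n + 1)) ℝ (Ambient n)) (f ξ : M → Ambient n) (p : M) : ℝ :=
  ‖evalBasis b (conormalField f ξ p)‖

theorem IsEquiaffineImmersion.conormalNorm_pos (hf : IsEquiaffineImmersion Ω A f ξ)
    (b : Module.Basis (Fin (n + 1)) ℝ (Ambient n)) (p : M) : 0 < conormalNorm b f ξ p := by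
  rw [conormalNorm, norm_pos_iff]
  intro h
  have h1 := evalBasis_injective b (h.trans (map_zero _).symm)
  have h2 := hf.conormalField_transversal p
  rw [h1] at h2
  simp at h2

theorem IsEquiaffineImmersion.continuous_conormalField (hf : IsEquiaffineImmersion Ω A f ξ) :
    Continuous (conormalField f ξ) := hf.contMDiff_conormalField.continuous

theorem IsEquiaffineImmersion.continuous_conormalNorm (hf : IsEquiaffineImmersion Ω A f ξ)
    (b : Module.Basis (Fin (n + 1)) ℝ (Ambient n)) : Continuous (conormalNorm b f ξ) :=
  ((evalBasis b).continuous.comp hf.continuous_conormalField).norm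

/-- The density of the area swept by the normalized conormal. -/
def curvatureDensity (b : Module.Basis (Fin (n + 1)) ℝ (Ambient n)) (A : EquiaffineStructure n M)
    (f ξ : M → Ambient n) (p : M) : ℝ :=
  |curvature A f ξ p| * (conormalNorm b f ξ p)⁻¹ ^ (n + 1)

theorem IsEquiaffineImmersion.continuous_curvatureDensity (hn : 0 < n)
    (hf : IsEquiaffineImmersion Ω A f ξ) (b : Module.Basis (Fin (n + 1)) ℝ (Ambient n)) :
    Continuous (curvatureDensity b A f ξ) :=
  (hf.continuous_abs_curvature hn).mul
    (((hf.continuous_conormalNorm b).inv₀ fun p => (hf.conormalNorm_pos b p).ne').pow _)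

/-- The fibre is {1/‖ℓ‖, -1/‖ℓ‖}, and the two points contribute equally: |t|ⁿ comes from G and one
more |t| from the volume element. -/
theorem IsEquiaffineImmersion.tsum_fiber (hn : 0 < n) (hf : IsEquiaffineImmersion Ω A f ξ)
    {b : Module.Basis (Fin (n + 1)) ℝ (Ambient n)} {S : Set (⋀[ℝ]^n (Ambient n))}
    (hb : ∀ φ, φ ∈ S ↔ ∑ j, height Ω φ (b j) ^ 2 = 1) (p : M) :
    ∑' t : {t : ℝ // (p, t) ∈ ellipsoidBundle A f S},
      ENNReal.ofReal (|lipschitzKilling Ω A f (p, t.1)| * |t.1|) =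
    2 * ENNReal.ofReal (curvatureDensity b A f ξ p) := by
  set K := conormalNorm b f ξ p with hK
  have hKp : 0 < K := hf.conormalNorm_pos b p
  have hmem : ∀ t : ℝ, (p, t) ∈ ellipsoidBundle A f S ↔ t = K⁻¹ ∨ t = -K⁻¹ := by
    intro t
    have h1 : (p, t) ∈ ellipsoidBundle A f S ↔ ∑ j, height Ω (gaussMap A f (p, t)) (b j) ^ 2 = 1 :=
      hb _
    have h2 : ∑ j, height Ω (gaussMap A f (p, t)) (b j) ^ 2 = (t * K) ^ 2 := by
      rw [mul_pow, hK, conormalNorm, EuclideanSpace.norm_sq_eq, Finset.mul_sum]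
      refine Finset.sum_congr rfl fun j _ => ?_
      rw [hf.height_gaussMap hn, evalBasis_apply, Real.norm_eq_abs, sq_abs, mul_pow]
    have h3 : t * K = 1 ↔ t = K⁻¹ := ⟨fun h => eq_inv_of_mul_eq_one_left h, fun h => by
      rw [h, inv_mul_cancel₀ hKp.ne']⟩
    have h4 : t * K = -1 ↔ t = -K⁻¹ := by
      rw [← neg_eq_iff_eq_neg, ← neg_mul, ← neg_eq_iff_eq_neg]
      exact ⟨fun h => eq_inv_of_mul_eq_one_left h, fun h => by
        rw [h, inv_mul_cancel₀ hKp.ne']⟩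
    rw [h1, h2, sq_eq_one_iff, h3, h4]
  set g : ℝ → ENNReal := fun t => ENNReal.ofReal (|lipschitzKilling Ω A f (p, t)| * |t|) with hg
  have hgt : ∀ t, |t| = K⁻¹ → g t = ENNReal.ofReal (curvatureDensity b A f ξ p) := by
    intro t ht
    rw [hg]
    simp only
    rw [hf.lipschitzKilling_eq hn, abs_mul, abs_pow, ht, curvatureDensity, ← hK]
    congr 1
    ring
  have hKi : 0 < K⁻¹ := inv_pos.2 hKp
  have hne : K⁻¹ ≠ -K⁻¹ := by linarith
  have hT : {t : ℝ | (p, t) ∈ ellipsoidBundle A f S} = (({K⁻¹, -K⁻¹} : Finset ℝ) : Set ℝ) := by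
    ext t
    rw [Finset.coe_pair]
    exact hmem t
  change ∑' t : {t : ℝ | (p, t) ∈ ellipsoidBundle A f S}, g t = _
  rw [hT, Finset.tsum_subtype', Finset.sum_pair hne, hgt _ (abs_of_pos hKi),
    hgt _ (by rw [abs_neg, abs_of_pos hKi]), two_mul]

/-- The part of the open unit ball swept by the conormal rays over `B`. -/
def conormalCone (b : Module.Basis (Fin (n + 1)) ℝ (Ambient n)) (f ξ : M → Ambient n) (B : Set M) :
    Set (Ambient n) :=
  {w | ∃ p ∈ B, ∃ s : ℝ, 0 < s ∧ w = evalBasis b (s • conormalField f ξ p) ∧ ‖w‖ < 1}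

theorem IsEquiaffineImmersion.setLIntegral_chartVolume [MeasurableSpace M] [BorelSpace M]
    (hf : IsEquiaffineImmersion Ω A f ξ) (x : M) {B : Set M} (hB : MeasurableSet B)
    {h : M → ENNReal} (hh : Measurable h) :
    ∫⁻ p in B, h p ∂(chartVolume A x) = ∫⁻ y in param x ⁻¹' B ∩ paramDomain x,
      ENNReal.ofReal |paramDensity A x y| * h (param x y) := by
  classical
  set O := paramDomain (n := n) x with hO
  have hOm : MeasurableSet O := (isOpen_paramDomain x).measurableSet
  -- The inverse chart is arbitrary off its domain; the constant value makes it measurable without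
  -- changing the pushforward.
  set g := O.piecewise (param x) (fun _ => x) with hg
  have hgm : Measurable g :=
    (chartAt (EuclideanSpace ℝ (Fin n)) x).symm.continuousOn.measurable_piecewise
      continuousOn_const hOm
  have hgO : ∀ y ∈ O, g y = param x y := fun y hy => piecewise_eq_of_mem _ _ _ hy
  set B' := g ⁻¹' B ∩ O with hB'
  have hB'm : MeasurableSet B' := (hgm hB).inter hOm
  set δ : EuclideanSpace ℝ (Fin n) → ENNReal := fun y => ENNReal.ofReal |paramDensity A x y| with hδ
  set ν := (volume.restrict O).withDensity δ with hν
  have hmap : chartVolume A x = Measure.map g ν := by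
    have h1 : chartVolume A x = Measure.map (param x) ν := rfl
    rw [h1]
    refine Measure.map_congr ?_
    refine (withDensity_absolutelyContinuous _ _).ae_le ?_
    filter_upwards [ae_restrict_mem hOm] with y hy using (hgO y hy).symm
  have hδm : AEMeasurable δ (volume.restrict B') := by
    have h1 : ContinuousOn (fun y => |paramDensity A x y|) O := (hf.continuousOn_paramDensity x).abs
    exact ((h1.aemeasurable hOm).mono_measure
      (Measure.restrict_mono inter_subset_right le_rfl)).ennreal_ofReal
  rw [hmap, setLIntegral_map hB hh hgm, hν, restrict_withDensity (hgm hB),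
    Measure.restrict_restrict (hgm hB), ← hB']
  refine (lintegral_withDensity_eq_lintegral_mul₀ hδm (hh.comp hgm).aemeasurable).trans ?_
  have hBB : param x ⁻¹' B ∩ O = B' := by
    ext y
    refine and_congr_left fun hy => ?_
    rw [mem_preimage, mem_preimage, hgO y hy]
  rw [hBB]
  refine setLIntegral_congr_fun hB'm fun y hy => ?_
  simp only [Pi.mul_apply, Function.comp_apply, hgO y hy.2, hδ]

theorem IsEquiaffineImmersion.volume_conormalCone_le_chartVolume [MeasurableSpace M] [BorelSpace M]
    (hn : 0 < n) (hf : IsEquiaffineImmersion Ω A f ξ)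
    {b : Module.Basis (Fin (n + 1)) ℝ (Ambient n)} (hb : |Ω b| = 1) (x : M) {B : Set M}
    (hB : MeasurableSet B) (hBx : B ⊆ (chartAt (EuclideanSpace ℝ (Fin n)) x).source) :
    volume (conormalCone b f ξ B) ≤
      ∫⁻ p in B, ENNReal.ofReal (curvatureDensity b A f ξ p / (n + 1)) ∂(chartVolume A x) := by
  set O := paramDomain (n := n) x with hO
  set B' := param x ⁻¹' B ∩ O with hB'
  have hB'm : MeasurableSet B' := measurableSet_preimage_param x hB
  have hGm : Measurable fun p => ENNReal.ofReal (curvatureDensity b A f ξ p / (n + 1)) :=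
    ((hf.continuous_curvatureDensity hn b).measurable.div_const _).ennreal_ofReal
  have hrhs := hf.setLIntegral_chartVolume x hB hGm
  set d : EuclideanSpace ℝ (Fin n) → ℝ := fun y => |paramDet f ξ x y| / |paramDensity A x y|
  have hdc : ContinuousOn d O := (hf.continuousOn_paramDet x).abs.div
    (hf.continuousOn_paramDensity x).abs
    fun y hy => abs_ne_zero.2 (hf.curvature_mul_sq hn hy).1
  have hmain := volume_cone_le Ω b hb (O := O) hB'm inter_subset_right
    (l := conormalField f ξ ∘ param x)
    (q := fun y i => fderiv ℝ (f ∘ param x) y (EuclideanSpace.single i (1 : ℝ)))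
    (ξ := ξ ∘ param x)
    (fun y hy => (hf.contDiffAt_conormalField_comp_param hy).differentiableAt (by simp))
    (fun y hy i => by
      rw [hf.fderiv_comp_param hy]; exact hf.conormalField_differential _ _)
    (fun y hy => hf.conormalField_transversal _)
    (fun y hy => by
      rw [← hf.paramDensity_eq hy]; exact (hf.curvature_mul_sq hn hy).1)
    hdc (fun y hy => by rw [← hf.paramDensity_eq hy]; rfl)
  have hsub : conormalCone b f ξ B ⊆ {w : Ambient n | ∃ y ∈ B', ∃ s : ℝ, 0 < s ∧
      w = evalBasis b (s • (conormalField f ξ ∘ param x) y) ∧ ‖w‖ < 1} := by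
    rintro w ⟨p, hp, s, hs, hw, hw1⟩
    set e := chartAt (EuclideanSpace ℝ (Fin n)) x
    have he : e p ∈ O := e.map_source (hBx hp)
    have hep : param x (e p) = p := e.left_inv (hBx hp)
    refine ⟨e p, ⟨?_, he⟩, s, hs, ?_, hw1⟩
    · rw [mem_preimage, hep]; exact hp
    · rw [Function.comp_apply, hep]; exact hw
  refine (measure_mono hsub).trans (hmain.trans (le_of_eq ?_))
  rw [hrhs]
  refine setLIntegral_congr_fun hB'm fun y hy => ?_
  obtain ⟨h1, h2⟩ := hf.curvature_mul_sq hn hy.2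
  have h3 : d y = |curvature A f ξ (param x y)| * |paramDensity A x y| := by
    simp only [d]
    rw [← h2, abs_mul, abs_pow, div_eq_iff (abs_ne_zero.2 h1)]
    ring
  rw [← ENNReal.ofReal_mul (abs_nonneg _), h3, curvatureDensity, conormalNorm]
  congr 1
  simp only [Function.comp_apply]
  ring

theorem chartVolume_le_volumeMeasure [MeasurableSpace M] (A : EquiaffineStructure n M) (x : M) :
    chartVolume A x ≤ volumeMeasure A := le_iSup (fun x => chartVolume A x) x

/-- Cut B into countably many disjoint measurable pieces, each inside one chart domain, and add the
local estimates; each chart measure is at most |θ|. -/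
theorem IsEquiaffineImmersion.volume_conormalCone_le [CompactSpace M] [MeasurableSpace M]
    [BorelSpace M] (hn : 0 < n) (hf : IsEquiaffineImmersion Ω A f ξ)
    {b : Module.Basis (Fin (n + 1)) ℝ (Ambient n)} (hb : |Ω b| = 1) {B : Set M}
    (hB : MeasurableSet B) :
    volume (conormalCone b f ξ B) ≤
      ∫⁻ p in B, ENNReal.ofReal (curvatureDensity b A f ξ p / (n + 1)) ∂(volumeMeasure A) := by
  rcases isEmpty_or_nonempty M with hM | hM
  · have : conormalCone b f ξ B = ∅ := by
      ext w
      constructor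
      · rintro ⟨p, -⟩; exact hM.elim p
      · exact fun h => h.elim
    simp [this]
  set U : M → Set M := fun x => (chartAt (EuclideanSpace ℝ (Fin n)) x).source
  obtain ⟨s, hs, hsU⟩ := countable_cover_nhds_of_sigmaCompact (f := U)
    fun x => (chartAt (EuclideanSpace ℝ (Fin n)) x).open_source.mem_nhds (mem_chart_source _ x)
  have hsne : s.Nonempty := by
    by_contra h
    rw [not_nonempty_iff_eq_empty] at h
    rw [h, biUnion_empty] at hsU
    exact empty_ne_univ hsU
  obtain ⟨x, rfl⟩ := hs.exists_eq_range hsne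
  have hcov : ⋃ k, U (x k) = univ := by simpa using hsU
  set D := disjointed fun k => U (x k) with hD
  have hDm : ∀ k, MeasurableSet (D k) := fun k => MeasurableSet.disjointed
    (fun k => (chartAt (EuclideanSpace ℝ (Fin n)) (x k)).open_source.measurableSet) k
  have hDU : ⋃ k, D k = univ := by rw [hD, iUnion_disjointed, hcov]
  have hBD : B = ⋃ k, B ∩ D k := by rw [← inter_iUnion, hDU, inter_univ]
  have hcone : conormalCone b f ξ B ⊆ ⋃ k, conormalCone b f ξ (B ∩ D k) := by
    rintro w ⟨p, hp, h⟩
    rw [hBD] at hp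
    obtain ⟨k, hk⟩ := mem_iUnion.1 hp
    exact mem_iUnion.2 ⟨k, p, hk, h⟩
  calc volume (conormalCone b f ξ B) ≤ ∑' k, volume (conormalCone b f ξ (B ∩ D k)) :=
        (measure_mono hcone).trans (measure_iUnion_le _)
    _ ≤ ∑' k, ∫⁻ p in B ∩ D k,
          ENNReal.ofReal (curvatureDensity b A f ξ p / (n + 1)) ∂(volumeMeasure A) := by
        refine ENNReal.tsum_le_tsum fun k => ?_
        refine (hf.volume_conormalCone_le_chartVolume hn hb (x k) (hB.inter (hDm k)) ?_).trans ?_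
        · exact inter_subset_right.trans (disjointed_subset _ k)
        · exact lintegral_mono'
            (Measure.restrict_mono le_rfl (chartVolume_le_volumeMeasure A (x k))) le_rfl
    _ = ∫⁻ p in ⋃ k, B ∩ D k,
          ENNReal.ofReal (curvatureDensity b A f ξ p / (n + 1)) ∂(volumeMeasure A) := by
        refine (lintegral_iUnion (fun k => hB.inter (hDm k)) ?_ _).symm
        exact fun i j hij =>
          ((disjoint_disjointed _) hij).mono inter_subset_right inter_subset_right
    _ = _ := by rw [← hBD]

end Curvature

/-! ### Consequences of minimal total absolute curvature -/

section Minimal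

variable {n : ℕ} {M : Type*} [TopologicalSpace M] [ChartedSpace (EuclideanSpace ℝ (Fin n)) M]
  [IsManifold (𝓡 n) ∞ M] {Ω : Ambient n [⋀^Fin (n + 1)]→ₗ[ℝ] ℝ} {A : EquiaffineStructure n M}
  {f ξ : M → Ambient n}

theorem IsEquiaffineImmersion.apply_differential_eq_zero (hf : IsEquiaffineImmersion Ω A f ξ)
    {Φ : Ambient n → ℝ} {Φ' : Ambient n →L[ℝ] ℝ} {p : M} (hΦ : HasFDerivAt Φ Φ' (f p))
    (hmax : ∀ q, Φ (f q) ≤ Φ (f p)) (c : EuclideanSpace ℝ (Fin n)) :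
    Φ' (differential f p c) = 0 := by
  obtain ⟨y, hy, hyp⟩ := exists_param_eq (n := n) p
  obtain ⟨c, rfl⟩ := (paramDeriv_bijective hy).2 c
  have h1 : HasFDerivAt (f ∘ param p) (fderiv ℝ (f ∘ param p) y) y :=
    ((contDiffAt_comp_param hf.smooth hy).differentiableAt (by simp)).hasFDerivAt
  have h2 : HasFDerivAt Φ Φ' ((f ∘ param p) y) := by rw [Function.comp_apply, hyp]; exact hΦ
  have h3 := h2.comp y h1
  have h4 : IsLocalMax (Φ ∘ f ∘ param p) y :=
    Eventually.of_forall fun z => by simpa only [Function.comp_apply, hyp] using hmax (param p z)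
  have h5 := h4.hasFDerivAt_eq_zero h3
  have h6 := congrArg (fun T : EuclideanSpace ℝ (Fin n) →L[ℝ] ℝ => T c) h5
  have h7 := hf.fderiv_comp_param hy c
  rw [hyp] at h7
  rw [← h7]
  exact h6

/-- If l∘f were constant, all tangent hyperplanes would be ker l. At the point p farthest from f(p₀)
the vector f(p) - f(p₀) would be tangent, and criticality of the squared distance would make it
zero. Then f would be constant, impossible for an immersion with n > 0. -/
theorem IsEquiaffineImmersion.not_apply_const [CompactSpace M] (hn : 0 < n)
    (hf : IsEquiaffineImmersion Ω A f ξ) (p₀ : M) {l : Ambient n →L[ℝ] ℝ} (hl : l ≠ 0) :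
    ¬ ∀ p, l (f p) = l (f p₀) := by
  intro hconst
  have hfc : Continuous f := hf.smooth.continuous
  obtain ⟨p, -, hp⟩ := isCompact_univ.exists_isMaxOn (⟨p₀, mem_univ _⟩ : (univ : Set M).Nonempty)
    (f := fun q => ‖f q - f p₀‖ ^ 2) (by fun_prop)
  have h1 : ∀ c, l (differential f p c) = 0 :=
    hf.apply_differential_eq_zero l.hasFDerivAt fun q => by rw [hconst q, hconst p]
  have h2 := hf.eq_smul_conormalField h1
  have h3 : l (ξ p) ≠ 0 := fun h => hl (by rw [h2, h, zero_smul])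
  have h4 : conormalField f ξ p (f p - f p₀) = 0 := by
    have : l (f p - f p₀) = 0 := by rw [map_sub, hconst p, sub_self]
    rw [h2] at this
    exact (mul_eq_zero.1 this).resolve_left h3
  obtain ⟨c, hc⟩ := (hf.conormalField_eq_zero_iff p _).1 h4
  have hd : HasFDerivAt (fun v : Ambient n => ‖v - f p₀‖ ^ 2)
      (2 • (innerSL ℝ (f p - f p₀))) (f p) := by
    have := ((hasFDerivAt_id (𝕜 := ℝ) (f p)).sub_const (f p₀)).norm_sq
    simpa using this
  have h5 := hf.apply_differential_eq_zero hd (fun q => hp (mem_univ q)) c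
  rw [hc] at h5
  have h6 : f p = f p₀ := by
    have h5' : (2 : ℕ) • (inner ℝ (f p - f p₀) (f p - f p₀) : ℝ) = 0 := h5
    rw [← sub_eq_zero, ← inner_self_eq_zero (𝕜 := ℝ)]
    exact (smul_eq_zero.1 h5').resolve_left two_ne_zero
  have h7 : ∀ q, f q = f p₀ := by
    intro q
    have := hp (mem_univ q)
    rw [← sub_eq_zero, ← norm_eq_zero]
    have h8 : ‖f q - f p₀‖ ^ 2 ≤ 0 := by simpa [h6] using this
    nlinarith [norm_nonneg (f q - f p₀)]
  have h8 : ∀ l' : Ambient n →L[ℝ] ℝ, ∀ c, l' (differential f p c) = 0 := fun l' =>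
    hf.apply_differential_eq_zero l'.hasFDerivAt fun q => by rw [h7 q, h7 p]
  have h9 : differential f p (EuclideanSpace.single ⟨0, hn⟩ (1 : ℝ)) = 0 :=
    ext_inner_left ℝ fun w => by
      rw [inner_zero_right]; exact h8 (innerSL ℝ w) _
  have h10 := (injective_iff_map_eq_zero _).1 (hf.differential_injective p) _ h9
  simp at h10

theorem IsEquiaffineImmersion.volumeMeasure_pos [MeasurableSpace M] [BorelSpace M] (hn : 0 < n)
    (hf : IsEquiaffineImmersion Ω A f ξ) {W : Set M} (hW : IsOpen W) (hne : W.Nonempty) :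
    0 < volumeMeasure A W := by
  obtain ⟨p, hp⟩ := hne
  refine lt_of_lt_of_le ?_ (chartVolume_le_volumeMeasure A p W)
  set W' := param p ⁻¹' W ∩ paramDomain (n := n) p with hW'
  have hW'o : IsOpen W' := by
    rw [hW', inter_comm]
    exact (chartAt (EuclideanSpace ℝ (Fin n)) p).symm.continuousOn.isOpen_inter_preimage
      (isOpen_paramDomain p) hW
  have hW'ne : W'.Nonempty := by
    obtain ⟨y, hy, hyp⟩ := exists_param_eq (n := n) p
    exact ⟨y, by rw [mem_preimage, hyp]; exact hp, hy⟩
  have h1 := hf.setLIntegral_chartVolume p hW.measurableSet (h := fun _ => 1) measurable_const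
  rw [setLIntegral_one] at h1
  rw [h1, pos_iff_ne_zero]
  intro h0
  have hm : AEMeasurable (fun y => ENNReal.ofReal |paramDensity A p y| * 1)
      (volume.restrict W') := by
    have h2 : ContinuousOn (fun y => |paramDensity A p y|) W' :=
      ((hf.continuousOn_paramDensity p).mono inter_subset_right).abs
    exact ((h2.aemeasurable hW'o.measurableSet).ennreal_ofReal).mul_const _
  have h3 := (lintegral_eq_zero_iff' hm).1 h0
  have h4 : ∀ᵐ y ∂(volume.restrict W'), False := by
    filter_upwards [h3, ae_restrict_mem hW'o.measurableSet] with y hy hyW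
    have h5 := (hf.curvature_mul_sq hn hyW.2).1
    simp at hy
    exact h5 hy
  rw [eventually_false_iff_eq_bot, ae_eq_bot, Measure.restrict_eq_zero] at h4
  exact (hW'o.measure_pos volume hW'ne).ne' h4

theorem evalBasis_surjective (b : Module.Basis (Fin (n + 1)) ℝ (Ambient n)) :
    Function.Surjective (evalBasis b) := by
  intro w
  refine ⟨LinearMap.toContinuousLinearMap (b.constr ℝ fun j => w j), ?_⟩
  ext j
  rw [evalBasis_apply, LinearMap.coe_toContinuousLinearMap', Module.Basis.constr_basis]

/-- The points off V where f maximises or minimises its own conormal already give every nonzero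
form, up to a positive or a negative factor. These two sets are disjoint, so the integrals over them
add up to at most the integral off V. -/
theorem IsEquiaffineImmersion.volume_ball_le [CompactSpace M] [MeasurableSpace M] [BorelSpace M]
    (hn : 0 < n) (hf : IsEquiaffineImmersion Ω A f ξ)
    {b : Module.Basis (Fin (n + 1)) ℝ (Ambient n)} (hb : |Ω b| = 1) {V : Set M} (hV : IsOpen V)
    (hmax : ∀ l : Ambient n →L[ℝ] ℝ, l ≠ 0 → ∃ p ∉ V, ∀ q, l (f q) ≤ l (f p)) :
    volume (Metric.ball (0 : Ambient n) 1) ≤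
      ∫⁻ p in Vᶜ, ENNReal.ofReal (curvatureDensity b A f ξ p / (n + 1)) ∂(volumeMeasure A) := by
  have hfc : Continuous f := hf.smooth.continuous
  have hlc := hf.continuous_conormalField
  set P₁ : Set M := {p | ∀ q, conormalField f ξ p (f q) ≤ conormalField f ξ p (f p)} with hP₁
  set P₂ : Set M := {p | ∀ q, conormalField f ξ p (f p) ≤ conormalField f ξ p (f q)} with hP₂
  have hP₁c : IsClosed P₁ := by
    have : P₁ = ⋂ q, {p | conormalField f ξ p (f q) ≤ conormalField f ξ p (f p)} := by
      ext p; rw [mem_iInter]; exact Iff.rfl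
    rw [this]
    exact isClosed_iInter fun q => isClosed_le (hlc.clm_apply continuous_const) (hlc.clm_apply hfc)
  have hP₂c : IsClosed P₂ := by
    have : P₂ = ⋂ q, {p | conormalField f ξ p (f p) ≤ conormalField f ξ p (f q)} := by
      ext p; rw [mem_iInter]; exact Iff.rfl
    rw [this]
    exact isClosed_iInter fun q => isClosed_le (hlc.clm_apply hfc) (hlc.clm_apply continuous_const)
  have hdisj : Disjoint P₁ P₂ := by
    rw [disjoint_left]
    intro p h1 h2
    refine hf.not_apply_const hn p (l := conormalField f ξ p) (fun h => ?_)
      fun q => le_antisymm (h1 q) (h2 q)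
    have := hf.conormalField_transversal p
    rw [h] at this
    simp at this
  set B₁ := P₁ ∩ Vᶜ
  set B₂ := P₂ ∩ Vᶜ
  have hB₁ : MeasurableSet B₁ := (hP₁c.inter hV.isClosed_compl).measurableSet
  have hB₂ : MeasurableSet B₂ := (hP₂c.inter hV.isClosed_compl).measurableSet
  -- At a maximum point l = l(ξ)·ℓ; the sign of l(ξ) decides whether ℓ itself is maximal or minimal
  -- there.
  have hcover : Metric.ball (0 : Ambient n) 1 \ {0} ⊆
      conormalCone b f ξ B₁ ∪ -conormalCone b f ξ B₂ := by
    rintro w ⟨hw, hw0⟩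
    have hw1 : ‖w‖ < 1 := by simpa using hw
    obtain ⟨l, rfl⟩ := evalBasis_surjective b w
    have hl : l ≠ 0 := fun h => hw0 (by rw [h, map_zero]; rfl)
    obtain ⟨p, hpV, hp⟩ := hmax l hl
    have h1 : ∀ c, l (differential f p c) = 0 :=
      hf.apply_differential_eq_zero l.hasFDerivAt hp
    have h2 := hf.eq_smul_conormalField h1
    have h2' : ∀ v, l v = l (ξ p) * conormalField f ξ p v := fun v =>
      congrArg (fun T : Ambient n →L[ℝ] ℝ => T v) h2
    have h3 : l (ξ p) ≠ 0 := fun h => hl (by rw [h2, h, zero_smul])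
    rcases lt_or_gt_of_ne h3 with hs | hs
    · right
      refine ⟨p, ⟨fun q => ?_, hpV⟩, -l (ξ p), neg_pos.2 hs, ?_, by rwa [norm_neg]⟩
      · have := hp q
        rw [h2', h2' (f p)] at this
        exact (mul_le_mul_left_of_neg hs).1 this
      · have h4 : (-l (ξ p)) • conormalField f ξ p = -l := by
          ext v
          change -l (ξ p) * conormalField f ξ p v = -(l v)
          rw [h2' v, neg_mul]
        rw [h4, map_neg]
    · left
      refine ⟨p, ⟨fun q => ?_, hpV⟩, l (ξ p), hs, by rw [← h2], hw1⟩
      have := hp q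
      rw [h2', h2' (f p)] at this
      exact le_of_mul_le_mul_left this hs
  calc volume (Metric.ball (0 : Ambient n) 1)
      = volume (Metric.ball (0 : Ambient n) 1 \ {0}) := by
        rw [measure_sdiff_null (measure_singleton _)]
    _ ≤ volume (conormalCone b f ξ B₁) + volume (-conormalCone b f ξ B₂) :=
        (measure_mono hcover).trans (measure_union_le _ _)
    _ = volume (conormalCone b f ξ B₁) + volume (conormalCone b f ξ B₂) := by
        rw [Measure.measure_neg]
    _ ≤ (∫⁻ p in B₁, ENNReal.ofReal (curvatureDensity b A f ξ p / (n + 1)) ∂(volumeMeasure A)) +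
        ∫⁻ p in B₂, ENNReal.ofReal (curvatureDensity b A f ξ p / (n + 1)) ∂(volumeMeasure A) :=
        add_le_add (hf.volume_conormalCone_le hn hb hB₁) (hf.volume_conormalCone_le hn hb hB₂)
    _ = ∫⁻ p in B₁ ∪ B₂,
          ENNReal.ofReal (curvatureDensity b A f ξ p / (n + 1)) ∂(volumeMeasure A) :=
        (lintegral_union hB₂ (hdisj.mono inter_subset_left inter_subset_left)).symm
    _ ≤ _ := lintegral_mono_set (union_subset inter_subset_right inter_subset_right)

/-- The sphere has n + 1 times the volume of the ball, and the factor 2 of the two-point fibres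
cancels the value 2 of τ. -/
theorem IsEquiaffineImmersion.lintegral_curvatureDensity [MeasurableSpace M] [BorelSpace M]
    (hn : 0 < n) (hf : IsEquiaffineImmersion Ω A f ξ)
    {b : Module.Basis (Fin (n + 1)) ℝ (Ambient n)} {S : Set (⋀[ℝ]^n (Ambient n))}
    (hb : ∀ φ, φ ∈ S ↔ ∑ j, height Ω φ (b j) ^ 2 = 1)
    (hτ : totalAbsoluteCurvature Ω A f S = 2) :
    ∫⁻ p, ENNReal.ofReal (curvatureDensity b A f ξ p / (n + 1)) ∂(volumeMeasure A) =
      volume (Metric.ball (0 : Ambient n) 1) := by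
  rw [totalAbsoluteCurvature] at hτ
  simp_rw [hf.tsum_fiber hn hb] at hτ
  have hm : Measurable fun p => ENNReal.ofReal (curvatureDensity b A f ξ p / (n + 1)) :=
    ((hf.continuous_curvatureDensity hn b).measurable.div_const _).ennreal_ofReal
  have hc : ∀ p, 2 * ENNReal.ofReal (curvatureDensity b A f ξ p) =
      (2 * ((n + 1 : ℕ) : ENNReal)) * ENNReal.ofReal (curvatureDensity b A f ξ p / (n + 1)) := by
    intro p
    rw [mul_assoc, ← ENNReal.ofReal_natCast, ← ENNReal.ofReal_mul (Nat.cast_nonneg _)]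
    congr 2
    push_cast
    field_simp
  simp_rw [hc] at hτ
  rw [lintegral_const_mul _ hm, Measure.toSphere_apply_univ] at hτ
  set I := ∫⁻ p, ENNReal.ofReal (curvatureDensity b A f ξ p / (n + 1)) ∂(volumeMeasure A)
  set v := volume (Metric.ball (0 : Ambient n) 1)
  have hv0 : v ≠ 0 := (Metric.measure_ball_pos volume _ one_pos).ne'
  have hvt : v ≠ ⊤ := measure_ball_lt_top.ne
  have hdim : (Module.finrank ℝ (Ambient n) : ENNReal) = ((n + 1 : ℕ) : ENNReal) := by simp
  rw [hdim] at hτ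
  have hN0 : ((n + 1 : ℕ) : ENNReal) ≠ 0 := by simp
  have hNt : ((n + 1 : ℕ) : ENNReal) ≠ ⊤ := ENNReal.natCast_ne_top _
  have h1 := ENNReal.div_mul_cancel (b := 2 * ((n + 1 : ℕ) : ENNReal) * I)
    (mul_ne_zero hN0 hv0) (ENNReal.mul_ne_top hNt hvt)
  rw [hτ] at h1
  have h2 : (2 * ((n + 1 : ℕ) : ENNReal)) * I = (2 * ((n + 1 : ℕ) : ENNReal)) * v := by
    rw [← h1]; ring
  exact (ENNReal.mul_right_inj (mul_ne_zero two_ne_zero hN0)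
    (ENNReal.mul_ne_top ENNReal.ofNat_ne_top hNt)).1 h2

/-- The part off V already accounts for the full volume of the ball, so the density integrates to 0
over V. Being continuous and nonnegative, it vanishes there, as open sets have positive measure. -/
theorem IsEquiaffineImmersion.curvature_eq_zero_of_max_off [CompactSpace M] [MeasurableSpace M]
    [BorelSpace M] (hn : 0 < n) (hΩ : Ω ≠ 0) (hf : IsEquiaffineImmersion Ω A f ξ)
    {S : Set (⋀[ℝ]^n (Ambient n))} (hS : IsUnitEllipsoid Ω S)
    (hτ : totalAbsoluteCurvature Ω A f S = 2) {V : Set M} (hV : IsOpen V)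
    (hmax : ∀ l : Ambient n →L[ℝ] ℝ, l ≠ 0 → ∃ p ∉ V, ∀ q, l (f q) ≤ l (f p)) :
    ∀ p ∈ V, curvature A f ξ p = 0 := by
  obtain ⟨b, hb, hbS⟩ := hS.exists_basis hΩ
  have h1 := hf.lintegral_curvatureDensity hn hbS hτ
  have h2 := hf.volume_ball_le hn hb hV hmax
  have hGc := hf.continuous_curvatureDensity hn b
  have hm : Measurable fun p => ENNReal.ofReal (curvatureDensity b A f ξ p / (n + 1)) :=
    (hGc.measurable.div_const _).ennreal_ofReal
  rw [← lintegral_add_compl _ hV.measurableSet] at h1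
  rw [← h1] at h2
  have hfin : ∫⁻ p in Vᶜ, ENNReal.ofReal (curvatureDensity b A f ξ p / (n + 1))
      ∂(volumeMeasure A) ≠ ⊤ := by
    refine ne_top_of_le_ne_top ?_ (le_add_self.trans h1.le)
    exact measure_ball_lt_top.ne
  have h3 : ∫⁻ p in V, ENNReal.ofReal (curvatureDensity b A f ξ p / (n + 1))
      ∂(volumeMeasure A) = 0 := by
    rw [← nonpos_iff_eq_zero]
    refine ENNReal.le_of_add_le_add_right hfin ?_
    rwa [zero_add]
  intro p hp
  by_contra hcurv
  set W : Set M := V ∩ {p | 0 < curvatureDensity b A f ξ p} with hW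
  have hWo : IsOpen W := hV.inter (isOpen_lt continuous_const hGc)
  have hpW : p ∈ W := ⟨hp, mul_pos (abs_pos.2 hcurv)
    (pow_pos (inv_pos.2 (hf.conormalNorm_pos b p)) _)⟩
  have h4 := hf.volumeMeasure_pos hn hWo ⟨p, hpW⟩
  have h5 := (setLIntegral_pos_iff hm (μ := volumeMeasure A) (s := V)).2
    (lt_of_lt_of_le h4 (measure_mono fun q hq => ⟨?_, hq.1⟩))
  · exact h5.ne' h3
  · rw [Function.mem_support]
    have : (0 : ℝ) < curvatureDensity b A f ξ q / (n + 1) := div_pos hq.2 (by positivity)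
    exact (ENNReal.ofReal_pos.2 this).ne'

end Minimal

/-! ### All tangent hyperplanes support the hypersurface -/

section Supporting

variable {n : ℕ} {M : Type*} [TopologicalSpace M] [ChartedSpace (EuclideanSpace ℝ (Fin n)) M]
  {f ξ : M → Ambient n}

/-- The points whose tangent hyperplane has points of the hypersurface strictly on both sides. -/
def nonSupportingSet (f ξ : M → Ambient n) : Set M :=
  {p | (∃ q, conormalField f ξ p (f p) < conormalField f ξ p (f q)) ∧
    ∃ q, conormalField f ξ p (f q) < conormalField f ξ p (f p)}

theorem mem_nonSupportingSet_iff {p : M} {l : Ambient n →L[ℝ] ℝ} {c : ℝ} (hc : c ≠ 0)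
    (hl : l = c • conormalField f ξ p) : p ∈ nonSupportingSet f ξ ↔
      (∃ q, l (f p) < l (f q)) ∧ ∃ q, l (f q) < l (f p) := by
  have h : ∀ v, l v = c * conormalField f ξ p v := fun v =>
    congrArg (fun T : Ambient n →L[ℝ] ℝ => T v) hl
  simp only [h]
  rcases lt_or_gt_of_ne hc with h0 | h0
  · simp only [mul_lt_mul_left_of_neg h0]
    exact and_comm
  · simp only [mul_lt_mul_iff_right₀ h0]
    exact Iff.rfl

variable [IsManifold (𝓡 n) ∞ M] {Ω : Ambient n [⋀^Fin (n + 1)]→ₗ[ℝ] ℝ} {A : EquiaffineStructure n M}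

theorem IsEquiaffineImmersion.isOpen_nonSupportingSet (hf : IsEquiaffineImmersion Ω A f ξ) :
    IsOpen (nonSupportingSet f ξ) := by
  have hfc : Continuous f := hf.smooth.continuous
  have hlc := hf.continuous_conormalField
  have h : nonSupportingSet f ξ =
      (⋃ q, {p | conormalField f ξ p (f p) < conormalField f ξ p (f q)}) ∩
        ⋃ q, {p | conormalField f ξ p (f q) < conormalField f ξ p (f p)} := by
    ext p
    rw [mem_inter_iff, mem_iUnion, mem_iUnion]
    exact Iff.rfl
  rw [h]
  exact (isOpen_iUnion fun q =>
    isOpen_lt (hlc.clm_apply hfc) (hlc.clm_apply continuous_const)).inter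
    (isOpen_iUnion fun q => isOpen_lt (hlc.clm_apply continuous_const) (hlc.clm_apply hfc))

theorem IsEquiaffineImmersion.exists_max [CompactSpace M] (hf : IsEquiaffineImmersion Ω A f ξ)
    (p₀ : M) (l : Ambient n →L[ℝ] ℝ) : ∃ p, ∀ q, l (f q) ≤ l (f p) := by
  have hfc : Continuous f := hf.smooth.continuous
  obtain ⟨p, -, hp⟩ := isCompact_univ.exists_isMaxOn (⟨p₀, mem_univ _⟩ : (univ : Set M).Nonempty)
    (f := fun q => l (f q)) (by fun_prop)
  exact ⟨p, fun q => hp (mem_univ q)⟩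

theorem IsEquiaffineImmersion.conormalField_ne_zero (hf : IsEquiaffineImmersion Ω A f ξ) (p : M) :
    conormalField f ξ p ≠ 0 := fun h => by
  have := hf.conormalField_transversal p
  rw [h] at this
  simp at this

/-- All points with the same tangent hyperplane as p form a compact set Z of non-supporting points.
A flat segment centred at any point of Z keeps its ends in Z, so none of them can have maximal norm.
-/
theorem IsEquiaffineImmersion.nonSupportingSet_eq_empty_of_curvature [CompactSpace M] (hn : 0 < n)
    (hf : IsEquiaffineImmersion Ω A f ξ)
    (hcurv : ∀ p ∈ nonSupportingSet f ξ, curvature A f ξ p = 0) : nonSupportingSet f ξ = ∅ := by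
  by_contra hne
  obtain ⟨p, hp⟩ := nonempty_iff_ne_empty.2 hne
  have hfc : Continuous f := hf.smooth.continuous
  have hξc : Continuous ξ := hf.transversal_smooth.continuous
  have hlc := hf.continuous_conormalField
  set h := conormalField f ξ p with hh
  set Z : Set M := {q | h = h (ξ q) • conormalField f ξ q ∧ h (f q) = h (f p)} with hZ
  have hZc : IsClosed Z :=
    (isClosed_eq continuous_const ((h.continuous.comp hξc).smul hlc)).inter
      (isClosed_eq (h.continuous.comp hfc) continuous_const)
  have hpZ : p ∈ Z := ⟨by rw [hh, hf.conormalField_transversal, one_smul], rfl⟩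
  obtain ⟨q, hqZ, hqmax⟩ := hZc.isCompact.exists_isMaxOn ⟨p, hpZ⟩ (f := fun q => ‖f q‖)
    (hfc.norm.continuousOn)
  have hμ : ∀ r ∈ Z, h (ξ r) ≠ 0 := fun r hr h0 => hf.conormalField_ne_zero p (by
    have := hr.1
    rwa [h0, zero_smul] at this)
  have hqU : q ∈ nonSupportingSet f ξ := by
    rw [mem_nonSupportingSet_iff (hμ q hqZ) hqZ.1, hqZ.2]
    exact hp
  obtain ⟨y, hy, hyq⟩ := exists_param_eq (n := n) q
  have hD : ∀ᶠ z in 𝓝 y, z ∈ paramDomain (n := n) q :=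
    eventually_mem_set.2 ((isOpen_paramDomain q).mem_nhds hy)
  have hDU : ∀ᶠ z in 𝓝 y, param q z ∈ nonSupportingSet f ξ := by
    have hc : ContinuousAt (param (n := n) q) y :=
      ((chartAt (EuclideanSpace ℝ (Fin n)) q).symm.continuousOn.continuousAt
        ((isOpen_paramDomain q).mem_nhds hy))
    refine hc.eventually ?_
    rw [hyq]
    exact eventually_mem_set.2 (hf.isOpen_nonSupportingSet.mem_nhds hqU)
  obtain ⟨d, hd, y₁, hy₁, y₂, hy₂, e₁, e₂, hld, ht₁, ht₂⟩ := exists_flat_segment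
    (F := f ∘ param q) (l := conormalField f ξ ∘ param q) (y₀ := y) (ξ := ξ q)
    (hD.mono fun z hz => contDiffAt_comp_param hf.smooth hz)
    (hD.mono fun z hz => hf.contDiffAt_conormalField_comp_param hz)
    (hD.mono fun z hz w => by
      rw [Function.comp_apply, hf.conormalField_eq_zero_iff]
      have := hf.range_fderiv_comp_param hz
      exact (Set.ext_iff.1 this w).symm)
    (hf.fderiv_comp_param_injective hy)
    (by rw [Function.comp_apply, hyq]; exact hf.conormalField_transversal q)
    ((hD.and hDU).mono fun z hz => hf.exists_degenerate_direction hn hz.1 (hcurv _ hz.2))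
    ((isOpen_paramDomain q).mem_nhds hy)
  simp only [Function.comp_apply, hyq] at e₁ e₂ hld ht₁ ht₂
  have hprop : ∀ v, h v = h (ξ q) * conormalField f ξ q v := fun v =>
    congrArg (fun T : Ambient n →L[ℝ] ℝ => T v) hqZ.1
  have hhd : h d = 0 := by rw [hprop, hld, mul_zero]
  have hmemZ : ∀ z ∈ paramDomain (n := n) q,
      (∀ c, conormalField f ξ q (fderiv ℝ (f ∘ param q) z c) = 0) →
      h (f (param q z)) = h (f p) → param q z ∈ Z := by
    intro z hz ht hval
    refine ⟨hf.eq_smul_conormalField fun c => ?_, hval⟩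
    obtain ⟨c, rfl⟩ := (paramDeriv_bijective hz).2 c
    rw [← hf.fderiv_comp_param hz, hprop, ht, mul_zero]
  have m₁ := hqmax (hmemZ y₁ hy₁ ht₁ (by rw [e₁, map_add, hhd, add_zero, hqZ.2]))
  have m₂ := hqmax (hmemZ y₂ hy₂ ht₂ (by rw [e₂, map_sub, hhd, sub_zero, hqZ.2]))
  have m₁' : ‖f q + d‖ ≤ ‖f q‖ := by rw [← e₁]; exact m₁
  have m₂' : ‖f q - d‖ ≤ ‖f q‖ := by rw [← e₂]; exact m₂
  -- One of f(q) + d and f(q) - d has norm larger than f(q).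
  have hpar := parallelogram_law_with_norm ℝ (f q) d
  have hdpos : 0 < ‖d‖ := norm_pos_iff.2 hd
  nlinarith [norm_nonneg (f q + d), norm_nonneg (f q - d), norm_nonneg (f q)]

/-- Maximum points of linear forms are never non-supporting, so the curvature vanishes on the
non-supporting set, which is therefore empty. The conormal or its negative then serves as l. -/
theorem IsEquiaffineImmersion.supporting [CompactSpace M] [MeasurableSpace M]
    [BorelSpace M] (hn : 0 < n) (hΩ : Ω ≠ 0) (hf : IsEquiaffineImmersion Ω A f ξ)
    {S : Set (⋀[ℝ]^n (Ambient n))} (hS : IsUnitEllipsoid Ω S)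
    (hτ : totalAbsoluteCurvature Ω A f S = 2) (p : M) :
    ∃ l : Ambient n →L[ℝ] ℝ, l ≠ 0 ∧ (∀ c, l (differential f p c) = 0) ∧
      ∀ q, l (f q) ≤ l (f p) := by
  have hempty : nonSupportingSet f ξ = ∅ := by
    refine hf.nonSupportingSet_eq_empty_of_curvature hn ?_
    refine hf.curvature_eq_zero_of_max_off hn hΩ hS hτ hf.isOpen_nonSupportingSet fun l hl => ?_
    obtain ⟨q, hq⟩ := hf.exists_max p l
    refine ⟨q, fun hmem => ?_, hq⟩
    have h2 := hf.eq_smul_conormalField (hf.apply_differential_eq_zero l.hasFDerivAt hq)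
    have h3 : l (ξ q) ≠ 0 := fun h => hl (by rw [h2, h, zero_smul])
    obtain ⟨⟨r, hr⟩, -⟩ := (mem_nonSupportingSet_iff h3 h2).1 hmem
    exact absurd (hq r) (not_le.2 hr)
  have hp : p ∉ nonSupportingSet f ξ := by rw [hempty]; exact notMem_empty p
  by_cases h : ∃ q, conormalField f ξ p (f p) < conormalField f ξ p (f q)
  · refine ⟨-conormalField f ξ p, neg_ne_zero.2 (hf.conormalField_ne_zero p), fun c => ?_,
      fun q => ?_⟩
    · change -(conormalField f ξ p (differential f p c)) = 0
      rw [hf.conormalField_differential, neg_zero]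
    · by_contra hq
      refine hp ⟨h, q, ?_⟩
      exact neg_lt_neg_iff.1 (not_le.1 hq)
  · push Not at h
    exact ⟨_, hf.conormalField_ne_zero p, hf.conormalField_differential p, h⟩

end Supporting

/-! ### Boundedness from one side by linear forms -/

section Hull

variable {E : Type*} [NormedAddCommGroup E] [NormedSpace ℝ E]

theorem apply_lt_of_mem_interior {K : Set E} {l : E →L[ℝ] ℝ} (hl : l ≠ 0) {a o : E}
    (hK : ∀ x ∈ K, l x ≤ l a) (ho : o ∈ interior K) : l o < l a := by
  refine lt_of_le_of_ne (hK o (interior_subset ho)) fun h => hl ?_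
  have hmax : IsLocalMax l o := by
    filter_upwards [mem_interior_iff_mem_nhds.1 ho] with x hx
    rw [h]
    exact hK x hx
  exact hmax.hasFDerivAt_eq_zero l.hasFDerivAt

theorem apply_le_of_mem_closure_convexHull {s : Set E} {l : E →L[ℝ] ℝ} {c : ℝ}
    (h : ∀ x ∈ s, l x ≤ c) : ∀ x ∈ closure (convexHull ℝ s), l x ≤ c := by
  have h1 : convexHull ℝ s ⊆ {x | l x ≤ c} :=
    convexHull_min h (convex_halfSpace_le l.toLinearMap.isLinear c)
  exact fun x hx => closure_minimal h1 (isClosed_le l.continuous continuous_const) hx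

/-- A ray from an interior point meets the boundary at most once: points strictly before a boundary
point are interior. -/
theorem eq_one_of_mem_frontier {K : Set E} (hK : Convex ℝ K) {o x y : E}
    (ho : o ∈ interior K) (hx : x ∈ frontier K) (hy : y ∈ frontier K) {t : ℝ} (ht : 0 < t)
    (h : x = o + t • (y - o)) : t = 1 := by
  have key : ∀ {x y : E} {t : ℝ}, x ∈ frontier K → y ∈ frontier K → 0 < t →
      x = o + t • (y - o) → 1 ≤ t := by
    intro x y t hx hy ht h
    by_contra! hlt
    refine hx.2 ?_
    have := hK.combo_interior_closure_mem_interior ho hy.1 (sub_pos.2 hlt) ht.le (by ring)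
    have hxe : x = (1 - t) • o + t • y := by rw [h]; module
    rwa [hxe]
  refine le_antisymm ?_ (key hx hy ht h)
  have h2 : y = o + t⁻¹ • (x - o) := by
    rw [h, add_sub_cancel_left, inv_smul_smul₀ ht.ne']; abel
  exact (one_le_inv₀ ht).1 (key hy hx (inv_pos.2 ht) h2)

theorem isCompact_closure_convexHull [FiniteDimensional ℝ E] {s : Set E} (hs : IsCompact s) :
    IsCompact (closure (convexHull ℝ s)) :=
  haveI := FiniteDimensional.proper_real E
  (isBounded_convexHull.2 hs.isBounded).isCompact_closure

theorem interior_convexHull_nonempty [FiniteDimensional ℝ E] {s : Set E} {a : E} (ha : a ∈ s)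
    (h : ∀ l : E →L[ℝ] ℝ, l ≠ 0 → ¬ ∀ x ∈ s, l x = l a) :
    (interior (convexHull ℝ s)).Nonempty := by
  rw [interior_convexHull_nonempty_iff_affineSpan_eq_top]
  by_contra hne
  have hlt : vectorSpan ℝ s < ⊤ := by
    refine lt_top_iff_ne_top.2 fun htop => hne ?_
    exact (AffineSubspace.affineSpan_eq_top_iff_vectorSpan_eq_top_of_nonempty ℝ E E ⟨a, ha⟩).2 htop
  obtain ⟨l, hl, hle⟩ := Submodule.exists_le_ker_of_lt_top _ hlt
  refine h (LinearMap.toContinuousLinearMap l) (by simpa using hl) fun x hx => ?_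
  have h1 : l (x - a) = 0 := hle (vsub_mem_vectorSpan ℝ hx ha)
  rw [map_sub, sub_eq_zero] at h1
  exact h1

/-- The union of the open rays from `o` through the image of `D` under `f`. -/
def rayCone {M : Type*} (f : M → E) (o : E) (D : Set M) : Set E :=
  {x | ∃ q ∈ D, ∃ t : ℝ, 0 < t ∧ x = o + t • (f q - o)}

/-- Away from o a point of the cone is determined by its direction, and the directions form the
compact image of D. -/
theorem mem_rayCone_of_mem_closure {M : Type*} [TopologicalSpace M] {f : M → E}
    (hf : Continuous f) {o : E} (ho : ∀ p, f p ≠ o) {D : Set M} (hD : IsCompact D) {x : E}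
    (hx : x ∈ closure (rayCone f o D)) (hxo : x ≠ o) : x ∈ rayCone f o D := by
  set u : E → E := fun z => ‖z - o‖⁻¹ • (z - o) with hu
  have hux : ∀ z, z ≠ o → ContinuousAt u z := fun z hz =>
    ((continuous_norm.comp (continuous_id.sub continuous_const)).continuousAt.inv₀
      (norm_ne_zero_iff.2 (sub_ne_zero.2 hz))).smul (by fun_prop)
  have hU : IsCompact ((u ∘ f) '' D) := hD.image <| continuous_iff_continuousAt.2 fun p =>
    ContinuousAt.comp (hux _ (ho p)) hf.continuousAt
  have h1 : u x ∈ closure (u '' rayCone f o D) := mem_closure_image (hux x hxo) hx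
  have h2 : u '' rayCone f o D ⊆ (u ∘ f) '' D := by
    rintro _ ⟨_, ⟨q, hq, t, ht, rfl⟩, rfl⟩
    refine ⟨q, hq, ?_⟩
    simp only [hu, Function.comp_apply, add_sub_cancel_left, norm_smul, Real.norm_eq_abs,
      abs_of_pos ht, smul_smul]
    congr 1
    field_simp
  obtain ⟨q, hq, hqx⟩ := closure_minimal h2 hU.isClosed h1
  have h3 : 0 < ‖x - o‖ := norm_pos_iff.2 (sub_ne_zero.2 hxo)
  have h4 : 0 < ‖f q - o‖ := norm_pos_iff.2 (sub_ne_zero.2 (ho q))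
  refine ⟨q, hq, ‖x - o‖ * ‖f q - o‖⁻¹, mul_pos h3 (inv_pos.2 h4), ?_⟩
  have h5 : ‖f q - o‖⁻¹ • (f q - o) = ‖x - o‖⁻¹ • (x - o) := hqx
  rw [mul_smul, h5, smul_inv_smul₀ h3.ne', add_sub_cancel]

end Hull

/-! ### Radial projection of an immersed hypersurface -/

section Radial

variable {X E : Type*} [NormedAddCommGroup X] [NormedSpace ℝ X] [FiniteDimensional ℝ X]
  [NormedAddCommGroup E] [NormedSpace ℝ E] [FiniteDimensional ℝ E]

theorem exists_hasStrictFDerivAt_radial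
    (hdim : Module.finrank ℝ E = Module.finrank ℝ X + 1) {F : X → E} {T : X →L[ℝ] E} {y : X}
    (hF : HasStrictFDerivAt F T y) (hT : Function.Injective T) {o : E} (ho : F y - o ∉ range T)
    {s : ℝ} (hs : s ≠ 0) : ∃ Q : (X × ℝ) ≃L[ℝ] E,
      HasStrictFDerivAt (fun z : X × ℝ => o + z.2 • (F z.1 - o)) (Q : (X × ℝ) →L[ℝ] E) (y, s) := by
  obtain ⟨Q, hQ⟩ := exists_equiv_frameMap hdim (T := s • T) (ξ := F y - o)
    (fun a b h => hT (smul_right_injective E hs h))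
    (fun ⟨c, hc⟩ => ho ⟨s • c, by rw [map_smul]; exact hc⟩)
  refine ⟨Q, ?_⟩
  have h1 : HasStrictFDerivAt (fun z : X × ℝ => F z.1) (T.comp (ContinuousLinearMap.fst ℝ X ℝ))
      (y, s) := hF.comp (y, s) hasStrictFDerivAt_fst
  have h2 := (hasStrictFDerivAt_snd (𝕜 := ℝ) (p := (y, s))).smul (h1.sub_const o)
  refine (h2.const_add o).congr_fderiv ?_
  rw [hQ]
  ext z <;> simp [frameMap_apply]

end Radial

/-! ### Radial projection, double points and the convex hull. -/

section Convex

variable {n : ℕ} {M : Type*} [TopologicalSpace M] [ChartedSpace (EuclideanSpace ℝ (Fin n)) M]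

theorem continuousAt_param {x : M} {y : EuclideanSpace ℝ (Fin n)} (hy : y ∈ paramDomain x) :
    ContinuousAt (param x) y :=
  (chartAt (EuclideanSpace ℝ (Fin n)) x).symm.continuousOn.continuousAt
    ((isOpen_paramDomain x).mem_nhds hy)

variable [IsManifold (𝓡 n) ∞ M] {Ω : Ambient n [⋀^Fin (n + 1)]→ₗ[ℝ] ℝ} {A : EquiaffineStructure n M}
  {f ξ : M → Ambient n}

theorem IsEquiaffineImmersion.hasStrictFDerivAt_comp_param (hf : IsEquiaffineImmersion Ω A f ξ)
    {x : M} {y : EuclideanSpace ℝ (Fin n)} (hy : y ∈ paramDomain x) :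
    HasStrictFDerivAt (f ∘ param x) (fderiv ℝ (f ∘ param x) y) y :=
  (contDiffAt_comp_param hf.smooth hy).hasStrictFDerivAt (by simp)

/-- When o is off the tangent hyperplane, (y,t) ↦ o + t(f(y) - o) has invertible derivative, so it
maps neighbourhoods onto neighbourhoods. -/
theorem IsEquiaffineImmersion.rayCone_mem_nhds (hf : IsEquiaffineImmersion Ω A f ξ) {p : M}
    {o : Ambient n} (ho : f p - o ∉ range (differential f p)) {N : Set M} (hN : N ∈ 𝓝 p) {s : ℝ}
    (hs : 0 < s) : rayCone f o N ∈ 𝓝 (o + s • (f p - o)) := by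
  obtain ⟨y, hy, hyp⟩ := exists_param_eq (n := n) p
  have ho' : (f ∘ param p) y - o ∉ range (fderiv ℝ (f ∘ param p) y) := by
    rw [hf.range_fderiv_comp_param hy, Function.comp_apply, hyp]
    exact ho
  obtain ⟨Q, hQ⟩ := exists_hasStrictFDerivAt_radial finrank_ambient
    (hf.hasStrictFDerivAt_comp_param hy) (hf.fderiv_comp_param_injective hy) ho' hs.ne'
  have h1 := hQ.map_nhds_eq_of_equiv
  simp only [Function.comp_apply, hyp] at h1
  rw [← h1, mem_map]
  have h2 : ∀ᶠ z : EuclideanSpace ℝ (Fin n) × ℝ in 𝓝 (y, s), param p z.1 ∈ N ∧ 0 < z.2 := by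
    refine Eventually.and ?_ (continuousAt_snd.eventually (lt_mem_nhds hs))
    have h3 : ∀ᶠ z in 𝓝 y, param p z ∈ N := by
      refine (continuousAt_param hy).eventually ?_
      rw [hyp]
      exact eventually_mem_set.2 hN
    exact (continuousAt_fst (p := (y, s))).eventually h3
  filter_upwards [h2] with z hz
  exact ⟨_, hz.1, _, hz.2, rfl⟩

/-- Compose f with a linear left inverse of its derivative and apply the inverse function theorem.
-/
theorem IsEquiaffineImmersion.exists_injOn_nhds (hf : IsEquiaffineImmersion Ω A f ξ) (p : M) :
    ∃ N : Set M, IsOpen N ∧ p ∈ N ∧ InjOn f N := by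
  set e := chartAt (EuclideanSpace ℝ (Fin n)) p
  have hy : e p ∈ paramDomain (n := n) p := mem_chart_target _ p
  have hyp : param (n := n) p (e p) = p := e.left_inv (mem_chart_source _ p)
  have hF := hf.hasStrictFDerivAt_comp_param hy
  obtain ⟨P, hP⟩ := (fderiv ℝ (f ∘ param p) (e p)).toLinearMap.exists_leftInverse_of_injective
    (LinearMap.ker_eq_bot.2 (hf.fderiv_comp_param_injective hy))
  set P' : Ambient n →L[ℝ] EuclideanSpace ℝ (Fin n) := LinearMap.toContinuousLinearMap P
  have h1 : HasStrictFDerivAt (P' ∘ f ∘ param p)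
      (ContinuousLinearEquiv.refl ℝ (EuclideanSpace ℝ (Fin n)) :
        EuclideanSpace ℝ (Fin n) →L[ℝ] EuclideanSpace ℝ (Fin n)) (e p) := by
    refine (P'.hasStrictFDerivAt.comp (e p) hF).congr_fderiv ?_
    ext1 c
    exact LinearMap.congr_fun hP c
  set H := h1.toOpenPartialHomeomorph (P' ∘ f ∘ param p)
  refine ⟨e.source ∩ e ⁻¹' H.source, e.isOpen_inter_preimage H.open_source,
    ⟨mem_chart_source _ p, h1.mem_toOpenPartialHomeomorph_source⟩, fun a ha b hb hab => ?_⟩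
  refine e.injOn ha.1 hb.1 (H.injOn ha.2 hb.2 ?_)
  change P' (f (e.symm (e a))) = P' (f (e.symm (e b)))
  rw [e.left_inv ha.1, e.left_inv hb.1, hab]

/-- The cone over D is open and relatively closed in the complement of o, which is connected because
n + 1 > 1. -/
theorem IsEquiaffineImmersion.compl_subset_rayCone [CompactSpace M] (hn : 0 < n)
    (hf : IsEquiaffineImmersion Ω A f ξ) {o : Ambient n}
    (ho : ∀ p, f p - o ∉ range (differential f p)) {D : Set M} (hDo : IsOpen D)
    (hDc : IsClosed D) (hne : D.Nonempty) : {o}ᶜ ⊆ rayCone f o D := by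
  have hfo : ∀ p, f p ≠ o := fun p h => ho p ⟨0, by rw [map_zero, h, sub_self]⟩
  have hrank : 1 < Module.rank ℝ (Ambient n) := by
    rw [← Module.finrank_eq_rank, finrank_ambient, finrank_euclideanSpace_fin]
    exact_mod_cast Nat.lt_add_of_pos_left hn
  refine (isConnected_compl_singleton_of_one_lt_rank hrank o).isPreconnected
    |>.subset_of_closure_inter_subset ?_ ?_ ?_
  · rw [isOpen_iff_mem_nhds]
    rintro _ ⟨q, hq, t, ht, rfl⟩
    exact hf.rayCone_mem_nhds (ho q) (hDo.mem_nhds hq) ht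
  · obtain ⟨q, hq⟩ := hne
    exact ⟨f q, hfo q, q, hq, 1, one_pos, by rw [one_smul, add_sub_cancel]⟩
  · rintro x ⟨hx, hxo⟩
    exact mem_rayCone_of_mem_closure hf.smooth.continuous hfo hDc.isCompact hx hxo

theorem IsEquiaffineImmersion.interior_hull_nonempty [CompactSpace M] (hn : 0 < n)
    (hf : IsEquiaffineImmersion Ω A f ξ) (p₀ : M) :
    (interior (closure (convexHull ℝ (range f)))).Nonempty :=
  (interior_convexHull_nonempty (mem_range_self p₀) fun _ hl h =>
    hf.not_apply_const hn p₀ hl fun p => h _ (mem_range_self p)).mono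
    (interior_mono subset_closure)

/-- The double points of `f`. -/
def doublePoints (f : M → Ambient n) : Set M := {p | ∃ q, q ≠ p ∧ f q = f p}

/-- Near a simple point p, partners inside a neighbourhood N are excluded by local injectivity, and
partners outside N because the compact set f(Nᶜ) misses f(p). -/
theorem IsEquiaffineImmersion.isClosed_doublePoints [CompactSpace M]
    (hf : IsEquiaffineImmersion Ω A f ξ) :
    IsClosed (doublePoints f) := by
  have hfc : Continuous f := hf.smooth.continuous
  rw [← isOpen_compl_iff, isOpen_iff_mem_nhds]
  intro p hp
  obtain ⟨N, hNo, hpN, hN⟩ := hf.exists_injOn_nhds p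
  have h1 : IsClosed (f '' Nᶜ) := (hNo.isClosed_compl.isCompact.image hfc).isClosed
  have h2 : f p ∉ f '' Nᶜ := by
    rintro ⟨q, hq, hqp⟩
    exact hp ⟨q, fun h => hq (h ▸ hpN), hqp⟩
  filter_upwards [hNo.mem_nhds hpN,
    hfc.continuousAt.preimage_mem_nhds (h1.isOpen_compl.mem_nhds h2)] with p' hp' hp''
  rintro ⟨q, hqp, hq⟩
  by_cases hqN : q ∈ N
  · exact hqp (hN hqN hp' hq)
  · exact hp'' ⟨q, hqN, hq⟩

theorem IsEquiaffineImmersion.exists_curvature_ne_zero [MeasurableSpace M] [BorelSpace M]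
    (hn : 0 < n) (hΩ : Ω ≠ 0) {S : Set (⋀[ℝ]^n (Ambient n))}
    (hf : IsEquiaffineImmersion Ω A f ξ) (hS : IsUnitEllipsoid Ω S)
    (hτ : totalAbsoluteCurvature Ω A f S = 2) : ∃ p, curvature A f ξ p ≠ 0 := by
  by_contra! h
  obtain ⟨b, -, hbS⟩ := hS.exists_basis hΩ
  have h1 := hf.lintegral_curvatureDensity hn hbS hτ
  have h2 : ∀ p, ENNReal.ofReal (curvatureDensity b A f ξ p / (n + 1)) = 0 := fun p => by
    rw [curvatureDensity, h p]; simp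
  simp_rw [h2, lintegral_zero] at h1
  exact (Metric.measure_ball_pos volume (0 : Ambient n) one_pos).ne h1

/-! ### Convexity and injectivity when the total absolute curvature is 2. -/

section Minimal

variable [CompactSpace M] [MeasurableSpace M] [BorelSpace M]
  {S : Set (⋀[ℝ]^n (Ambient n))}

theorem IsEquiaffineImmersion.mem_frontier_hull (hn : 0 < n) (hΩ : Ω ≠ 0)
    (hf : IsEquiaffineImmersion Ω A f ξ) (hS : IsUnitEllipsoid Ω S)
    (hτ : totalAbsoluteCurvature Ω A f S = 2) (p : M) :
    f p ∈ frontier (closure (convexHull ℝ (range f))) := by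
  obtain ⟨l, hl, -, hle⟩ := hf.supporting hn hΩ hS hτ p
  refine ⟨subset_closure (subset_closure (subset_convexHull ℝ _ (mem_range_self p))), fun h => ?_⟩
  exact lt_irrefl _ (apply_lt_of_mem_interior hl
    (apply_le_of_mem_closure_convexHull (by rintro _ ⟨q, rfl⟩; exact hle q)) h)

/-- The tangent hyperplane at p supports the hull, hence misses its interior. -/
theorem IsEquiaffineImmersion.sub_notMem_range (hn : 0 < n) (hΩ : Ω ≠ 0)
    (hf : IsEquiaffineImmersion Ω A f ξ) (hS : IsUnitEllipsoid Ω S)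
    (hτ : totalAbsoluteCurvature Ω A f S = 2) {o : Ambient n}
    (ho : o ∈ interior (closure (convexHull ℝ (range f)))) (p : M) :
    f p - o ∉ range (differential f p) := by
  obtain ⟨l, hl, htan, hle⟩ := hf.supporting hn hΩ hS hτ p
  rintro ⟨c, hc⟩
  have h1 := htan c
  rw [hc, map_sub, sub_eq_zero] at h1
  have h2 := apply_lt_of_mem_interior hl
    (apply_le_of_mem_closure_convexHull (by rintro _ ⟨q, rfl⟩; exact hle q)) ho
  exact h2.ne' h1

theorem IsEquiaffineImmersion.eq_of_mem_frontier_of_mem_rayCone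
    (hn : 0 < n) (hΩ : Ω ≠ 0) (hf : IsEquiaffineImmersion Ω A f ξ) (hS : IsUnitEllipsoid Ω S)
    (hτ : totalAbsoluteCurvature Ω A f S = 2) {o : Ambient n}
    (ho : o ∈ interior (closure (convexHull ℝ (range f)))) {D : Set M} {x : Ambient n}
    (hx : x ∈ frontier (closure (convexHull ℝ (range f)))) (hxD : x ∈ rayCone f o D) :
    ∃ q ∈ D, f q = x := by
  obtain ⟨q, hq, t, ht, hxt⟩ := hxD
  have h1 := eq_one_of_mem_frontier (convex_convexHull ℝ (range f)).closure ho hx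
    (hf.mem_frontier_hull hn hΩ hS hτ q) ht hxt
  exact ⟨q, hq, by rw [hxt, h1, one_smul, add_sub_cancel]⟩

theorem IsEquiaffineImmersion.frontier_hull (hn : 0 < n) (hΩ : Ω ≠ 0)
    (hf : IsEquiaffineImmersion Ω A f ξ) (hS : IsUnitEllipsoid Ω S)
    (hτ : totalAbsoluteCurvature Ω A f S = 2) (p₀ : M) :
    frontier (closure (convexHull ℝ (range f))) = range f := by
  obtain ⟨o, ho⟩ := hf.interior_hull_nonempty hn p₀
  refine Subset.antisymm (fun x hx => ?_) ?_
  · have hxo : x ≠ o := by rintro rfl; exact hx.2 ho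
    obtain ⟨q, -, hq⟩ := hf.eq_of_mem_frontier_of_mem_rayCone hn hΩ hS hτ ho hx
      (hf.compl_subset_rayCone hn (hf.sub_notMem_range hn hΩ hS hτ ho) isOpen_univ isClosed_univ
        ⟨p₀, mem_univ _⟩ hxo)
    exact ⟨q, hq⟩
  · rintro _ ⟨p, rfl⟩
    exact hf.mem_frontier_hull hn hΩ hS hτ p

/-- Rays over a neighbourhood W of the partner q fill a neighbourhood of f(p). A nearby f(p') thus
lies on the ray of some f(r) with r in W; both are boundary points of the hull, so they coincide. -/
theorem IsEquiaffineImmersion.exists_nhds_of_mem_doublePoints [T2Space M] (hn : 0 < n)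
    (hΩ : Ω ≠ 0) (hf : IsEquiaffineImmersion Ω A f ξ) (hS : IsUnitEllipsoid Ω S)
    (hτ : totalAbsoluteCurvature Ω A f S = 2) {p : M} (hp : p ∈ doublePoints f) :
    ∃ V : Set M, IsOpen V ∧ p ∈ V ∧ ∀ p' ∈ V, ∃ q ∉ V, f q = f p' := by
  have hfc : Continuous f := hf.smooth.continuous
  obtain ⟨q, hqp, hq⟩ := hp
  obtain ⟨W, V, hW, hV, hqW, hpV, hdisj⟩ := t2_separation hqp
  obtain ⟨o, ho⟩ := hf.interior_hull_nonempty hn p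
  have h1 := hf.rayCone_mem_nhds (hf.sub_notMem_range hn hΩ hS hτ ho q) (hW.mem_nhds hqW)
    one_pos
  rw [one_smul, add_sub_cancel, hq] at h1
  have h2 : f ⁻¹' rayCone f o W ∈ 𝓝 p := hfc.continuousAt.preimage_mem_nhds h1
  refine ⟨V ∩ interior (f ⁻¹' rayCone f o W), hV.inter isOpen_interior,
    ⟨hpV, mem_interior_iff_mem_nhds.2 h2⟩, fun p' hp' => ?_⟩
  obtain ⟨r, hr, hrp⟩ := hf.eq_of_mem_frontier_of_mem_rayCone hn hΩ hS hτ ho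
    (hf.mem_frontier_hull hn hΩ hS hτ p') (mem_preimage.1 (interior_subset hp'.2))
  exact ⟨r, fun h => disjoint_left.1 hdisj hr h.1, hrp⟩

theorem IsEquiaffineImmersion.isOpen_doublePoints [T2Space M] (hn : 0 < n)
    (hΩ : Ω ≠ 0) (hf : IsEquiaffineImmersion Ω A f ξ) (hS : IsUnitEllipsoid Ω S)
    (hτ : totalAbsoluteCurvature Ω A f S = 2) : IsOpen (doublePoints f) := by
  rw [isOpen_iff_mem_nhds]
  intro p hp
  obtain ⟨V, hV, hpV, h⟩ := hf.exists_nhds_of_mem_doublePoints hn hΩ hS hτ hp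
  filter_upwards [hV.mem_nhds hpV] with p' hp'
  obtain ⟨q, hq, hqp⟩ := h p' hp'
  exact ⟨q, fun e => hq (e ▸ hp'), hqp⟩

/-- A maximum attained in V is also attained at a partner outside V, so V carries no curvature. -/
theorem IsEquiaffineImmersion.curvature_eq_zero_of_mem_doublePoints [T2Space M] (hn : 0 < n)
    (hΩ : Ω ≠ 0) (hf : IsEquiaffineImmersion Ω A f ξ) (hS : IsUnitEllipsoid Ω S)
    (hτ : totalAbsoluteCurvature Ω A f S = 2) {p : M} (hp : p ∈ doublePoints f) :
    curvature A f ξ p = 0 := by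
  obtain ⟨V, hV, hpV, h⟩ := hf.exists_nhds_of_mem_doublePoints hn hΩ hS hτ hp
  refine hf.curvature_eq_zero_of_max_off hn hΩ hS hτ hV (fun l _ => ?_) p hpV
  obtain ⟨r, hr⟩ := hf.exists_max p l
  by_cases hrV : r ∈ V
  · obtain ⟨q, hq, hqr⟩ := h r hrV
    exact ⟨q, hq, fun s => by rw [hqr]; exact hr s⟩
  · exact ⟨r, hrV, hr⟩

theorem IsEquiaffineImmersion.injective_of_totalAbsoluteCurvature_eq_two [T2Space M] (hn : 0 < n)
    (hΩ : Ω ≠ 0) (hf : IsEquiaffineImmersion Ω A f ξ) (hS : IsUnitEllipsoid Ω S)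
    (hτ : totalAbsoluteCurvature Ω A f S = 2) : Function.Injective f := by
  intro p q hpq
  by_contra hne
  have hp : p ∈ doublePoints f := ⟨q, Ne.symm hne, hpq.symm⟩
  obtain ⟨o, ho⟩ := hf.interior_hull_nonempty hn p
  have htr := hf.sub_notMem_range hn hΩ hS hτ ho
  obtain ⟨r, hr⟩ := hf.exists_curvature_ne_zero hn hΩ hS hτ
  refine hr (hf.curvature_eq_zero_of_mem_doublePoints hn hΩ hS hτ ?_)
  have hro : f r ≠ o := fun h => htr r ⟨0, by rw [map_zero, h, sub_self]⟩
  -- The double points are open and closed, so the ray through f(r) meets their image, and it does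
  -- so at f(r). Hence r is a double point, against its nonzero curvature.
  obtain ⟨d, hd, hdr⟩ := hf.eq_of_mem_frontier_of_mem_rayCone hn hΩ hS hτ ho
    (hf.mem_frontier_hull hn hΩ hS hτ r) (hf.compl_subset_rayCone hn htr
      (hf.isOpen_doublePoints hn hΩ hS hτ) hf.isClosed_doublePoints ⟨p, hp⟩ hro)
  by_cases hdr' : d = r
  · exact hdr' ▸ hd
  · exact ⟨d, hdr', hdr⟩

end Minimal

end Convex

end EquiaffineHypersurface

end

theorem theorem3p7 {n : ℕ} (hn : 0 < n)
    {M : Type*} [TopologicalSpace M] [T2Space M] [CompactSpace M]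
    [ChartedSpace (EuclideanSpace ℝ (Fin n)) M] [IsManifold (𝓡 n) ∞ M]
    [MeasurableSpace M] [BorelSpace M]
    (Ω : EquiaffineHypersurface.Ambient n [⋀^Fin (n + 1)]→ₗ[ℝ] ℝ) (hΩ : Ω ≠ 0)
    (A : EquiaffineHypersurface.EquiaffineStructure n M)
    (f ξ : M → EquiaffineHypersurface.Ambient n)
    (hf : EquiaffineHypersurface.IsEquiaffineImmersion Ω A f ξ)
    (S : Set (⋀[ℝ]^n (EquiaffineHypersurface.Ambient n)))
    (hS : EquiaffineHypersurface.IsUnitEllipsoid Ω S)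
    (hτ : EquiaffineHypersurface.totalAbsoluteCurvature Ω A f S = 2) :
    Topology.IsEmbedding f ∧ EquiaffineHypersurface.IsConvexHypersurface (Set.range f) := by
  -- Used only for the nonemptiness of M.
  obtain ⟨p₀, -⟩ := hf.exists_curvature_ne_zero hn hΩ hS hτ
  have hfc : Continuous f := hf.smooth.continuous
  refine ⟨(hfc.isClosedEmbedding
    (hf.injective_of_totalAbsoluteCurvature_eq_two hn hΩ hS hτ)).isEmbedding, ?_⟩
  exact ⟨_, EquiaffineHypersurface.isCompact_closure_convexHull (isCompact_range hfc),
    (convex_convexHull ℝ _).closure, hf.interior_hull_nonempty hn p₀,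
    hf.frontier_hull hn hΩ hS hτ p₀⟩
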